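/- Let $M$ be a smooth $5$-manifold with an irreducible $SO(3)$-structure, i.e. an oriented Riemannian manifold $(M,g)$ with a symmetric $3$-tensor $\Upsilon$ such that near every point there is a smooth oriented orthonormal frame $E_1,\dots,E_5$ (called adapted) with $$\Upsilon(X,X,X)=\tfrac12x_1(6x_2^2+6x_4^2-2x_1^2-3x_3^2-3x_5^2)+\tfrac{3\sqrt3}{2}x_4(x_5^2-x_3^2)+3\sqrt3\,x_2x_3x_5,\qquad X=\sum_i x_iE_i .$$ Identify bivectors with skew-symmetric endomorphisms by $g(\sigma x,y)=g(\sigma,x\wedge y)$, where $g(x\wedge y,u\wedge v)=g(x,u)g(y,v)-g(x,v)g(y,u)$. Define $\Upsilon_v$ by $g(\Upsilon_vx,y)=\Upsilon(v,x,y)$, let $\Lambda^2_3TM$ be the rank-$3$ bundle of endomorphisms $W$ with $4\sum_j\Upsilon_{W(e_j)}\circ\Upsilon_{e_j}=7W$ ($e_j$ an orthonormal basis), and let $\mathcal P:\Lambda^2TM\to\Lambda^2_3TM$ be the orthogonal projection. The twistor space is the $7$-manifold $\mathbb T=\{\sigma\in\Lambda^2_3TM:\ |\sigma|^2=5\}$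 with projection $\pi:\mathbb T\to M$, and for $\sigma\in\mathbb T$ we put $\xi_\sigma=\frac14*(\sigma\wedge\sigma)\in T_{\pi(\sigma)}M$. Let $\nabla$ be the characteristic connection, i.e. a smooth connection on $TM$ with $\nabla g=0$, $\nabla\Upsilon=0$ and totally skew-symmetric torsion. It induces a splitting $T\mathbb T=\mathcal V\oplus\mathcal H$ into the vertical and horizontal bundles, where $\mathcal V_\sigma=\{w\in\Lambda^2_3T_{\pi(\sigma)}M: w\perp\sigma\}$; denote by $X^h_\sigma$ the horizontal lift of $X$ at $\sigma$. For $t>0$ let $h_t$ be the Riemannian metric on $\mathbb T$ with $$h_t(X^h_\sigma+V,Y^h_\sigma+W)=g(X,Y)+t\,g(V,W),\qquad X,Y\in T_{\pi(\sigma)}M,\ V,W\in\mathcal V_\sigma,$$ and let $\chi$ be the vector field $\chi_\sigma=(\xi_\sigma)^h_\sigma$ on $\mathbb T$. Then, for every $t>0$: (i) if $\chi$ is a conformal Killing vector field of $h_t$, i.e. $\mathcal L_\chi h_t=f\,h_t$ for some function $f$ on $\mathbb T$, then $\chi$ is a Killing vector field, $\mathcal L_\chi h_t=0$; (ii) $\chi$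 is a Killing vector field of $h_t$ if and only if $\nabla$ has constant curvature $t^{-1}$, i.e. $t\,\mathcal R=\mathcal P$, where $g(\mathcal R(X\wedge Y),Z\wedge U)=g(R(X,Y)Z,U)$ and $R(X,Y)Z=-\nabla_X\nabla_YZ+\nabla_Y\nabla_XZ+\nabla_{[X,Y]}Z$. -/

import Mathlib

open Bundle Manifold Topology
open scoped Manifold ContDiff

noncomputable section

namespace SO3Twistor

/-- The model space of the five-dimensional manifolds considered here. -/
abbrev E5 : Type := EuclideanSpace ℝ (Fin 5)

/-! ### Linear algebra of the irreducible representation on a five-dimensional space -/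

/-- The `SO(3)`-invariant cubic polynomial on `ℝ⁵` (coordinates `x 0, …, x 4` are the usual
`x₁, …, x₅`). -/
def upsilonPoly (x : Fin 5 → ℝ) : ℝ :=
  1 / 2 * x 0 * (6 * x 1 ^ 2 + 6 * x 3 ^ 2 - 2 * x 0 ^ 2 - 3 * x 2 ^ 2 - 3 * x 4 ^ 2)
    + 3 * √3 / 2 * x 3 * (x 4 ^ 2 - x 2 ^ 2) + 3 * √3 * x 1 * x 2 * x 4

section Manifold

variable (M : Type*) [TopologicalSpace M] [ChartedSpace E5 M]

/-- The endomorphisms of the tangent space at `p`. The bivectors at `p` are the skew-symmetric ones: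
`σ ∈ Λ²T_pM` is identified with the endomorphism `S_σ` given by `g(S_σ x, y) = g(σ, x ∧ y)`. -/
abbrev EndT (p : M) : Type := TangentSpace (𝓡 5) p →L[ℝ] TangentSpace (𝓡 5) p

/-- The total space of the vector bundle `End(TM)`, a smooth manifold which contains `Λ²TM`. -/
abbrev EndTM : Type _ := TotalSpace (E5 →L[ℝ] E5) (fun p : M ↦ EndT M p)

/-- The model with corners of the total space of `End(TM)`. -/
abbrev IEnd := (𝓡 5).prod 𝓘(ℝ, E5 →L[ℝ] E5)

variable [IsManifold (𝓡 5) ∞ M]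

/-- An irreducible `SO(3)`-structure on a `5`-manifold: a Riemannian metric `g`, an orientation,
given by its volume form `vol`, and a symmetric `3`-tensor `Υ`, such that around each point there
is a smooth oriented orthonormal frame in which `Υ` is the standard invariant cubic form, i.e. the
frame bundle is reduced to the irreducibly embedded `SO(3) ⊂ SO(5)`. -/
structure IrreducibleSO3Structure where
  /-- the Riemannian metric -/
  g : ContMDiffRiemannianMetric (𝓡 5) ∞ E5 (fun p : M ↦ TangentSpace (𝓡 5) p)
  /-- the volume form of the oriented Riemannian manifold -/
  vol : (p : M) → (TangentSpace (𝓡 5) p) [⋀^Fin 5]→ₗ[ℝ] ℝ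
  /-- the symmetric `3`-tensor -/
  Υ : (p : M) → TangentSpace (𝓡 5) p →ₗ[ℝ] TangentSpace (𝓡 5) p →ₗ[ℝ] TangentSpace (𝓡 5) p →ₗ[ℝ] ℝ
  Υ_symm_left : ∀ (p : M) (x y z : TangentSpace (𝓡 5) p), Υ p x y z = Υ p y x z
  Υ_symm_right : ∀ (p : M) (x y z : TangentSpace (𝓡 5) p), Υ p x y z = Υ p x z y
  exists_adapted_frame : ∀ p : M, ∃ U : Set M, IsOpen U ∧ p ∈ U ∧
    ∃ e : Fin 5 → (x : M) → TangentSpace (𝓡 5) x,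
      (∀ i, ContMDiffOn (𝓡 5) ((𝓡 5).prod 𝓘(ℝ, E5)) ∞
        (fun x ↦ (⟨x, e i x⟩ : TotalSpace E5 (fun x : M ↦ TangentSpace (𝓡 5) x))) U) ∧
      ∀ x ∈ U, (∀ i j, g.inner x (e i x) (e j x) = if i = j then 1 else 0) ∧
        vol x (fun i ↦ e i x) = 1 ∧
        ∀ c : Fin 5 → ℝ,
          Υ x (∑ i, c i • e i x) (∑ i, c i • e i x) (∑ i, c i • e i x) = upsilonPoly c

variable {M}

namespace IrreducibleSO3Structure

variable (S : IrreducibleSO3Structure M)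

/-- A basis of `T_pM` is adapted if it is oriented, orthonormal, and `Υ` has the standard form in
the corresponding coordinates. -/
def IsAdapted (p : M) (a : Fin 5 → TangentSpace (𝓡 5) p) : Prop :=
  (∀ i j, S.g.inner p (a i) (a j) = if i = j then 1 else 0) ∧
    S.vol p a = 1 ∧
    ∀ c : Fin 5 → ℝ, S.Υ p (∑ i, c i • a i) (∑ i, c i • a i) (∑ i, c i • a i) = upsilonPoly c

theorem exists_isAdapted (p : M) : ∃ a : Fin 5 → TangentSpace (𝓡 5) p, S.IsAdapted p a := by
  obtain ⟨U, -, hp, e, -, he⟩ := S.exists_adapted_frame p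
  exact ⟨fun i ↦ e i p, he p hp⟩

/-- Some adapted basis of `T_pM`; only quantities which do not depend on the choice are built
from it. -/
def adaptedBasis (p : M) : Fin 5 → TangentSpace (𝓡 5) p :=
  Classical.choose (S.exists_isAdapted p)

/-- The inner product of two bivectors, for which
`g(x ∧ y, u ∧ v) = g(x, u) g(y, v) - g(x, v) g(y, u)`; in terms of skew-symmetric endomorphisms it
is `-½ tr (A ∘ B)`. -/
def bivInner {p : M} (A B : EndT M p) : ℝ :=
  -(1 / 2) * LinearMap.trace ℝ (TangentSpace (𝓡 5) p)
    ((A : TangentSpace (𝓡 5) p →ₗ[ℝ] TangentSpace (𝓡 5) p) ∘ₗ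
      (B : TangentSpace (𝓡 5) p →ₗ[ℝ] TangentSpace (𝓡 5) p))

/-- The bivector `x ∧ y`, as the endomorphism `u ↦ g(x, u) y - g(y, u) x`. -/
def wedge {p : M} (x y : TangentSpace (𝓡 5) p) : EndT M p :=
  (S.g.inner p x).smulRight y - (S.g.inner p y).smulRight x

/-- The subspace `Λ²₃T_pM`: the eigenspace for the eigenvalue `7` of the operator
`Υ̂(W) = 4 ∑ⱼ Υ_{W(eⱼ)} ∘ Υ_{eⱼ}`, where `g(Υ_v x, y) = Υ(v, x, y)` and `e` is an orthonormal
basis, so that `g(Υ̂(W)x, y) = 4 ∑ⱼₖ Υ(W eⱼ, eₖ, y) Υ(eⱼ, x, eₖ)`. -/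
def lambda23 (p : M) : Set (EndT M p) :=
  {W | ∀ e : Fin 5 → TangentSpace (𝓡 5) p,
    (∀ i j, S.g.inner p (e i) (e j) = if i = j then 1 else 0) →
    ∀ x y : TangentSpace (𝓡 5) p,
      4 * ∑ j, ∑ k, S.Υ p (W (e j)) (e k) y * S.Υ p (e j) x (e k) = 7 * S.g.inner p (W x) y}

/-- `P` is the orthogonal projection `𝒫 α` of the bivector `α` onto `Λ²₃T_pM`. -/
def IsProj23 {p : M} (α P : EndT M p) : Prop :=
  P ∈ S.lambda23 p ∧ ∀ τ ∈ S.lambda23 p, bivInner (α - P) τ = 0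

/-- The vector `ξ_σ = ¼ *(σ ∧ σ)`. For an oriented orthonormal basis `e`, with
`σ = ½ ∑ σᵢⱼ eᵢ ∧ eⱼ`, `σᵢⱼ = g(σ eᵢ, eⱼ)`, it is the vector such that
`g(ξ_σ, X) = ¼ · ¼ ∑ σᵢⱼ σₖₗ vol(eᵢ, eⱼ, eₖ, eₗ, X)`. -/
def xi {p : M} (σ : EndT M p) : TangentSpace (𝓡 5) p :=
  letI e := S.adaptedBasis p
  ∑ a, (1 / 16 * ∑ i, ∑ j, ∑ k, ∑ l,
    S.g.inner p (σ (e i)) (e j) * S.g.inner p (σ (e k)) (e l)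
      * S.vol p ![e i, e j, e k, e l, e a]) • e a

/-- The twistor space `𝕋 = {σ ∈ Λ²₃TM : |σ|² = 5}`, an embedded `7`-dimensional submanifold of the
total space of `End(TM)`. -/
def twistorSpace : Set (EndTM M) :=
  {σ | σ.2 ∈ S.lambda23 σ.1 ∧ bivInner σ.2 σ.2 = 5}

/-! ### Connections -/

/-- Covariant derivatives on the tangent bundle. -/
abbrev Connection (M : Type*) [TopologicalSpace M] [ChartedSpace E5 M]
    [IsManifold (𝓡 5) ∞ M] : Type _ :=
  CovariantDerivative (𝓡 5) E5 (fun p : M ↦ TangentSpace (𝓡 5) p)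

/-- A vector field on `M` is differentiable at `p`. -/
abbrev DiffAt (X : (x : M) → TangentSpace (𝓡 5) x) (p : M) : Prop :=
  MDifferentiableAt (𝓡 5) ((𝓡 5).prod 𝓘(ℝ, E5))
    (fun x ↦ (⟨x, X x⟩ : TotalSpace E5 (fun x : M ↦ TangentSpace (𝓡 5) x))) p

/-- `∇` is an `SO(3)`-connection: `∇g = 0` and `∇Υ = 0`. (In Mathlib, `∇ Y p v` is `∇_v Y`.) -/
structure IsSO3Connection (cov : Connection M) : Prop where
  metric : ∀ (p : M) (X Y : (x : M) → TangentSpace (𝓡 5) x), DiffAt X p → DiffAt Y p →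
    ∀ v : TangentSpace (𝓡 5) p,
      mvfderiv (𝓡 5) (fun x ↦ S.g.inner x (X x) (Y x)) p v
        = S.g.inner p (cov X p v) (Y p) + S.g.inner p (X p) (cov Y p v)
  upsilon : ∀ (p : M) (X Y Z : (x : M) → TangentSpace (𝓡 5) x),
    DiffAt X p → DiffAt Y p → DiffAt Z p → ∀ v : TangentSpace (𝓡 5) p,
      mvfderiv (𝓡 5) (fun x ↦ S.Υ x (X x) (Y x) (Z x)) p v
        = S.Υ p (cov X p v) (Y p) (Z p) + S.Υ p (X p) (cov Y p v) (Z p)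
          + S.Υ p (X p) (Y p) (cov Z p v)

/-- `∇` is a characteristic connection: an `SO(3)`-connection whose torsion
`T(X, Y, Z) = g(T(X, Y), Z)` is totally skew-symmetric. -/
structure IsCharacteristic (cov : Connection M) : Prop extends S.IsSO3Connection cov where
  skew_left : ∀ (p : M) (X Y Z : TangentSpace (𝓡 5) p),
    S.g.inner p (cov.torsion p X Y) Z = - S.g.inner p (cov.torsion p Y X) Z
  skew_right : ∀ (p : M) (X Y Z : TangentSpace (𝓡 5) p),
    S.g.inner p (cov.torsion p X Y) Z = - S.g.inner p (cov.torsion p X Z) Y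

/-- The curvature tensor `R(X, Y, Z) = -∇_X ∇_Y Z + ∇_Y ∇_X Z + ∇_{[X, Y]} Z` at `p`, computed by
extending the three tangent vectors to vector fields that are smooth near `p`. -/
def curvature (cov : Connection M) (p : M) (X Y Z : TangentSpace (𝓡 5) p) :
    TangentSpace (𝓡 5) p :=
  letI X' := FiberBundle.extend E5 (E := fun p : M ↦ TangentSpace (𝓡 5) p) X
  letI Y' := FiberBundle.extend E5 (E := fun p : M ↦ TangentSpace (𝓡 5) p) Y
  letI Z' := FiberBundle.extend E5 (E := fun p : M ↦ TangentSpace (𝓡 5) p) Z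
  cov (fun x ↦ cov Z' x (X' x)) p Y - cov (fun x ↦ cov Z' x (Y' x)) p X
    + cov Z' p (VectorField.mlieBracket (𝓡 5) X' Y' p)

/-- `∇` has constant curvature `c`: the curvature operator `𝓡`, given by
`g(𝓡(X ∧ Y), Z ∧ U) = g(R(X, Y)Z, U)` (so that `𝓡(X ∧ Y)` is the endomorphism `Z ↦ R(X, Y)Z`),
equals `c 𝒫`, with `𝒫` the orthogonal projection onto `Λ²₃TM`. -/
def HasConstantCurvature (cov : Connection M) (c : ℝ) : Prop :=
  ∀ (p : M) (X Y : TangentSpace (𝓡 5) p), ∃ P : EndT M p, S.IsProj23 (S.wedge X Y) P ∧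
    ∀ Z : TangentSpace (𝓡 5) p, curvature cov p X Y Z = c • P Z

/-! ### The induced connection on `End(TM)` -/

/-- A section of `End(TM)` is differentiable at `p`. -/
abbrev EndDiffAt (s : (x : M) → EndT M x) (p : M) : Prop :=
  MDifferentiableAt (𝓡 5) IEnd (fun x ↦ (⟨x, s x⟩ : EndTM M)) p

theorem tensorialAt_endCov (cov : Connection M) {s : (x : M) → EndT M x} {p : M}
    (hs : EndDiffAt s p) (v : TangentSpace (𝓡 5) p) :
    TensorialAt (𝓡 5) E5
      (fun Y : (x : M) → TangentSpace (𝓡 5) x ↦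
        cov (fun x ↦ s x (Y x)) p v - s p (cov Y p v)) p where
  smul {f Y} hf hY := by
    have hsY : DiffAt (fun x ↦ s x (Y x)) p := MDifferentiableAt.clm_bundle_apply hs hY
    have h1 : (fun x ↦ s x ((f • Y) x)) = f • (fun x ↦ s x (Y x)) := by
      funext x; simp
    rw [h1, cov.isCovariantDerivativeOn.leibniz (s := Set.univ) hsY hf,
      cov.isCovariantDerivativeOn.leibniz (s := Set.univ) hY hf]
    simp [smul_sub]
  add {Y Y'} hY hY' := by
    have hsY : DiffAt (fun x ↦ s x (Y x)) p := MDifferentiableAt.clm_bundle_apply hs hY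
    have hsY' : DiffAt (fun x ↦ s x (Y' x)) p := MDifferentiableAt.clm_bundle_apply hs hY'
    have h1 : (fun x ↦ s x ((Y + Y') x)) = (fun x ↦ s x (Y x)) + (fun x ↦ s x (Y' x)) := by
      funext x; simp
    rw [h1, cov.isCovariantDerivativeOn.add (s := Set.univ) hsY hsY',
      cov.isCovariantDerivativeOn.add (s := Set.univ) hY hY']
    simp only [add_apply, map_add]
    abel

/-- The connection induced by `∇` on `End(TM)`: `(∇_v s)(Y) = ∇_v (s(Y)) - s(∇_v Y)`. -/
def endCov (cov : Connection M) {s : (x : M) → EndT M x} {p : M} (hs : EndDiffAt s p)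
    (v : TangentSpace (𝓡 5) p) : EndT M p :=
  TensorialAt.mkHom _ p (tensorialAt_endCov cov hs v)

/-- A local section of `End(TM)` through `σ`, constant in the preferred trivialization at the base
point of `σ`. -/
def extSection (σ : EndTM M) : (x : M) → EndT M x :=
  FiberBundle.extend (E5 →L[ℝ] E5) (E := fun x : M ↦ EndT M x) σ.2

theorem endDiffAt_extSection (σ : EndTM M) : EndDiffAt (extSection σ) σ.1 :=
  FiberBundle.mdifferentiableAt_extend (𝓡 5) (E5 →L[ℝ] E5) (V := fun x : M ↦ EndT M x) σ.2

/-! ### Tangent vectors of `End(TM)`, horizontal lifts, and the connection map -/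

/-- The vertical tangent vector at `σ` given by the endomorphism `w`: the velocity of
`r ↦ σ + r w`. -/
def vlift (σ : EndTM M) (w : EndT M σ.1) : TangentSpace IEnd σ :=
  mfderiv 𝓘(ℝ, ℝ) IEnd (fun r : ℝ ↦ (⟨σ.1, σ.2 + r • w⟩ : EndTM M)) 0 (1 : ℝ)

/-- The horizontal lift of `X` at `σ`: `ds(X) - (∇_X s)ᵛ` for a section `s` through `σ`. -/
def hlift (cov : Connection M) (σ : EndTM M) (X : TangentSpace (𝓡 5) σ.1) :
    TangentSpace IEnd σ :=
  letI u : TangentSpace IEnd σ :=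
    mfderiv (𝓡 5) IEnd (fun x ↦ (⟨x, extSection σ x⟩ : EndTM M)) σ.1 X
  u - vlift σ (endCov cov (endDiffAt_extSection σ) X)

/-- The differential of the bundle projection. -/
def dproj (σ : EndTM M) (A : TangentSpace IEnd σ) : TangentSpace (𝓡 5) σ.1 :=
  mfderiv IEnd (𝓡 5) (fun e : EndTM M ↦ e.1) σ A

/-- The connection map of `∇`, i.e. the vertical component of the tangent vector `A` at `σ`, as an
endomorphism. It is linear, sends `ds(X)` to `∇_X s`, and `wᵛ` to `w`: in the
preferred trivialization, add to the fibre component of `A` the covariant derivative of the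
constant section through `σ`. -/
def connMap (cov : Connection M) (σ : EndTM M) (A : TangentSpace IEnd σ) : EndT M σ.1 :=
  letI tr := trivializationAt (E5 →L[ℝ] E5) (fun x : M ↦ EndT M x) σ.1
  letI w : E5 →L[ℝ] E5 := mvfderiv IEnd (fun e : EndTM M ↦ (tr e).2) σ A
  tr.symm σ.1 w + endCov cov (endDiffAt_extSection σ) (dproj σ A)

/-- The tangent space of the twistor space at `σ ∈ 𝕋`, as a set of tangent vectors to the total
space of `End(TM)`: the sum of the horizontal space and of the vertical space
`𝓥_σ = {w ∈ Λ²₃ : w ⊥ σ}`. -/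
def twistorTangent (cov : Connection M) (σ : EndTM M) : Set (TangentSpace IEnd σ) :=
  {A | connMap cov σ A ∈ S.lambda23 σ.1 ∧ bivInner (connMap cov σ A) σ.2 = 0}

/-- The metric `h_t(Xʰ + V, Yʰ + W) = g(X, Y) + t g(V, W)`. -/
def hMetric (cov : Connection M) (t : ℝ) (σ : EndTM M) (A B : TangentSpace IEnd σ) : ℝ :=
  S.g.inner σ.1 (dproj σ A) (dproj σ B) + t * bivInner (connMap cov σ A) (connMap cov σ B)

/-- The characteristic vector field `χ_σ = (ξ_σ)ʰ_σ`. -/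
def chi (cov : Connection M) (σ : EndTM M) : TangentSpace IEnd σ :=
  hlift cov σ (S.xi σ.2)

/-- `A` represents a smooth vector field on the open subset `U ∩ 𝕋` of the twistor space: it is a
smooth vector field on the open subset `U` of the ambient manifold, tangent to `𝕋` along `U ∩ 𝕋`.
-/
def IsTwistorField (cov : Connection M) (U : Set (EndTM M))
    (A : (σ : EndTM M) → TangentSpace IEnd σ) : Prop :=
  ContMDiffOn IEnd (IEnd.prod 𝓘(ℝ, E5 × (E5 →L[ℝ] E5))) ∞
      (fun σ ↦ (⟨σ, A σ⟩ : TotalSpace (E5 × (E5 →L[ℝ] E5))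
        (fun σ : EndTM M ↦ TangentSpace IEnd σ))) U ∧
    ∀ σ ∈ U ∩ S.twistorSpace, A σ ∈ S.twistorTangent cov σ

/-- The Lie derivative
`(𝓛_χ h_t)(A, B) = χ(h_t(A, B)) - h_t([χ, A], B) - h_t(A, [χ, B])` at `σ`. -/
def lieDerivMetric (cov : Connection M) (t : ℝ) (A B : (σ : EndTM M) → TangentSpace IEnd σ)
    (σ : EndTM M) : ℝ :=
  mvfderiv IEnd (fun τ : EndTM M ↦ S.hMetric cov t τ (A τ) (B τ)) σ (S.chi cov σ)
    - S.hMetric cov t σ (VectorField.mlieBracket IEnd (S.chi cov) A σ) (B σ)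
    - S.hMetric cov t σ (A σ) (VectorField.mlieBracket IEnd (S.chi cov) B σ)

/-- `χ` is a Killing vector field of `(𝕋, h_t)`: `𝓛_χ h_t = 0` on `𝕋`. -/
def IsKilling (cov : Connection M) (t : ℝ) : Prop :=
  ∀ σ ∈ S.twistorSpace, ∀ U : Set (EndTM M), IsOpen U → σ ∈ U →
    ∀ A B : (σ : EndTM M) → TangentSpace IEnd σ,
      S.IsTwistorField cov U A → S.IsTwistorField cov U B →
        S.lieDerivMetric cov t A B σ = 0

/-- `χ` is a conformal Killing vector field of `(𝕋, h_t)`: `𝓛_χ h_t = f h_t` on `𝕋` for some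
function `f` on `𝕋`. -/
def IsConformalKilling (cov : Connection M) (t : ℝ) : Prop :=
  ∃ f : S.twistorSpace → ℝ, ∀ σ : S.twistorSpace, ∀ U : Set (EndTM M), IsOpen U → σ.1 ∈ U →
    ∀ A B : (σ : EndTM M) → TangentSpace IEnd σ,
      S.IsTwistorField cov U A → S.IsTwistorField cov U B →
        S.lieDerivMetric cov t A B σ = f σ * S.hMetric cov t σ (A σ) (B σ)

end IrreducibleSO3Structure

end Manifold

end SO3Twistor

end

/-!
The proof computes the Lie derivative of `h_t` along `χ` in an adapted frame of `M`.

*Algebra.* In an adapted basis, `Λ²₃` consists of the matrices `so3Mat v` with `v ∈ ℝ³`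
(`IsAdapted.mem_lambda23`). These form the Lie algebra `so(3) ⊆ so(5)` of the stabilizer of `Υ`,
with the cross product as the bracket (`so3Mat_lie`), and `𝕋` is locally `M × S²`. The vector `ξ_v`
is a quadratic polynomial in `v` with values in `ℝ⁵` (`quad`, `IsAdapted.xi_eq`), which is
equivariant (`quadPolar_cross`).

*Connection.* As `g` and `Υ` are parallel, the connection forms of an adapted frame take values in
`so(3)` (`AdaptedFrame.exists_conn_eq_so3Mat`), and so do the curvature forms
(`AdaptedFrame.exists_curv_eq_so3Mat`). Therefore the curvature is given by a bilinear map `Λ²ℝ⁵ →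
ℝ³`, which can be compared with the projection `𝒫`; the difference `D = 𝒫 - t 𝓡` is
`AdaptedFrame.defect`.

*Lie derivative.* A vector field on `End(TM)` has horizontal and vertical components in the frame,
and the components of a Lie bracket follow from those of the brackets of the frame and from Cartan's
structure equation (`AdaptedFrame.hcoeff_mlieBracket`, `AdaptedFrame.vmat_mlieBracket`). In `(𝓛_χ
h_t)(A, B)`, the terms that involve the connection forms vanish by equivariance, together with the
total skewness of the torsion (`AdaptedFrame.sum_torsion`). What remains is a derivative of `ξ` in a
vertical direction, which gives the projection `𝒫`, and the curvature term in the bracket of two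
horizontal fields. At a point with coordinates `v ∈ S²` the result is `5 D(ξ_v, b) · (v × w_A) + 5
D(ξ_v, a) · (v × w_B)`, where `a`, `b` are the horizontal and `w_A`, `w_B` the vertical components
of `A`, `B` (`AdaptedFrame.lieDerivMetric_eq_defect`).

*Conclusion.* This vanishes if both `A` and `B` are horizontal, so that a conformal factor must be
zero (`isKilling_of_isConformalKilling`). If `χ` is Killing, then `D(ξ_v, b)` is a multiple of `v`
for all `v ∈ S²` and `b ∈ ℝ⁵`. For independent `v`, `w` the vector `D(ξ_v, ξ_w)` is then a multiple
both of `v` and of `w`, hence zero; as the vectors `ξ_v` span `ℝ⁵`, this forces `D = 0`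
(`eq_zero_of_cross_eq_zero`). Finally, `D = 0` says that `∇` has constant curvature `t⁻¹`
(`AdaptedFrame.curvature_eq_iff`).
-/

/-! ### Derivations and vector fields on manifolds -/

section VectorFields

variable {E H N F : Type*} [NormedAddCommGroup E] [NormedSpace ℝ E] [TopologicalSpace H]
  {I : ModelWithCorners ℝ E H} [TopologicalSpace N] [ChartedSpace H N] [IsManifold I ∞ N]
  [NormedAddCommGroup F] [NormedSpace ℝ F]

theorem trivializationAt_snd_eq_mvfderiv {x y : N} (hy : y ∈ (chartAt H x).source)
    (v : TangentSpace I y) :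
    (trivializationAt E (TangentSpace I) x ⟨y, v⟩).2 = mvfderiv I (extChartAt I x) y v := by
  have : IsManifold I 1 N := IsManifold.of_le (n := ∞) (by simp)
  have h2 := congrArg (fun L : TangentSpace I y →L[ℝ] E ↦ L v)
    (TangentBundle.continuousLinearMapAt_trivializationAt (I := I) hy)
  refine Eq.trans ?_ h2
  rw [Trivialization.continuousLinearMapAt_apply_of_mem]
  simpa using hy

/-- A vector field is smooth at `x` iff the derivatives along it of the coordinates of the chart
at `x` are. -/
theorem contMDiffAt_vectorField_iff {V : (x : N) → TangentSpace I x} {x : N} :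
    ContMDiffAt I (I.prod 𝓘(ℝ, E)) ∞ (fun y ↦ (⟨y, V y⟩ : TangentBundle I N)) x ↔
      ContMDiffAt I 𝓘(ℝ, E) ∞ (fun y ↦ mvfderiv I (extChartAt I x) y (V y)) x := by
  have : IsManifold I 1 N := IsManifold.of_le (n := ∞) (by simp)
  rw [contMDiffAt_section]
  apply Filter.EventuallyEq.contMDiffAt_iff
  filter_upwards [(chartAt H x).open_source.mem_nhds (mem_chart_source H x)] with y hy
    using trivializationAt_snd_eq_mvfderiv hy (V y)

/-- The derivative of a smooth function along a smooth vector field is smooth. -/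
theorem ContMDiffAt.mvfderiv_vectorField {V : (x : N) → TangentSpace I x} {x : N} {f : N → F}
    (hf : ContMDiffAt I 𝓘(ℝ, F) ∞ f x)
    (hV : ContMDiffAt I (I.prod 𝓘(ℝ, E)) ∞ (fun y ↦ (⟨y, V y⟩ : TangentBundle I N)) x) :
    ContMDiffAt I 𝓘(ℝ, F) ∞ (fun y ↦ mvfderiv I f y (V y)) x := by
  have : IsManifold I 1 N := IsManifold.of_le (n := ∞) (by simp)
  have h1 := ContMDiffAt.mfderiv_const (m := ∞) hf (by simp)
  rw [contMDiffAt_section] at hV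
  refine (h1.clm_apply hV).congr_of_eventuallyEq ?_
  filter_upwards [(chartAt H x).open_source.mem_nhds (mem_chart_source H x)] with y hy
  have hy' : y ∈ (extChartAt I x).source := by simpa using hy
  have h0 := inTangentCoordinates_eq_mfderiv_comp (I := I) (I' := 𝓘(ℝ, F)) (f := id) (g := f)
    (ϕ := fun z ↦ mfderiv I 𝓘(ℝ, F) f z) (x₀ := x) (x := y) hy (by rw [chartAt_self_eq]; trivial)
  have h2 : (trivializationAt E (TangentSpace I) x ⟨y, V y⟩).2
      = mfderiv I 𝓘(ℝ, E) (extChartAt I x) y (V y) :=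
    trivializationAt_snd_eq_mvfderiv hy (V y)
  have h3 := congrArg (fun L : TangentSpace I y →L[ℝ] TangentSpace I y ↦ L (V y))
    (mfderivWithin_extChartAt_symm_comp_mfderiv_extChartAt' (I := I) hy')
  have h4 : mfderiv 𝓘(ℝ, F) 𝓘(ℝ, F) (extChartAt 𝓘(ℝ, F) (f x)) (f y)
      = ContinuousLinearMap.id ℝ _ := by
    rw [extChartAt_model_space_eq_id]
    exact mfderiv_id
  have h5 := congrArg (fun L : E →L[ℝ] F ↦
    L ((trivializationAt E (TangentSpace I) x ⟨y, V y⟩).2)) h0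
  refine Eq.trans ?_ h5.symm
  have h6 := congrArg (fun w : E ↦ ((mfderiv 𝓘(ℝ, F) 𝓘(ℝ, F) (extChartAt 𝓘(ℝ, F) (f x)) (f y)) ∘L
    (mfderiv I 𝓘(ℝ, F) f y) ∘L (mfderivWithin 𝓘(ℝ, E) I (extChartAt I x).symm (Set.range I)
      (extChartAt I x y))) w) h2
  refine Eq.trans ?_ h6.symm
  have h7 := congrArg (fun w : TangentSpace I y ↦ ((mfderiv 𝓘(ℝ, F) 𝓘(ℝ, F)
    (extChartAt 𝓘(ℝ, F) (f x)) (f y)) ∘L (mfderiv I 𝓘(ℝ, F) f y)) w) h3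
  refine Eq.trans ?_ h7.symm
  rw [h4]
  rfl

/-- The Lie bracket is the commutator of derivations: `[V, W] f = V (W f) - W (V f)`. It is proved
in the chart at `x`, where it is the symmetry of the second derivative. -/
theorem mvfderiv_mlieBracket [CompleteSpace E] {V W : (x : N) → TangentSpace I x} {x : N}
    {f : N → F}
    (hf : ContMDiffAt I 𝓘(ℝ, F) ∞ f x)
    (hV : ContMDiffAt I (I.prod 𝓘(ℝ, E)) ∞ (fun y ↦ (⟨y, V y⟩ : TangentBundle I N)) x)
    (hW : ContMDiffAt I (I.prod 𝓘(ℝ, E)) ∞ (fun y ↦ (⟨y, W y⟩ : TangentBundle I N)) x)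
    (hx : extChartAt I x x ∈ closure (interior (Set.range I))) :
    mvfderiv I f x (VectorField.mlieBracket I V W x)
      = mvfderiv I (fun y ↦ mvfderiv I f y (W y)) x (V x)
        - mvfderiv I (fun y ↦ mvfderiv I f y (V y)) x (W x) := by
  have : IsManifold I 1 N := IsManifold.of_le (n := ∞) (by simp)
  have : IsManifold I 2 N := IsManifold.of_le (n := ∞) (by exact WithTop.coe_le_coe.2 le_top)
  set φ := extChartAt I x with hφ
  have hdf := hf.mdifferentiableAt (by simp)
  have hev : ∀ᶠ y in 𝓝 x, MDifferentiableAt I 𝓘(ℝ, F) f y := by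
    have h1 : ContMDiffAt I 𝓘(ℝ, F) 1 f x := hf.of_le (by simp)
    have h2 := contMDiffAt_iff_contMDiffAt_nhds (by simp) |>.1 h1
    filter_upwards [h2] with y hy using hy.mdifferentiableAt (by simp)
  have hev2 : ∀ᶠ z in 𝓝[Set.range I] (φ x),
      z ∈ φ.target ∧ MDifferentiableAt I 𝓘(ℝ, F) f (φ.symm z) := by
    have h1 := (continuousAt_extChartAt_symm (I := I) x)
    have h2 := h1.tendsto
    rw [extChartAt_to_inv] at h2
    have h3 := (h2.eventually hev).filter_mono (nhdsWithin_le_nhds (s := Set.range I))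
    filter_upwards [h3, extChartAt_target_mem_nhdsWithin (I := I) x] with z hz hz2 using ⟨hz2, hz⟩
  have key : ∀ Z : (x : N) → TangentSpace I x,
      ContMDiffAt I (I.prod 𝓘(ℝ, E)) ∞ (fun y ↦ (⟨y, Z y⟩ : TangentBundle I N)) x → ∀ v : E,
      mvfderiv I (fun y ↦ mvfderiv I f y (Z y)) x v =
        fderivWithin ℝ (fun z ↦ fderivWithin ℝ (f ∘ φ.symm) (Set.range I) z
          (VectorField.mpullbackWithin 𝓘(ℝ, E) I φ.symm Z (Set.range I) z))
          (Set.range I) (φ x) v := by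
    intro Z hZ v
    rw [((hf.mvfderiv_vectorField hZ).mdifferentiableAt (by simp)).mvfderiv]
    have : fderivWithin ℝ (writtenInExtChartAt I 𝓘(ℝ, F) x (fun y ↦ mvfderiv I f y (Z y)))
        (Set.range I) (φ x) = fderivWithin ℝ (fun z ↦ fderivWithin ℝ (f ∘ φ.symm) (Set.range I) z
          (VectorField.mpullbackWithin 𝓘(ℝ, E) I φ.symm Z (Set.range I) z))
          (Set.range I) (φ x) := by
      apply Filter.EventuallyEq.fderivWithin_eq_of_mem _ (by simp [hφ])
      filter_upwards [hev2] with z ⟨hz1, hz2⟩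
      have hr : z ∈ Set.range I := extChartAt_target_subset_range x hz1
      have h1 := mfderiv_comp_mfderivWithin (I := 𝓘(ℝ, E)) (I' := I) (I'' := 𝓘(ℝ, F)) z hz2
        (mdifferentiableWithinAt_extChartAt_symm hz1) (I.uniqueMDiffOn z hr)
      rw [mfderivWithin_eq_fderivWithin] at h1
      have h2 := congrArg (fun L : E →L[ℝ] F ↦
        L (VectorField.mpullbackWithin 𝓘(ℝ, E) I φ.symm Z (Set.range I) z)) h1
      refine Eq.trans ?_ h2.symm
      have h3 := (isInvertible_mfderivWithin_extChartAt_symm (I := I) hz1).self_apply_inverse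
        (Z (φ.symm z))
      have h4 := congrArg (fun v ↦ mfderiv I 𝓘(ℝ, F) f (φ.symm z) v) h3
      exact h4.symm
    exact congrArg (fun L : E →L[ℝ] F => L v) this
  have hb : VectorField.mlieBracket I V W x = (VectorField.lieBracketWithin ℝ
      (VectorField.mpullbackWithin 𝓘(ℝ, E) I φ.symm V (Set.range I))
      (VectorField.mpullbackWithin 𝓘(ℝ, E) I φ.symm W (Set.range I))
      (Set.range I) (φ x) : E) := by
    rw [← VectorField.mlieBracketWithin_univ, VectorField.mlieBracketWithin_apply,
      Set.preimage_univ, Set.univ_inter, mfderiv_extChartAt_self]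
    exact congrArg (fun L : E →L[ℝ] E ↦ L _) (ContinuousLinearMap.inverse_id (R := ℝ) (M := E))
  have hd : ∀ Z : (x : N) → TangentSpace I x,
      ContMDiffAt I (I.prod 𝓘(ℝ, E)) ∞ (fun y ↦ (⟨y, Z y⟩ : TangentBundle I N)) x →
      DifferentiableWithinAt ℝ (VectorField.mpullbackWithin 𝓘(ℝ, E) I φ.symm Z (Set.range I))
        (Set.range I) (φ x) ∧
      VectorField.mpullbackWithin 𝓘(ℝ, E) I φ.symm Z (Set.range I) (φ x) = Z x := by
    intro Z hZ
    have h1 := (hZ.mdifferentiableAt (by simp)).mdifferentiableWithinAt (s := Set.univ)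
    have h2 := h1.differentiableWithinAt_mpullbackWithin_vectorField
    rw [Set.preimage_univ, Set.univ_inter] at h2
    refine ⟨h2, ?_⟩
    have h3 : VectorField.mpullbackWithin 𝓘(ℝ, E) I φ.symm Z (Set.range I) (φ x)
      = (mfderivWithin 𝓘(ℝ, E) I φ.symm (Set.range I) (φ x)).inverse (Z (φ.symm (φ x))) := rfl
    rw [h3, mfderivWithin_range_extChartAt_symm]
    have h4 : (Z (φ.symm (φ x)) : E) = (Z x : E) := by
      rw [show φ.symm (φ x) = x from extChartAt_to_inv x]
    exact (congrArg (fun L : E →L[ℝ] E ↦ L _)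
      (ContinuousLinearMap.inverse_id (R := ℝ) (M := E))).trans h4
  obtain ⟨hV1, hV2⟩ := hd V hV
  obtain ⟨hW1, hW2⟩ := hd W hW
  have hfc : ContDiffWithinAt ℝ 2 (f ∘ φ.symm) (Set.range I) (φ x) := by
    have := (contMDiffAt_iff.1 (hf.of_le (m := 2) (by exact WithTop.coe_le_coe.2 le_top))).2
    rwa [extChartAt_model_space_eq_id] at this
  have hL := VectorField.fderivWithin_apply_lieBracket hfc (by simp)
    I.uniqueDiffOn hx (by simp [hφ]) hW1 hV1
  have e1 := congrArg (fun v : E ↦ mvfderiv I f x v) hb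
  refine e1.trans ?_
  have e2 := congrArg (fun L : E →L[ℝ] F ↦ L (VectorField.lieBracketWithin ℝ
      (VectorField.mpullbackWithin 𝓘(ℝ, E) I φ.symm V (Set.range I))
      (VectorField.mpullbackWithin 𝓘(ℝ, E) I φ.symm W (Set.range I))
      (Set.range I) (φ x) : E)) hdf.mvfderiv
  refine e2.trans (Eq.trans hL ?_)
  have e3 := key W hW (V x)
  have e4 := key V hV (W x)
  refine Eq.trans ?_ (congrArg₂ (fun a b : F ↦ a - b) e3 e4).symm
  have e5 : ∀ L L' : E →L[ℝ] F, ∀ v v' w w' : E, v = v' → w = w' → L v - L' w = L v' - L' w' := by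
    rintro L L' v v' w w' rfl rfl; rfl
  exact e5 _ _ _ _ _ _ hV2 hW2

end VectorFields

/-! ### Lie brackets of fields expressed in a frame of the base -/

section FrameBracket

variable {E H N F : Type*} [NormedAddCommGroup E] [NormedSpace ℝ E] [TopologicalSpace H]
  {I : ModelWithCorners ℝ E H} [TopologicalSpace N] [ChartedSpace H N]
  [NormedAddCommGroup F] [NormedSpace ℝ F]

theorem mvfderiv_congr {f g : N → F} {x : N} (h : f =ᶠ[𝓝 x] g) (v : TangentSpace I x) :
    mvfderiv I f x v = mvfderiv I g x v :=
  congrArg (fun L : TangentSpace I x →L[ℝ] F ↦ L v) h.mfderiv_eq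

theorem mvfderiv_sum_smul {ι : Type*} (s : Finset ι) {c : ι → N → ℝ} {g : ι → N → F} {x : N}
    (hc : ∀ i, ContMDiffAt I 𝓘(ℝ, ℝ) ∞ (c i) x) (hg : ∀ i, ContMDiffAt I 𝓘(ℝ, F) ∞ (g i) x)
    (v : TangentSpace I x) :
    mvfderiv I (fun y ↦ ∑ i ∈ s, c i y • g i y) x v =
      ∑ i ∈ s, (mvfderiv I (c i) x v • g i x + c i x • mvfderiv I (g i) x v) := by
  classical
  have hcd : ∀ i, MDifferentiableAt I 𝓘(ℝ, ℝ) (c i) x := fun i ↦ (hc i).mdifferentiableAt (by simp)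
  have hgd : ∀ i, MDifferentiableAt I 𝓘(ℝ, F) (g i) x := fun i ↦ (hg i).mdifferentiableAt (by simp)
  have hs : ∀ i, ContMDiffAt I 𝓘(ℝ, F) ∞ (fun y ↦ c i y • g i y) x := fun i ↦ (hc i).smul (hg i)
  induction s using Finset.induction_on with
  | empty => simp [mvfderiv_const]
  | insert a s ha ih =>
    simp only [Finset.sum_insert ha]
    have h2 : ContMDiffAt I 𝓘(ℝ, F) ∞ (fun y ↦ ∑ i ∈ s, c i y • g i y) x :=
      ContMDiffAt.sum fun i _ ↦ hs i
    rw [mvfderiv_fun_add ((hs a).mdifferentiableAt (by simp)) (h2.mdifferentiableAt (by simp)),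
      mvfderiv_fun_smul (hcd a) (hgd a), add_apply, ih]
    simp [add_comm]

theorem mvfderiv_sum_mul {ι : Type*} (s : Finset ι) {c g : ι → N → ℝ} {x : N}
    (hc : ∀ i, ContMDiffAt I 𝓘(ℝ, ℝ) ∞ (c i) x) (hg : ∀ i, ContMDiffAt I 𝓘(ℝ, ℝ) ∞ (g i) x)
    (v : TangentSpace I x) :
    mvfderiv I (fun y ↦ ∑ i ∈ s, c i y * g i y) x v =
      ∑ i ∈ s, (mvfderiv I (c i) x v * g i x + c i x * mvfderiv I (g i) x v) :=
  mvfderiv_sum_smul s hc hg v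

theorem mvfderiv_sum {ι : Type*} (s : Finset ι) {g : ι → N → F} {x : N}
    (hg : ∀ i, ContMDiffAt I 𝓘(ℝ, F) ∞ (g i) x) (v : TangentSpace I x) :
    mvfderiv I (fun y ↦ ∑ i ∈ s, g i y) x v = ∑ i ∈ s, mvfderiv I (g i) x v := by
  have := mvfderiv_sum_smul s (c := fun _ _ ↦ (1 : ℝ)) (fun _ ↦ contMDiffAt_const) hg v
  simpa [mvfderiv_const] using this

variable {E' H' M : Type*} [NormedAddCommGroup E'] [NormedSpace ℝ E'] [TopologicalSpace H']
  {J : ModelWithCorners ℝ E' H'} [TopologicalSpace M] [ChartedSpace H' M]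

theorem mvfderiv_comp_eq {f : M → F} {q : N → M} (x : N)
    (hf : MDifferentiableAt J 𝓘(ℝ, F) f (q x)) (hq : MDifferentiableAt I J q x)
    (v : TangentSpace I x) :
    mvfderiv I (f ∘ q) x v = mvfderiv J f (q x) (mfderiv I J q x v) :=
  mfderiv_comp_apply x hf hq v

variable [CompleteSpace E'] [J.Boundaryless] [IsManifold I ∞ N] [IsManifold J ∞ M] [CompleteSpace E]

/-- If the fields `V` and `W` on `N` project to `∑ vʲ eⱼ` and `∑ wⁱ eᵢ`, where the `eᵢ` are vector
fields on `M`, then `[V, W]` projects to `∑ (V wⁱ - W vⁱ) eᵢ + ∑ vʲ wⁱ [eⱼ, eᵢ]`. -/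
theorem mfderiv_mlieBracket_frame {ι : Type*} [Fintype ι] {q : N → M} {n : N}
    (hn : extChartAt I n n ∈ closure (interior (Set.range I)))
    (hq : ContMDiffAt I J ∞ q n)
    {V W : (x : N) → TangentSpace I x}
    (hV : ContMDiffAt I (I.prod 𝓘(ℝ, E)) ∞ (fun y ↦ (⟨y, V y⟩ : TangentBundle I N)) n)
    (hW : ContMDiffAt I (I.prod 𝓘(ℝ, E)) ∞ (fun y ↦ (⟨y, W y⟩ : TangentBundle I N)) n)
    {e : ι → (x : M) → TangentSpace J x}
    (he : ∀ i, ContMDiffAt J (J.prod 𝓘(ℝ, E')) ∞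
      (fun y ↦ (⟨y, e i y⟩ : TangentBundle J M)) (q n))
    {v w : ι → N → ℝ} (hv : ∀ i, ContMDiffAt I 𝓘(ℝ, ℝ) ∞ (v i) n)
    (hw : ∀ i, ContMDiffAt I 𝓘(ℝ, ℝ) ∞ (w i) n)
    (hVv : ∀ᶠ y in 𝓝 n, mfderiv I J q y (V y) = ∑ i, v i y • e i (q y))
    (hWw : ∀ᶠ y in 𝓝 n, mfderiv I J q y (W y) = ∑ i, w i y • e i (q y)) :
    mfderiv I J q n (VectorField.mlieBracket I V W n) =
      ∑ i, (mvfderiv I (w i) n (V n) - mvfderiv I (v i) n (W n)) • e i (q n)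
      + ∑ j, ∑ i, (v j n * w i n) • VectorField.mlieBracket J (e j) (e i) (q n) := by
  have : IsManifold J 1 M := IsManifold.of_le (n := ∞) (by simp)
  have : IsManifold I 1 N := IsManifold.of_le (n := ∞) (by simp)
  let φ : M → E' := extChartAt J (q n)
  have hφ : ContMDiffAt J 𝓘(ℝ, E') ∞ φ (q n) := contMDiffAt_extChartAt
  have hφq : ContMDiffAt I 𝓘(ℝ, E') ∞ (φ ∘ q) n := hφ.comp n hq
  -- the coordinates of the `eᵢ`
  let ε : ι → M → E' := fun i x ↦ mvfderiv J φ x (e i x)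
  have hε : ∀ i, ContMDiffAt J 𝓘(ℝ, E') ∞ (ε i) (q n) := fun i ↦ hφ.mvfderiv_vectorField (he i)
  have hεq : ∀ i, ContMDiffAt I 𝓘(ℝ, E') ∞ (ε i ∘ q) n := fun i ↦ (hε i).comp n hq
  have hnear : ∀ᶠ y in 𝓝 n, MDifferentiableAt J 𝓘(ℝ, E') φ (q y) ∧
      MDifferentiableAt I J q y := by
    have h1 : ∀ᶠ y in 𝓝 n, q y ∈ (chartAt H' (q n)).source :=
      hq.continuousAt.eventually
        ((chartAt H' (q n)).open_source.mem_nhds (mem_chart_source H' (q n)))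
    have h2 : ∀ᶠ y in 𝓝 n, ContMDiffAt I J 1 q y :=
      contMDiffAt_iff_contMDiffAt_nhds (by simp) |>.mp (hq.of_le (by simp))
    filter_upwards [h1, h2] with y hy1 hy2
    exact ⟨mdifferentiableAt_extChartAt hy1, hy2.mdifferentiableAt (by simp)⟩
  have key : ∀ {X : (x : N) → TangentSpace I x} {x : ι → N → ℝ},
      (∀ᶠ y in 𝓝 n, mfderiv I J q y (X y) = ∑ i, x i y • e i (q y)) →
      (fun y ↦ mvfderiv I (φ ∘ q) y (X y)) =ᶠ[𝓝 n] fun y ↦ ∑ i, x i y • (ε i ∘ q) y := by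
    intro X x hX
    filter_upwards [hX, hnear] with y hy hy2
    rw [mvfderiv_comp_eq y hy2.1 hy2.2, hy, map_sum]
    exact Finset.sum_congr rfl fun i _ ↦ by rw [map_smul]; rfl
  have hstep : ∀ (i : ι) {X : (x : N) → TangentSpace I x} {x : ι → N → ℝ},
      (∀ᶠ y in 𝓝 n, mfderiv I J q y (X y) = ∑ i, x i y • e i (q y)) →
      mvfderiv I (ε i ∘ q) n (X n) = ∑ j, x j n • mvfderiv J (ε i) (q n) (e j (q n)) := by
    intro i X x hX
    rw [mvfderiv_comp_eq n ((hε i).mdifferentiableAt (by simp))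
      (hq.mdifferentiableAt (by simp)), hX.self_of_nhds, map_sum]
    exact Finset.sum_congr rfl fun i _ ↦ by rw [map_smul]
  have h1 := mvfderiv_mlieBracket hφq hV hW hn
  rw [mvfderiv_congr (key hWw), mvfderiv_congr (key hVv), mvfderiv_sum_smul _ hw hεq,
    mvfderiv_sum_smul _ hv hεq, mvfderiv_comp_eq n (hφ.mdifferentiableAt (by simp))
      (hq.mdifferentiableAt (by simp))] at h1
  simp only [hstep _ hVv, hstep _ hWw, Function.comp_apply] at h1
  have hinj : Function.Injective (mvfderiv J φ (q n)) := by
    have := isInvertible_mfderiv_extChartAt (I := J) (mem_extChartAt_source (I := J) (q n))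
    exact this.injective
  apply hinj
  refine h1.trans ?_
  have hbr : ∀ j i, mvfderiv J φ (q n) (VectorField.mlieBracket J (e j) (e i) (q n)) =
      mvfderiv J (ε i) (q n) (e j (q n)) - mvfderiv J (ε j) (q n) (e i (q n)) := fun j i ↦
    mvfderiv_mlieBracket hφ (he j) (he i) (by rw [J.range_eq_univ]; simp)
  have h2 : mvfderiv J φ (q n)
      (∑ i, (mvfderiv I (w i) n (V n) - mvfderiv I (v i) n (W n)) • e i (q n)) =
      ∑ i, (mvfderiv I (w i) n (V n) - mvfderiv I (v i) n (W n)) • ε i (q n) := by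
    rw [map_sum]
    exact Finset.sum_congr rfl fun i _ ↦ map_smul _ _ _
  have h3 : mvfderiv J φ (q n)
      (∑ j, ∑ i, (v j n * w i n) • VectorField.mlieBracket J (e j) (e i) (q n)) =
      ∑ j, ∑ i, (v j n * w i n) • (mvfderiv J (ε i) (q n) (e j (q n)) -
        mvfderiv J (ε j) (q n) (e i (q n))) := by
    simp only [map_sum, map_smul, hbr]
  rw [map_add, h2, h3]
  simp only [smul_sub, sub_smul, Finset.sum_add_distrib, Finset.sum_sub_distrib, Finset.smul_sum,
    smul_smul]
  rw [Finset.sum_comm (f := fun j i ↦ (v j n * w i n) • mvfderiv J (ε i) (q n) (e j (q n)))]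
  simp only [mul_comm (v _ n)]
  abel

/-- The exterior derivative of a `1`-form `α` on `M`, pulled back to `N`, in terms of a frame: it is
`V(α(W)) - W(α(V)) - α([V, W])`, and depends on `V` and `W` only through their coefficients. -/
theorem pullback_extDeriv_frame {ι : Type*} [Fintype ι] {q : N → M} {n : N}
    (hn : extChartAt I n n ∈ closure (interior (Set.range I)))
    (hq : ContMDiffAt I J ∞ q n)
    {V W : (x : N) → TangentSpace I x}
    (hV : ContMDiffAt I (I.prod 𝓘(ℝ, E)) ∞ (fun y ↦ (⟨y, V y⟩ : TangentBundle I N)) n)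
    (hW : ContMDiffAt I (I.prod 𝓘(ℝ, E)) ∞ (fun y ↦ (⟨y, W y⟩ : TangentBundle I N)) n)
    {e : ι → (x : M) → TangentSpace J x}
    (he : ∀ i, ContMDiffAt J (J.prod 𝓘(ℝ, E')) ∞
      (fun y ↦ (⟨y, e i y⟩ : TangentBundle J M)) (q n))
    {v w : ι → N → ℝ} (hv : ∀ i, ContMDiffAt I 𝓘(ℝ, ℝ) ∞ (v i) n)
    (hw : ∀ i, ContMDiffAt I 𝓘(ℝ, ℝ) ∞ (w i) n)
    (hVv : ∀ᶠ y in 𝓝 n, mfderiv I J q y (V y) = ∑ i, v i y • e i (q y))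
    (hWw : ∀ᶠ y in 𝓝 n, mfderiv I J q y (W y) = ∑ i, w i y • e i (q y))
    {α : (x : M) → TangentSpace J x →L[ℝ] ℝ}
    (hα : ∀ i, ContMDiffAt J 𝓘(ℝ, ℝ) ∞ (fun x ↦ α x (e i x)) (q n)) :
    mvfderiv I (fun y ↦ α (q y) (mfderiv I J q y (W y))) n (V n)
      - mvfderiv I (fun y ↦ α (q y) (mfderiv I J q y (V y))) n (W n)
      - α (q n) (mfderiv I J q n (VectorField.mlieBracket I V W n)) =
      ∑ j, ∑ i, v j n * w i n * (mvfderiv J (fun x ↦ α x (e i x)) (q n) (e j (q n))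
        - mvfderiv J (fun x ↦ α x (e j x)) (q n) (e i (q n))
        - α (q n) (VectorField.mlieBracket J (e j) (e i) (q n))) := by
  let ε : ι → M → ℝ := fun i x ↦ α x (e i x)
  have hεq : ∀ i, ContMDiffAt I 𝓘(ℝ, ℝ) ∞ (ε i ∘ q) n := fun i ↦
    ContMDiffAt.comp n (hα i) hq
  have key : ∀ {X : (x : N) → TangentSpace I x} {x : ι → N → ℝ},
      (∀ᶠ y in 𝓝 n, mfderiv I J q y (X y) = ∑ i, x i y • e i (q y)) →
      (fun y ↦ α (q y) (mfderiv I J q y (X y))) =ᶠ[𝓝 n] fun y ↦ ∑ i, x i y * (ε i ∘ q) y := by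
    intro X x hX
    filter_upwards [hX] with y hy
    rw [hy, map_sum]
    exact Finset.sum_congr rfl fun i _ ↦ by rw [map_smul]; rfl
  have hstep : ∀ (i : ι) {X : (x : N) → TangentSpace I x} {x : ι → N → ℝ},
      (∀ᶠ y in 𝓝 n, mfderiv I J q y (X y) = ∑ i, x i y • e i (q y)) →
      mvfderiv I (ε i ∘ q) n (X n) = ∑ j, x j n * mvfderiv J (ε i) (q n) (e j (q n)) := by
    intro i X x hX
    rw [mvfderiv_comp_eq n ((hα i).mdifferentiableAt (by simp))
      (hq.mdifferentiableAt (by simp)), hX.self_of_nhds, map_sum]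
    exact Finset.sum_congr rfl fun i _ ↦ by rw [map_smul, smul_eq_mul]
  rw [mvfderiv_congr (key hWw), mvfderiv_congr (key hVv), mvfderiv_sum_mul _ hw hεq,
    mvfderiv_sum_mul _ hv hεq, mfderiv_mlieBracket_frame hn hq hV hW he hv hw hVv hWw]
  simp only [hstep _ hVv, hstep _ hWw, Function.comp_apply]
  have h2 : α (q n) (∑ i, (mvfderiv I (w i) n (V n) - mvfderiv I (v i) n (W n)) • e i (q n)) =
      ∑ i, (mvfderiv I (w i) n (V n) - mvfderiv I (v i) n (W n)) * ε i (q n) := by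
    rw [map_sum]
    exact Finset.sum_congr rfl fun i _ ↦ by rw [map_smul, smul_eq_mul]
  have h3 : α (q n) (∑ j, ∑ i, (v j n * w i n) • VectorField.mlieBracket J (e j) (e i) (q n)) =
      ∑ j, ∑ i, v j n * w i n * α (q n) (VectorField.mlieBracket J (e j) (e i) (q n)) := by
    simp only [map_sum, map_smul, smul_eq_mul]
  rw [map_add, h2, h3]
  simp only [mul_sub, sub_mul, Finset.sum_add_distrib, Finset.sum_sub_distrib, Finset.mul_sum]
  rw [Finset.sum_comm (f := fun i j ↦ w i n * (v j n * mvfderiv J (ε i) (q n) (e j (q n))))]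
  simp only [← mul_assoc, mul_comm (w _ n) (v _ n)]
  ring

end FrameBracket

noncomputable section
namespace SO3Twistor
namespace IrreducibleSO3Structure

/-! ### Tangent vectors of `End(TM)` -/

section EndTM
variable {M : Type*} [TopologicalSpace M] [ChartedSpace E5 M] [IsManifold (𝓡 5) ∞ M]

/-- The fibre coordinate on `End(TM)` of the preferred trivialization at `p`. -/
def fibCoord (p : M) (e : EndTM M) : E5 →L[ℝ] E5 :=
  (trivializationAt (E5 →L[ℝ] E5) (fun x : M ↦ EndT M x) p e).2

theorem contMDiff_base : ContMDiff IEnd (𝓡 5) ∞ (fun e : EndTM M ↦ e.1) :=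
  Bundle.contMDiff_proj (fun x : M ↦ EndT M x)

theorem contMDiffAt_fibCoord {p : M} {σ : EndTM M}
    (h : σ.1 ∈ (trivializationAt (E5 →L[ℝ] E5) (fun x : M ↦ EndT M x) p).baseSet) :
    ContMDiffAt IEnd 𝓘(ℝ, E5 →L[ℝ] E5) ∞ (fibCoord p) σ :=
  ((Bundle.Trivialization.contMDiffAt_iff
    (e := trivializationAt (E5 →L[ℝ] E5) (fun x : M ↦ EndT M x) p) (f := id)
    (by simpa [Trivialization.mem_source] using h)).1
    contMDiffAt_id).2

theorem baseSet_eq (p : M) :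
    (trivializationAt (E5 →L[ℝ] E5) (fun x : M ↦ EndT M x) p).baseSet = (chartAt E5 p).source := by
  simp [hom_trivializationAt_baseSet]

/-- In the chart of `End(TM)` at `σ`, a tangent vector has the base component `dproj A` and the
derivative of the fibre coordinate. -/
theorem mvfderiv_extChartAt_EndTM (σ τ : EndTM M) (h : τ.1 ∈ (chartAt E5 σ.1).source)
    (A : TangentSpace IEnd τ) :
    mvfderiv IEnd (extChartAt IEnd σ) τ A =
      (mvfderiv (𝓡 5) (extChartAt (𝓡 5) σ.1) τ.1 (dproj τ A),
        mvfderiv IEnd (fibCoord σ.1) τ A) := by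
  have : IsManifold (𝓡 5) 1 M := IsManifold.of_le (n := ∞) (by simp)
  have h1 : (extChartAt IEnd σ : EndTM M → E5 × (E5 →L[ℝ] E5)) =ᶠ[𝓝 τ]
      fun e ↦ (extChartAt (𝓡 5) σ.1 e.1, fibCoord σ.1 e) := by
    have hn : (fun e : EndTM M ↦ e.1) ⁻¹' (chartAt E5 σ.1).source ∈ 𝓝 τ :=
      (contMDiff_base.continuous.isOpen_preimage _ (chartAt E5 σ.1).open_source).mem_nhds h
    filter_upwards [hn] with e he
    rw [FiberBundle.extChartAt]
    simp only [PartialEquiv.coe_trans, Function.comp_apply, PartialEquiv.prod_coe,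
      PartialEquiv.refl_coe, id]
    refine Prod.ext ?_ rfl
    refine congrArg (extChartAt (𝓡 5) σ.1) ?_
    exact Trivialization.coe_fst' _ (by rw [baseSet_eq]; exact he)
  have h2 : MDifferentiableAt (𝓡 5) 𝓘(ℝ, E5) (extChartAt (𝓡 5) σ.1) τ.1 :=
    mdifferentiableAt_extChartAt h
  have hext : MDifferentiableAt IEnd 𝓘(ℝ, E5 × (E5 →L[ℝ] E5)) (extChartAt IEnd σ) τ :=
    ((h2.comp τ (contMDiff_base.contMDiffAt.mdifferentiableAt (by simp))).prodMk_space
      ((contMDiffAt_fibCoord (p := σ.1) (σ := τ)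
        (by rw [baseSet_eq]; exact h)).mdifferentiableAt (by simp))).congr_of_eventuallyEq h1
  refine Prod.ext ?_ ?_
  · have h3 : mfderiv IEnd 𝓘(ℝ, E5) (Prod.fst ∘ extChartAt IEnd σ) τ
        = mfderiv IEnd 𝓘(ℝ, E5) (extChartAt (𝓡 5) σ.1 ∘ fun e : EndTM M ↦ e.1) τ :=
      Filter.EventuallyEq.mfderiv_eq (h1.fun_comp Prod.fst)
    have h4 := mfderiv_comp_apply τ
      (ContinuousLinearMap.fst ℝ E5 (E5 →L[ℝ] E5)).mdifferentiableAt hext A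
    have h5 := mfderiv_comp_apply τ h2 (contMDiff_base.contMDiffAt.mdifferentiableAt (by simp)) A
    rw [ContinuousLinearMap.mfderiv_eq] at h4
    refine Eq.trans h4.symm (Eq.trans ?_ h5)
    exact congrArg (fun L : TangentSpace IEnd τ →L[ℝ] E5 ↦ L A) h3
  · have h3 : mfderiv IEnd 𝓘(ℝ, E5 →L[ℝ] E5) (Prod.snd ∘ extChartAt IEnd σ) τ
        = mfderiv IEnd 𝓘(ℝ, E5 →L[ℝ] E5) (fibCoord σ.1) τ :=
      Filter.EventuallyEq.mfderiv_eq (h1.fun_comp Prod.snd)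
    have h4 := mfderiv_comp_apply τ
      (ContinuousLinearMap.snd ℝ E5 (E5 →L[ℝ] E5)).mdifferentiableAt hext A
    rw [ContinuousLinearMap.mfderiv_eq] at h4
    refine Eq.trans h4.symm ?_
    exact congrArg (fun L : TangentSpace IEnd τ →L[ℝ] (E5 →L[ℝ] E5) ↦ L A) h3

/-- A tangent vector of `End(TM)` is determined by its two components in the chart. -/
theorem tangent_ext {σ : EndTM M} {A B : TangentSpace IEnd σ} (h1 : dproj σ A = dproj σ B)
    (h2 : mvfderiv IEnd (fibCoord σ.1) σ A = mvfderiv IEnd (fibCoord σ.1) σ B) : A = B := by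
  have : IsManifold IEnd 1 (EndTM M) := IsManifold.of_le (n := ∞) (by simp)
  have hA := mvfderiv_extChartAt_EndTM σ σ (mem_chart_source _ _) A
  have hB := mvfderiv_extChartAt_EndTM σ σ (mem_chart_source _ _) B
  rw [h1, h2, ← hB] at hA
  have h3 := mfderiv_extChartAt_self (I := IEnd) (x := σ)
  have h4 : ∀ C : TangentSpace IEnd σ, (mvfderiv IEnd (extChartAt IEnd σ) σ C) = C := fun C ↦
    congrArg (fun L : TangentSpace IEnd σ →L[ℝ] (E5 × (E5 →L[ℝ] E5)) ↦ L C) h3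
  exact (h4 A).symm.trans (hA.trans (h4 B))

theorem dproj_add (σ : EndTM M) (A B : TangentSpace IEnd σ) :
    dproj σ (A + B) = dproj σ A + dproj σ B :=
  ContinuousLinearMap.map_add (mfderiv IEnd (𝓡 5) (fun e : EndTM M ↦ e.1) σ) A B

theorem fibCoord_symm (σ : EndTM M) (w : EndT M σ.1) :
    (trivializationAt (E5 →L[ℝ] E5) (fun x : M ↦ EndT M x) σ.1).symm σ.1
      (fibCoord σ.1 ⟨σ.1, w⟩) = w :=
  Trivialization.symm_apply_apply_mk _ (FiberBundle.mem_baseSet_trivializationAt' σ.1) w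

/-- The fibre coordinate restricted to the fibre over `x`, as a linear map. -/
theorem fibCoord_eq (p : M) {x : M} (h : x ∈ (chartAt E5 p).source) (w : EndT M x) :
    fibCoord p ⟨x, w⟩ = Trivialization.continuousLinearMapAt ℝ
      (trivializationAt (E5 →L[ℝ] E5) (fun x : M ↦ EndT M x) p) x w := by
  exact (Trivialization.continuousLinearMapAt_apply_of_mem ℝ
    (trivializationAt (E5 →L[ℝ] E5) (fun x : M ↦ EndT M x) p) (by rw [baseSet_eq]; exact h) w).symm

theorem contMDiffAt_vline (σ : EndTM M) (w : EndT M σ.1) (r : ℝ) :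
    ContMDiffAt 𝓘(ℝ, ℝ) IEnd ∞ (fun r : ℝ ↦ (⟨σ.1, σ.2 + r • w⟩ : EndTM M)) r := by
  rw [Trivialization.contMDiffAt_iff
    (e := trivializationAt (E5 →L[ℝ] E5) (fun x : M ↦ EndT M x) σ.1) (by simp)]
  refine ⟨contMDiffAt_const, ?_⟩
  have : (fun r : ℝ ↦ (trivializationAt (E5 →L[ℝ] E5) (fun x : M ↦ EndT M x) σ.1
      (⟨σ.1, σ.2 + r • w⟩ : EndTM M)).2) =
        fun r ↦ fibCoord σ.1 ⟨σ.1, σ.2⟩ + r • fibCoord σ.1 ⟨σ.1, w⟩ := by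
    funext r
    change fibCoord σ.1 ⟨σ.1, σ.2 + r • w⟩ = _
    simp only [fibCoord_eq σ.1 (mem_chart_source E5 σ.1), map_add, map_smul]
  rw [this]
  apply ContDiffAt.contMDiffAt
  fun_prop

/-- The derivative along a vertical vector is the derivative along a line in the fibre. -/
theorem mvfderiv_vlift {F : Type*} [NormedAddCommGroup F] [NormedSpace ℝ F] (σ : EndTM M)
    (w : EndT M σ.1) {f : EndTM M → F} (hf : MDifferentiableAt IEnd 𝓘(ℝ, F) f σ) :
    mvfderiv IEnd f σ (vlift σ w) = deriv (fun r : ℝ ↦ f ⟨σ.1, σ.2 + r • w⟩) 0 := by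
  have h0 : (⟨σ.1, σ.2 + (0 : ℝ) • w⟩ : EndTM M) = σ := by simp
  have h1 := mfderiv_comp_apply_of_eq (I := 𝓘(ℝ, ℝ)) (I' := IEnd) (I'' := 𝓘(ℝ, F)) (0 : ℝ) hf
    ((contMDiffAt_vline σ w 0).mdifferentiableAt (by simp)) h0 (1 : ℝ)
  refine h1.symm.trans ?_
  rw [mfderiv_eq_fderiv]
  rfl

theorem dproj_vlift (σ : EndTM M) (w : EndT M σ.1) : dproj σ (vlift σ w) = 0 := by
  have h0 : (⟨σ.1, σ.2 + (0 : ℝ) • w⟩ : EndTM M) = σ := by simp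
  have h1 := mfderiv_comp_apply_of_eq (I := 𝓘(ℝ, ℝ)) (I' := IEnd) (I'' := 𝓡 5)
    (g := fun e : EndTM M ↦ e.1) (0 : ℝ) (contMDiff_base.contMDiffAt.mdifferentiableAt (by simp))
    ((contMDiffAt_vline σ w 0).mdifferentiableAt (by simp)) h0 (1 : ℝ)
  refine h1.symm.trans ?_
  have h2 : ((fun e : EndTM M ↦ e.1) ∘ fun r : ℝ ↦ (⟨σ.1, σ.2 + r • w⟩ : EndTM M))
    = fun _ ↦ σ.1 := rfl
  rw [h2, mfderiv_const]
  rfl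

theorem mvfderiv_fibCoord_vlift (σ : EndTM M) (w : EndT M σ.1) :
    mvfderiv IEnd (fibCoord σ.1) σ (vlift σ w) = fibCoord σ.1 ⟨σ.1, w⟩ := by
  rw [mvfderiv_vlift σ w ((contMDiffAt_fibCoord (p := σ.1) (σ := σ)
    (by rw [baseSet_eq]; exact mem_chart_source _ _)).mdifferentiableAt (by simp))]
  simp only [fibCoord_eq σ.1 (mem_chart_source E5 σ.1), map_add, map_smul]
  rw [deriv_const_add]
  exact ((hasDerivAt_id (0 : ℝ)).smul_const (Trivialization.continuousLinearMapAt ℝ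
    (trivializationAt (E5 →L[ℝ] E5) (fun x : M ↦ EndT M x) σ.1) σ.1 w)).deriv.trans (one_smul _ _)

/-- The image of `X` under the differential of the section `s`, as a tangent vector at `σ`; this is
meaningful if `s` passes through `σ`. -/
def sectionLift (σ : EndTM M) (s : (x : M) → EndT M x) (X : TangentSpace (𝓡 5) σ.1) :
    TangentSpace IEnd σ :=
  mfderiv (𝓡 5) IEnd (fun x ↦ (⟨x, s x⟩ : EndTM M)) σ.1 X

theorem mvfderiv_sectionLift {F : Type*} [NormedAddCommGroup F] [NormedSpace ℝ F] {σ : EndTM M}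
    {s : (x : M) → EndT M x} (h : s σ.1 = σ.2) (hs : EndDiffAt s σ.1) {f : EndTM M → F}
    (hf : MDifferentiableAt IEnd 𝓘(ℝ, F) f σ) (X : TangentSpace (𝓡 5) σ.1) :
    mvfderiv IEnd f σ (sectionLift σ s X) = mvfderiv (𝓡 5) (fun x ↦ f ⟨x, s x⟩) σ.1 X := by
  obtain ⟨p, v⟩ := σ
  obtain rfl : s p = v := h
  exact (mfderiv_comp_apply p hf hs X).symm

theorem dproj_sectionLift {σ : EndTM M} {s : (x : M) → EndT M x} (h : s σ.1 = σ.2)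
    (hs : EndDiffAt s σ.1) (X : TangentSpace (𝓡 5) σ.1) : dproj σ (sectionLift σ s X) = X := by
  obtain ⟨p, v⟩ := σ
  obtain rfl : s p = v := h
  refine (mfderiv_comp_apply (I' := IEnd) (g := fun e : EndTM M ↦ e.1) p
    (contMDiff_base.contMDiffAt.mdifferentiableAt (by simp)) hs X).symm.trans ?_
  exact congrArg (fun L : TangentSpace (𝓡 5) p →L[ℝ] TangentSpace (𝓡 5) p ↦ L X)
    (mfderiv_id (I := 𝓡 5) (x := p))

theorem extSection_self (σ : EndTM M) : extSection σ σ.1 = σ.2 :=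
  FiberBundle.extend_apply_self _ _

/-- The section `extSection σ` is constant in the trivialization at the base point of `σ`. -/
theorem mvfderiv_fibCoord_extSection (σ : EndTM M) (X : TangentSpace (𝓡 5) σ.1) :
    mvfderiv IEnd (fibCoord σ.1) σ (sectionLift σ (extSection σ) X) = 0 := by
  rw [mvfderiv_sectionLift (extSection_self σ) (endDiffAt_extSection σ)
    ((contMDiffAt_fibCoord (p := σ.1) (σ := σ)
      (by rw [baseSet_eq]; exact mem_chart_source _ _)).mdifferentiableAt (by simp))]
  have h1 : (fun x ↦ fibCoord σ.1 ⟨x, extSection σ x⟩) =ᶠ[𝓝 σ.1] fun _ ↦ fibCoord σ.1 σ := by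
    filter_upwards [(chartAt E5 σ.1).open_source.mem_nhds (mem_chart_source E5 σ.1)] with x hx
    have h3 := congrArg Prod.snd (Trivialization.apply_mk_symm
      (trivializationAt (E5 →L[ℝ] E5) (fun x : M ↦ EndT M x) σ.1) (b := x)
      (by rw [baseSet_eq]; exact hx) (fibCoord σ.1 σ))
    exact h3
  have h2 : mfderiv (𝓡 5) 𝓘(ℝ, E5 →L[ℝ] E5) (fun x ↦ fibCoord σ.1 ⟨x, extSection σ x⟩) σ.1 = _ :=
    h1.mfderiv_eq
  rw [mfderiv_const] at h2
  exact congrArg (fun L : TangentSpace (𝓡 5) σ.1 →L[ℝ] (E5 →L[ℝ] E5) ↦ L X) h2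

/-- Every tangent vector of `End(TM)` is the sum of the image of `dproj A` under a local section and
of a vertical vector. -/
theorem tangent_decomp (cov : Connection M) (σ : EndTM M) (A : TangentSpace IEnd σ) :
    A = sectionLift σ (extSection σ) (dproj σ A) +
      vlift σ (connMap cov σ A - endCov cov (endDiffAt_extSection σ) (dproj σ A)) := by
  apply tangent_ext
  · rw [dproj_add, dproj_sectionLift (extSection_self σ) (endDiffAt_extSection σ), dproj_vlift,
      add_zero]
  · rw [ContinuousLinearMap.map_add (mvfderiv IEnd (fibCoord σ.1) σ), mvfderiv_fibCoord_extSection,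
      mvfderiv_fibCoord_vlift, zero_add]
    rw [connMap, add_sub_cancel_right]
    exact (congrArg Prod.snd (Trivialization.apply_mk_symm
      (trivializationAt (E5 →L[ℝ] E5) (fun x : M ↦ EndT M x) σ.1)
      (by rw [baseSet_eq]; exact mem_chart_source E5 σ.1) _)).symm

theorem endCov_apply (cov : Connection M) {s : (x : M) → EndT M x} {p : M} (hs : EndDiffAt s p)
    (v : TangentSpace (𝓡 5) p) {Y : (x : M) → TangentSpace (𝓡 5) x} (hY : DiffAt Y p) :
    endCov cov hs v (Y p) = cov (fun x ↦ s x (Y x)) p v - s p (cov Y p v) :=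
  TensorialAt.mkHom_apply _ hY

theorem endCov_add (cov : Connection M) {s : (x : M) → EndT M x} {p : M} (hs : EndDiffAt s p)
    (v w : TangentSpace (𝓡 5) p) : endCov cov hs (v + w) = endCov cov hs v + endCov cov hs w := by
  ext1 y
  have hY := FiberBundle.mdifferentiableAt_extend (𝓡 5) E5 (V := fun x : M ↦ TangentSpace (𝓡 5) x) y
  have h0 : FiberBundle.extend E5 (E := fun x : M ↦ TangentSpace (𝓡 5) x) y p = y :=
    FiberBundle.extend_apply_self _ _
  rw [add_apply]
  have h := fun u ↦ endCov_apply cov hs u hY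
  rw [h0] at h
  rw [h, h, h, ContinuousLinearMap.map_add (cov _ p), ContinuousLinearMap.map_add (cov _ p),
    ContinuousLinearMap.map_add (s p)]
  abel

theorem endCov_smul (cov : Connection M) {s : (x : M) → EndT M x} {p : M} (hs : EndDiffAt s p)
    (c : ℝ) (v : TangentSpace (𝓡 5) p) : endCov cov hs (c • v) = c • endCov cov hs v := by
  ext1 y
  have hY := FiberBundle.mdifferentiableAt_extend (𝓡 5) E5 (V := fun x : M ↦ TangentSpace (𝓡 5) x) y
  have h0 : FiberBundle.extend E5 (E := fun x : M ↦ TangentSpace (𝓡 5) x) y p = y :=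
    FiberBundle.extend_apply_self _ _
  rw [smul_apply]
  have h := fun u ↦ endCov_apply cov hs u hY
  rw [h0] at h
  rw [h, h, ContinuousLinearMap.map_smul (cov _ p), ContinuousLinearMap.map_smul (cov _ p),
    ContinuousLinearMap.map_smul (s p), smul_sub]

theorem connMap_eq (cov : Connection M) (σ : EndTM M) (A : TangentSpace IEnd σ) :
    connMap cov σ A = (trivializationAt (E5 →L[ℝ] E5) (fun x : M ↦ EndT M x) σ.1).symmL ℝ σ.1
      (mvfderiv IEnd (fibCoord σ.1) σ A) + endCov cov (endDiffAt_extSection σ) (dproj σ A) := by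
  rw [Trivialization.symmL_apply _ (FiberBundle.mem_baseSet_trivializationAt' σ.1)]
  rfl

theorem connMap_add (cov : Connection M) (σ : EndTM M) (A B : TangentSpace IEnd σ) :
    connMap cov σ (A + B) = connMap cov σ A + connMap cov σ B := by
  rw [connMap_eq, connMap_eq, connMap_eq, dproj_add, endCov_add,
    ContinuousLinearMap.map_add (mvfderiv IEnd (fibCoord σ.1) σ), ContinuousLinearMap.map_add]
  abel

theorem connMap_vlift (cov : Connection M) (σ : EndTM M) (w : EndT M σ.1) :
    connMap cov σ (vlift σ w) = w := by
  rw [connMap_eq, dproj_vlift, mvfderiv_fibCoord_vlift]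
  have h0 : endCov cov (endDiffAt_extSection σ) 0 = 0 := by
    simpa using endCov_smul cov (endDiffAt_extSection σ) 0 0
  rw [h0, add_zero]
  rw [Trivialization.symmL_apply _ (FiberBundle.mem_baseSet_trivializationAt' σ.1)]
  exact fibCoord_symm σ w

theorem hlift_eq (cov : Connection M) (σ : EndTM M) (X : TangentSpace (𝓡 5) σ.1) :
    hlift cov σ X = sectionLift σ (extSection σ) X
      - vlift σ (endCov cov (endDiffAt_extSection σ) X) := rfl

theorem dproj_hlift (cov : Connection M) (σ : EndTM M) (X : TangentSpace (𝓡 5) σ.1) :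
    dproj σ (hlift cov σ X) = X := by
  have h : hlift cov σ X + vlift σ (endCov cov (endDiffAt_extSection σ) X)
      = sectionLift σ (extSection σ) X := by rw [hlift_eq, sub_add_cancel]
  have h2 := congrArg (dproj σ) h
  rwa [dproj_add, dproj_vlift, add_zero,
    dproj_sectionLift (extSection_self σ) (endDiffAt_extSection σ)] at h2

theorem connMap_hlift (cov : Connection M) (σ : EndTM M) (X : TangentSpace (𝓡 5) σ.1) :
    connMap cov σ (hlift cov σ X) = 0 := by
  have h : hlift cov σ X + vlift σ (endCov cov (endDiffAt_extSection σ) X)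
      = sectionLift σ (extSection σ) X := by rw [hlift_eq, sub_add_cancel]
  have h2 := congrArg (connMap cov σ) h
  rw [connMap_add, connMap_vlift, connMap_eq cov σ (sectionLift _ _ _),
    mvfderiv_fibCoord_extSection, dproj_sectionLift (extSection_self σ) (endDiffAt_extSection σ),
    ContinuousLinearMap.map_zero, zero_add] at h2
  simpa using h2
end EndTM

/-! ### Orthonormal and adapted bases of a tangent space -/

section Pointwise
variable {M : Type*} [TopologicalSpace M] [ChartedSpace E5 M] [IsManifold (𝓡 5) ∞ M]
  (S : IrreducibleSO3Structure M) {p : M}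

/-- `a` is an orthonormal basis of `T_pM`. -/
def IsON (a : Fin 5 → TangentSpace (𝓡 5) p) : Prop :=
  ∀ i j, S.g.inner p (a i) (a j) = if i = j then 1 else 0

variable {S} {a b : Fin 5 → TangentSpace (𝓡 5) p}

theorem IsAdapted.isON (h : S.IsAdapted p a) : S.IsON a := h.1

theorem inner_sum_left (c : Fin 5 → ℝ) (x : Fin 5 → TangentSpace (𝓡 5) p)
    (y : TangentSpace (𝓡 5) p) :
    S.g.inner p (∑ i, c i • x i) y = ∑ i, c i * S.g.inner p (x i) y := by
  rw [map_sum, sum_apply]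
  exact Finset.sum_congr rfl fun i _ ↦ by rw [map_smul]; rfl

theorem inner_sum_right (c : Fin 5 → ℝ) (x : Fin 5 → TangentSpace (𝓡 5) p)
    (y : TangentSpace (𝓡 5) p) :
    S.g.inner p y (∑ i, c i • x i) = ∑ i, c i * S.g.inner p y (x i) := by
  rw [map_sum]
  exact Finset.sum_congr rfl fun i _ ↦ by rw [map_smul]; rfl

theorem IsON.inner_sum (h : S.IsON a) (c : Fin 5 → ℝ) (k : Fin 5) :
    S.g.inner p (∑ i, c i • a i) (a k) = c k := by
  have h' : ∀ i j, S.g.inner p (a i) (a j) = if i = j then 1 else 0 := h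
  rw [inner_sum_left]
  simp [h']

/-- The basis of `T_pM` given by five orthonormal vectors. -/
def IsON.basis (h : S.IsON a) : Module.Basis (Fin 5) ℝ (TangentSpace (𝓡 5) p) :=
  basisOfLinearIndependentOfCardEqFinrank (b := a)
    (by
      rw [Fintype.linearIndependent_iff]
      intro c hc k
      have := h.inner_sum c k
      rw [hc] at this
      simpa using this.symm)
    (by
      change _ = Module.finrank ℝ E5
      simp)

theorem IsON.basis_apply (h : S.IsON a) (i : Fin 5) : h.basis i = a i := by
  simp [IsON.basis]

theorem IsON.basis_repr (h : S.IsON a) (v : TangentSpace (𝓡 5) p) (k : Fin 5) :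
    h.basis.repr v k = S.g.inner p v (a k) := by
  have h1 := h.basis.sum_repr v
  simp only [h.basis_apply] at h1
  rw [← h.inner_sum (fun i ↦ h.basis.repr v i) k, h1]

theorem IsON.expand (h : S.IsON a) (v : TangentSpace (𝓡 5) p) :
    v = ∑ i, S.g.inner p v (a i) • a i := by
  have h1 := h.basis.sum_repr v
  simp only [h.basis_apply, h.basis_repr] at h1
  exact h1.symm

theorem IsON.ext (h : S.IsON a) {v w : TangentSpace (𝓡 5) p}
    (hvw : ∀ i, S.g.inner p v (a i) = S.g.inner p w (a i)) : v = w := by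
  rw [h.expand v, h.expand w]
  simp only [hvw]

theorem IsON.inner_eq (h : S.IsON a) (v w : TangentSpace (𝓡 5) p) :
    S.g.inner p v w = ∑ i, S.g.inner p v (a i) * S.g.inner p w (a i) := by
  conv_lhs => rw [h.expand w]
  rw [inner_sum_right]
  exact Finset.sum_congr rfl fun i _ ↦ mul_comm _ _

/-- The contraction of a bilinear form with the metric does not depend on the orthonormal basis. -/
theorem IsON.contract (ha : S.IsON a) (hb : S.IsON b)
    (B : TangentSpace (𝓡 5) p →ₗ[ℝ] TangentSpace (𝓡 5) p →ₗ[ℝ] ℝ) :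
    ∑ i, B (b i) (b i) = ∑ i, B (a i) (a i) := by
  have h1 : ∀ i, B (b i) (b i) = ∑ j, ∑ k, (S.g.inner p (a j) (b i) * S.g.inner p (a k) (b i)) *
      B (a k) (a j) := by
    intro i
    conv_lhs => rw [ha.expand (b i)]
    simp only [map_sum, map_smul, LinearMap.sum_apply, LinearMap.smul_apply, smul_eq_mul,
      Finset.mul_sum, S.g.symm p (b i)]
    exact Finset.sum_congr rfl fun j _ ↦ Finset.sum_congr rfl fun k _ ↦ by ring
  simp only [h1]
  rw [Finset.sum_comm]
  refine Finset.sum_congr rfl fun j _ ↦ ?_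
  rw [Finset.sum_comm]
  simp only [← Finset.sum_mul, ← hb.inner_eq, ha _ _]
  simp

/-- The matrix `g(W aᵢ, aⱼ)` of an endomorphism. -/
def mat (S : IrreducibleSO3Structure M) (a : Fin 5 → TangentSpace (𝓡 5) p) (W : EndT M p) :
    Matrix (Fin 5) (Fin 5) ℝ :=
  fun i j ↦ S.g.inner p (W (a i)) (a j)

theorem IsON.apply_eq (h : S.IsON a) (W : EndT M p) (i : Fin 5) :
    W (a i) = ∑ j, mat S a W i j • a j := h.expand _

theorem IsON.bivInner_eq (h : S.IsON a) (A B : EndT M p) :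
    bivInner A B = -(1 / 2) * ∑ i, ∑ j, mat S a A i j * mat S a B j i := by
  rw [bivInner, LinearMap.trace_eq_matrix_trace ℝ h.basis, Matrix.trace]
  congr 1
  rw [Finset.sum_comm]
  refine Finset.sum_congr rfl fun i _ ↦ ?_
  rw [Matrix.diag_apply, LinearMap.toMatrix_apply, h.basis_repr, h.basis_apply,
    LinearMap.comp_apply]
  change S.g.inner p (A (B (a i))) (a i) = _
  conv_lhs => rw [h.apply_eq B i, map_sum]
  simp only [map_smul]
  rw [inner_sum_left]
  exact Finset.sum_congr rfl fun j _ ↦ mul_comm _ _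

/-- The endomorphism with a given matrix in an orthonormal basis. -/
def ofMat (S : IrreducibleSO3Structure M) (a : Fin 5 → TangentSpace (𝓡 5) p)
    (W : Matrix (Fin 5) (Fin 5) ℝ) : EndT M p :=
  ∑ i, ∑ j, W i j • (S.g.inner p (a i)).smulRight (a j)

theorem IsON.mat_ofMat (h : S.IsON a) (W : Matrix (Fin 5) (Fin 5) ℝ) :
    mat S a (ofMat S a W) = W := by
  ext k l
  have h1 : ofMat S a W (a k) = ∑ j, W k j • a j := by
    simp only [ofMat, sum_apply, smul_apply, ContinuousLinearMap.smulRight_apply, h _ _]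
    simp
  rw [mat, h1, h.inner_sum]

theorem IsON.end_ext (h : S.IsON a) {A B : EndT M p} (hAB : mat S a A = mat S a B) : A = B := by
  ext1 v
  rw [h.expand v]
  simp only [map_sum, map_smul, h.apply_eq, hAB]

theorem mat_add (A B : EndT M p) : mat S a (A + B) = mat S a A + mat S a B := by
  ext i j
  simp only [mat, add_apply, map_add, Matrix.add_apply]

theorem mat_smul (c : ℝ) (A : EndT M p) : mat S a (c • A) = c • mat S a A := by
  ext i j
  simp only [mat, smul_apply, map_smul, Matrix.smul_apply]

theorem mat_sub (A B : EndT M p) : mat S a (A - B) = mat S a A - mat S a B := by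
  ext i j
  simp only [mat, sub_apply, map_sub, Matrix.sub_apply]

theorem mat_wedge (x y : TangentSpace (𝓡 5) p) (i j : Fin 5) :
    mat S a (S.wedge x y) i j = S.g.inner p x (a i) * S.g.inner p y (a j)
      - S.g.inner p y (a i) * S.g.inner p x (a j) := by
  simp only [mat, wedge, sub_apply, map_sub, ContinuousLinearMap.smulRight_apply, map_smul,
    smul_apply, smul_eq_mul]

end Pointwise

/-! ### The Lie algebra `so(3)` in an adapted basis -/

section Pointwise
variable {M : Type*} [TopologicalSpace M] [ChartedSpace E5 M] [IsManifold (𝓡 5) ∞ M]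
  {S : IrreducibleSO3Structure M} {p : M} {a b : Fin 5 → TangentSpace (𝓡 5) p}

/-- The symmetric trilinear form obtained from `upsilonPoly` by polarization. -/
def upsTri (c d f : Fin 5 → ℝ) : ℝ :=
  -(c 0 * d 0 * f 0)
    + (c 0 * d 1 * f 1 + c 1 * d 0 * f 1 + c 1 * d 1 * f 0)
    + (c 0 * d 3 * f 3 + c 3 * d 0 * f 3 + c 3 * d 3 * f 0)
    - 1 / 2 * (c 0 * d 2 * f 2 + c 2 * d 0 * f 2 + c 2 * d 2 * f 0)
    - 1 / 2 * (c 0 * d 4 * f 4 + c 4 * d 0 * f 4 + c 4 * d 4 * f 0)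
    + √3 / 2 * (c 3 * d 4 * f 4 + c 4 * d 3 * f 4 + c 4 * d 4 * f 3)
    - √3 / 2 * (c 3 * d 2 * f 2 + c 2 * d 3 * f 2 + c 2 * d 2 * f 3)
    + √3 / 2 * (c 1 * d 2 * f 4 + c 1 * d 4 * f 2 + c 2 * d 1 * f 4 + c 2 * d 4 * f 1
      + c 4 * d 1 * f 2 + c 4 * d 2 * f 1)

theorem IsAdapted.upsilon_eq (h : S.IsAdapted p a) (c d f : Fin 5 → ℝ) :
    S.Υ p (∑ i, c i • a i) (∑ i, d i • a i) (∑ i, f i • a i) = upsTri c d f := by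
  have hN : ∀ u : Fin 5 → ℝ, S.Υ p (∑ i, u i • a i) (∑ i, u i • a i) (∑ i, u i • a i)
    = upsilonPoly u := h.2.2
  have hadd : ∀ u v : Fin 5 → ℝ, ∑ i, (u + v) i • a i = ∑ i, u i • a i + ∑ i, v i • a i := by
    intro u v
    simp only [Pi.add_apply, add_smul, Finset.sum_add_distrib]
  have pol : ∀ x y z : TangentSpace (𝓡 5) p, 6 * S.Υ p x y z =
      S.Υ p (x + y + z) (x + y + z) (x + y + z) - S.Υ p (x + y) (x + y) (x + y)
      - S.Υ p (x + z) (x + z) (x + z) - S.Υ p (y + z) (y + z) (y + z)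
      + S.Υ p x x x + S.Υ p y y y + S.Υ p z z z := by
    intro x y z
    have e1 := S.Υ_symm_left p x y z
    have e2 := S.Υ_symm_right p x y z
    have e3 := S.Υ_symm_right p y x z
    have e4 := S.Υ_symm_left p x z y
    have e5 := S.Υ_symm_right p z x y
    simp only [map_add, LinearMap.add_apply]
    linarith
  have := pol (∑ i, c i • a i) (∑ i, d i • a i) (∑ i, f i • a i)
  rw [← hadd, ← hadd, ← hadd, ← hadd] at this
  simp only [hN] at this
  have e : 6 * upsTri c d f = upsilonPoly (c + d + f) - upsilonPoly (c + d) - upsilonPoly (c + f)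
      - upsilonPoly (d + f) + upsilonPoly c + upsilonPoly d + upsilonPoly f := by
    simp only [upsTri, upsilonPoly, Pi.add_apply]
    ring
  linarith

/-- The matrices `(g(W aᵢ, aⱼ))` of the elements of `Λ²₃ ≅ so(3)` in an adapted basis. The
isomorphism with `ℝ³` is scaled so that it turns the Lie bracket into the cross product up to sign;
then unit vectors correspond to `|σ|² = 5`. -/
def so3Mat (v : Fin 3 → ℝ) : Matrix (Fin 5) (Fin 5) ℝ :=
  !![0, 0, -(√3 * v 0), 0, -(√3 * v 2);
    0, 0, -v 2, -(2 * v 1), -v 0;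
    √3 * v 0, v 2, 0, -v 0, -v 1;
    0, 2 * v 1, v 0, 0, -v 2;
    √3 * v 2, v 0, v 1, v 2, 0]

theorem so3Mat_skew (v : Fin 3 → ℝ) (i j : Fin 5) : so3Mat v j i = -so3Mat v i j := by
  fin_cases i <;> fin_cases j <;> simp [so3Mat]

theorem so3Mat_inj {v w : Fin 3 → ℝ} (h : so3Mat v = so3Mat w) : v = w := by
  have h0 := congrFun (congrFun h 1) 4
  have h1 := congrFun (congrFun h 2) 4
  have h2 := congrFun (congrFun h 1) 2
  simp [so3Mat] at h0 h1 h2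
  ext i
  fin_cases i <;> assumption

theorem isLinear_so3Mat (v w : Fin 3 → ℝ) (c : ℝ) :
    so3Mat (v + w) = so3Mat v + so3Mat w ∧ so3Mat (c • v) = c • so3Mat v := by
  constructor
  · ext i j
    fin_cases i <;> fin_cases j <;> simp [so3Mat] <;> ring
  · ext i j
    fin_cases i <;> fin_cases j <;> simp [so3Mat] <;> ring

theorem sqrt3_sq : √3 * √3 = (3 : ℝ) := Real.mul_self_sqrt (by norm_num)

/-- A skew-symmetric matrix which annihilates the cubic form belongs to `so(3)`. -/
theorem exists_so3Mat_of_annihilates (A : Matrix (Fin 5) (Fin 5) ℝ) (hs : ∀ i j, A j i = -A i j)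
    (hU : ∀ i j k : Fin 5, upsTri (A i) (Pi.single j 1) (Pi.single k 1)
      + upsTri (Pi.single i 1) (A j) (Pi.single k 1)
      + upsTri (Pi.single i 1) (Pi.single j 1) (A k) = 0) : ∃ v, A = so3Mat v := by
  have hd : ∀ i, A i i = 0 := fun i ↦ by linarith [hs i i]
  have s3 := sqrt3_sq
  have h001 := hU 0 0 1
  have h003 := hU 0 0 3
  have h012 := hU 0 1 2
  have h014 := hU 0 1 4
  have h023 := hU 0 2 3
  have h034 := hU 0 3 4
  have h122 := hU 1 2 2
  simp [upsTri, hd] at h001 h003 h012 h014 h023 h034 h122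
  have e10 := hs 0 1
  have e20 := hs 0 2
  have e30 := hs 0 3
  have e40 := hs 0 4
  have e21 := hs 1 2
  have e31 := hs 1 3
  have e41 := hs 1 4
  have e32 := hs 2 3
  have e42 := hs 2 4
  have e43 := hs 3 4
  have f01 : A 0 1 = 0 := by linarith
  have f03 : A 0 3 = 0 := by linarith
  have f02 : A 0 2 = √3 * A 1 4 := by
    linear_combination (2 / 3 * √3) * (h014 - e41) - (1 / 3 * A 0 2) * s3
  have f04 : A 0 4 = √3 * A 1 2 := by
    linear_combination (2 / 3 * √3) * (h012 - e21) - (1 / 3 * A 0 4) * s3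
  have f13 : A 1 3 = 2 * A 2 4 := by
    linear_combination (-2 / 3 * √3) * (h122 + 1 / 2 * e10 - 1 / 2 * f01)
      - 1 / 3 * (A 1 3 - 2 * A 2 4) * s3
  have f23 : A 2 3 = A 1 4 := by
    linear_combination (2 / 3) * (h023 + 1 / 2 * e32) + √3 / 3 * f02 + 1 / 3 * A 1 4 * s3
  have f34 : A 3 4 = A 1 2 := by
    linear_combination (-2 / 3) * (h034 - e43) + √3 / 3 * f04 + 1 / 3 * A 1 2 * s3
  refine ⟨![-A 1 4, -A 2 4, -A 1 2], ?_⟩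
  ext i j
  fin_cases i <;> fin_cases j <;>
    simp [so3Mat, hd, e10, e20, e30, e40, e21, e31, e41, e32, e42, e43, f01, f03, f13, f02, f04,
      f23, f34]

end Pointwise

section Pointwise
variable {M : Type*} [TopologicalSpace M] [ChartedSpace E5 M] [IsManifold (𝓡 5) ∞ M]
  {S : IrreducibleSO3Structure M} {p : M} {a b : Fin 5 → TangentSpace (𝓡 5) p}

/-- The eigenvalue equation that defines `Λ²₃`, solved in an adapted basis. -/
theorem exists_so3Mat_of_eigen (F : Matrix (Fin 5) (Fin 5) ℝ)
    (h : ∀ i l : Fin 5, 4 * ∑ j, ∑ k, upsTri (F j) (Pi.single k 1) (Pi.single l 1) *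
      upsTri (Pi.single j 1) (Pi.single i 1) (Pi.single k 1) = 7 * F i l) :
    ∃ v, F = so3Mat v := by
  have h00 := h 0 0
  have h01 := h 0 1
  have h02 := h 0 2
  have h03 := h 0 3
  have h04 := h 0 4
  have h10 := h 1 0
  have h11 := h 1 1
  have h12 := h 1 2
  have h13 := h 1 3
  have h14 := h 1 4
  have h20 := h 2 0
  have h21 := h 2 1
  have h22 := h 2 2
  have h23 := h 2 3
  have h24 := h 2 4
  have h30 := h 3 0
  have h31 := h 3 1
  have h32 := h 3 2
  have h33 := h 3 3
  have h34 := h 3 4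
  have h40 := h 4 0
  have h41 := h 4 1
  have h42 := h 4 2
  have h43 := h 4 3
  have h44 := h 4 4
  simp [Fin.sum_univ_five, upsTri] at h00 h01 h02 h03 h04 h10 h11 h12 h13 h14 h20 h21 h22
  simp [Fin.sum_univ_five, upsTri] at h23 h24 h30 h31 h32 h33 h34 h40 h41 h42 h43 h44
  -- Multiplying the equations with an index `0` by `√3` makes the system linear with rational
  -- coefficients in the unknowns `√3 * F 0 i`, `√3 * F i 0` and `F i j`.
  replace h01 := congrArg (fun r ↦ √3 * r) h01
  replace h02 := congrArg (fun r ↦ √3 * r) h02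
  replace h03 := congrArg (fun r ↦ √3 * r) h03
  replace h04 := congrArg (fun r ↦ √3 * r) h04
  replace h10 := congrArg (fun r ↦ √3 * r) h10
  replace h20 := congrArg (fun r ↦ √3 * r) h20
  replace h30 := congrArg (fun r ↦ √3 * r) h30
  replace h40 := congrArg (fun r ↦ √3 * r) h40
  ring_nf at h00 h01 h02 h03 h04 h10 h11 h12 h13 h14 h20 h21 h22
  ring_nf at h23 h24 h30 h31 h32 h33 h34 h40 h41 h42 h43 h44
  have s3' : √3 ^ 2 = (3 : ℝ) := Real.sq_sqrt (by norm_num)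
  simp only [s3'] at h00 h01 h02 h03 h04 h10 h11 h12 h13 h14 h20 h21 h22
  simp only [s3'] at h23 h24 h30 h31 h32 h33 h34 h40 h41 h42 h43 h44
  have s3 := sqrt3_sq
  have hne : (√3 : ℝ) ≠ 0 := by positivity
  have g03 : F 0 3 * √3 = 0 := by linarith only [h03, h30, h22, h44]
  have g30 : F 3 0 * √3 = 0 := by linarith only [h03, h30, h22, h44]
  have d0 : F 0 0 = 0 := by linarith only [h00, h11, h22, h33, h44, g03, g30, h03]
  have d1 : F 1 1 = 0 := by linarith only [h00, h11, h22, h33, h44, g03, g30, h03]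
  have d2 : F 2 2 = 0 := by linarith only [h00, h11, h22, h33, h44, g03, g30, h03]
  have d3 : F 3 3 = 0 := by linarith only [h00, h11, h22, h33, h44, g03, g30, h03]
  have d4 : F 4 4 = 0 := by linarith only [h00, h11, h22, h33, h44, g03, g30, h03]
  have g01 : F 0 1 * √3 = 0 := by linarith only [h01, h10, h24, h42, h13, h31]
  have g10 : F 1 0 * √3 = 0 := by linarith only [h01, h10, h24, h42, h13, h31]
  have f31 : F 3 1 = -F 1 3 := by linarith only [h01, h10, h24, h42, h13, h31]
  have f13 : F 1 3 = 2 * F 2 4 := by linarith only [h01, h10, h24, h42, h13, h31]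
  have f42 : F 4 2 = -F 2 4 := by linarith only [h01, h10, h24, h42, h13, h31]
  have f21 : F 2 1 = -F 1 2 := by linarith only [h04, h40, h12, h21, h34, h43]
  have f34 : F 3 4 = F 1 2 := by linarith only [h04, h40, h12, h21, h34, h43]
  have f43 : F 4 3 = -F 1 2 := by linarith only [h04, h40, h12, h21, h34, h43]
  have g04 : F 0 4 * √3 = 3 * F 1 2 := by linarith only [h04, h40, h12, h21, h34, h43]
  have g40 : F 4 0 * √3 = -3 * F 1 2 := by linarith only [h04, h40, h12, h21, h34, h43]
  have f41 : F 4 1 = -F 1 4 := by linarith only [h02, h20, h14, h41, h23, h32]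
  have f23 : F 2 3 = F 1 4 := by linarith only [h02, h20, h14, h41, h23, h32]
  have f32 : F 3 2 = -F 1 4 := by linarith only [h02, h20, h14, h41, h23, h32]
  have g02 : F 0 2 * √3 = 3 * F 1 4 := by linarith only [h02, h20, h14, h41, h23, h32]
  have g20 : F 2 0 * √3 = -3 * F 1 4 := by linarith only [h02, h20, h14, h41, h23, h32]
  have f01 : F 0 1 = 0 := by simpa using g01
  have f10 : F 1 0 = 0 := by simpa using g10
  have f03 : F 0 3 = 0 := by simpa using g03
  have f30 : F 3 0 = 0 := by simpa using g30
  have f04 : F 0 4 = √3 * F 1 2 :=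
    mul_right_cancel₀ hne (by linear_combination g04 - F 1 2 * s3)
  have f40 : F 4 0 = -(√3 * F 1 2) :=
    mul_right_cancel₀ hne (by linear_combination g40 + F 1 2 * s3)
  have f02 : F 0 2 = √3 * F 1 4 :=
    mul_right_cancel₀ hne (by linear_combination g02 - F 1 4 * s3)
  have f20 : F 2 0 = -(√3 * F 1 4) :=
    mul_right_cancel₀ hne (by linear_combination g20 + F 1 4 * s3)
  refine ⟨![-F 1 4, -F 2 4, -F 1 2], ?_⟩
  ext i j
  fin_cases i <;> fin_cases j <;>
    simp [so3Mat, d0, d1, d2, d3, d4, f01, f10, f03, f30, f31, f13, f42, f21, f34, f43, f41, f23,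
      f32, f04, f40, f02, f20]

/-- The elements of `so(3)` satisfy the eigenvalue equation that defines `Λ²₃`. -/
theorem so3Mat_eigen (v : Fin 3 → ℝ) (i l : Fin 5) :
    4 * ∑ j, ∑ k, upsTri (so3Mat v j) (Pi.single k 1) (Pi.single l 1) *
      upsTri (Pi.single j 1) (Pi.single i 1) (Pi.single k 1) = 7 * so3Mat v i l := by
  have s3 : √3 ^ 2 = (3 : ℝ) := Real.sq_sqrt (by norm_num)
  fin_cases i <;> fin_cases l <;> simp [Fin.sum_univ_five, upsTri, so3Mat] <;> ring_nf <;>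
    simp only [s3] <;> ring

end Pointwise

/-! ### The bundle `Λ²₃` and the vector `ξ` in an adapted basis -/

section Pointwise
variable {M : Type*} [TopologicalSpace M] [ChartedSpace E5 M] [IsManifold (𝓡 5) ∞ M]
  {S : IrreducibleSO3Structure M} {p : M} {a b : Fin 5 → TangentSpace (𝓡 5) p}

theorem sum_single_smul {V : Type*} [AddCommGroup V] [Module ℝ V] (c : Fin 5 → V) (i : Fin 5) :
    ∑ j, (Pi.single i (1 : ℝ) : Fin 5 → ℝ) j • c j = c i := by
  simp [Pi.single_apply]

/-- In an adapted basis, `Λ²₃` is `so(3)`. -/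
theorem IsAdapted.mem_lambda23 (h : S.IsAdapted p a) {W : EndT M p} :
    W ∈ S.lambda23 p ↔ ∃ v, mat S a W = so3Mat v := by
  have key : ∀ i l, ∑ j, ∑ k, S.Υ p (W (a j)) (a k) (a l) * S.Υ p (a j) (a i) (a k) =
      ∑ j, ∑ k, upsTri (mat S a W j) (Pi.single k 1) (Pi.single l 1) *
      upsTri (Pi.single j 1) (Pi.single i 1) (Pi.single k 1) := by
    intro i l
    refine Finset.sum_congr rfl fun j _ ↦ Finset.sum_congr rfl fun k _ ↦ ?_
    rw [← h.upsilon_eq, ← h.upsilon_eq]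
    simp only [sum_single_smul, ← h.isON.apply_eq]
  constructor
  · intro hW
    refine exists_so3Mat_of_eigen _ fun i l ↦ ?_
    rw [← key]
    exact hW a h.isON (a i) (a l)
  · rintro ⟨v, hv⟩ e he x y
    -- the contraction over `j` and `k` may be computed in the basis `a`
    have h1 : ∑ j, ∑ k, S.Υ p (W (e j)) (e k) y * S.Υ p (e j) x (e k) =
        ∑ j, ∑ k, S.Υ p (W (a j)) (a k) y * S.Υ p (a j) x (a k) := by
      have hk : ∀ j, ∑ k, S.Υ p (W (e j)) (e k) y * S.Υ p (e j) x (e k) =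
          ∑ k, S.Υ p (W (e j)) (a k) y * S.Υ p (e j) x (a k) := by
        intro j
        exact h.isON.contract (b := e) he
          (LinearMap.mk₂ ℝ (fun u w ↦ S.Υ p (W (e j)) u y * S.Υ p (e j) x w)
            (by intros; simp [add_mul]) (by intros; simp [mul_assoc])
            (by intros; simp [mul_add]) (by intros; simp [mul_left_comm]))
      simp only [hk]
      rw [Finset.sum_comm, Finset.sum_comm (f := fun j k ↦ S.Υ p (W (a j)) (a k) y * _)]
      refine Finset.sum_congr rfl fun k _ ↦ ?_
      exact h.isON.contract (b := e) he
          (LinearMap.mk₂ ℝ (fun u w ↦ S.Υ p (W u) (a k) y * S.Υ p w x (a k))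
            (by intros; simp [add_mul]) (by intros; simp [mul_assoc])
            (by intros; simp [mul_add]) (by intros; simp [mul_left_comm]))
    have h2 : ∀ i l, 4 * ∑ j, ∑ k, S.Υ p (W (a j)) (a k) (a l) * S.Υ p (a j) (a i) (a k) =
        7 * S.g.inner p (W (a i)) (a l) := by
      intro i l
      rw [key, hv, so3Mat_eigen, ← hv]
      rfl
    rw [h1]
    let B₁ : TangentSpace (𝓡 5) p →ₗ[ℝ] TangentSpace (𝓡 5) p →ₗ[ℝ] ℝ :=
      (4 : ℝ) • ∑ j, ∑ k, LinearMap.mk₂ ℝ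
        (fun x y ↦ S.Υ p (W (a j)) (a k) y * S.Υ p (a j) x (a k))
        (by intros; simp [mul_add]) (by intros; simp [mul_left_comm])
        (by intros; simp [add_mul]) (by intros; simp [mul_assoc])
    have hB₁ : ∀ x y, B₁ x y =
        4 * ∑ j, ∑ k, S.Υ p (W (a j)) (a k) y * S.Υ p (a j) x (a k) := by
      intro x y
      simp [B₁, LinearMap.sum_apply]
    let B₂ : TangentSpace (𝓡 5) p →ₗ[ℝ] TangentSpace (𝓡 5) p →ₗ[ℝ] ℝ :=
      LinearMap.mk₂ ℝ (fun x y ↦ 7 * S.g.inner p (W x) y)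
        (by intros; simp [mul_add]) (by intros; simp [mul_left_comm])
        (by intros; simp [mul_add]) (by intros; simp [mul_left_comm])
    have h3 : B₁ = B₂ := by
      refine h.isON.basis.ext fun i ↦ h.isON.basis.ext fun l ↦ ?_
      rw [h.isON.basis_apply, h.isON.basis_apply]
      exact (hB₁ _ _).trans (h2 i l)
    rw [← hB₁, h3]
    rfl

/-- Four times the Pfaffian of the skew part of `F` on the indices `i, j, k, l`. -/
def pfaff (F : Matrix (Fin 5) (Fin 5) ℝ) (i j k l : Fin 5) : ℝ :=
  (F i j - F j i) * (F k l - F l k) - (F i k - F k i) * (F j l - F l j)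
    + (F i l - F l i) * (F j k - F k j)

/-- The coordinates of `ξ_σ = ¼ *(σ ∧ σ)` in terms of the matrix `F` of `σ`. -/
def quad (F : Matrix (Fin 5) (Fin 5) ℝ) : Fin 5 → ℝ :=
  ![1 / 8 * pfaff F 1 2 3 4, -(1 / 8 * pfaff F 0 2 3 4), 1 / 8 * pfaff F 0 1 3 4,
    -(1 / 8 * pfaff F 0 1 2 4), 1 / 8 * pfaff F 0 1 2 3]

/-- The values of a volume form on a basis, as Vandermonde determinants: `288 = 1! 2! 3! 4!`. -/
theorem vol_apply (h : S.vol p a = 1) (f : Fin 5 → Fin 5) :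
    S.vol p (fun i ↦ a (f i)) = (Matrix.vandermonde fun i ↦ ((f i : ℕ) : ℝ)).det / 288 := by
  by_cases hf : Function.Injective f
  · have hb : Function.Bijective f := Finite.injective_iff_bijective.mp hf
    let s : Equiv.Perm (Fin 5) := Equiv.ofBijective f hb
    have h1 : S.vol p (fun i ↦ a (f i)) = (Equiv.Perm.sign s : ℤ) := by
      have := (S.vol p).map_perm a s
      rw [h] at this
      refine (this : S.vol p (fun i ↦ a (f i)) = _).trans ?_
      simp [Units.smul_def]
    have h2 : (Matrix.vandermonde fun i ↦ ((f i : ℕ) : ℝ)) =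
        (Matrix.vandermonde fun i : Fin 5 ↦ ((i : ℕ) : ℝ)).submatrix s id := by
      ext i j
      rfl
    have h3 : (Matrix.vandermonde fun i : Fin 5 ↦ ((i : ℕ) : ℝ)).det = 288 := by
      have := Matrix.det_vandermonde_id_eq_superFactorial (R := ℝ) 4
      refine this.trans ?_
      simp [Nat.superFactorial, Nat.factorial]
    rw [h1, h2, Matrix.det_permute, h3]
    simp
  · have h1 : S.vol p (fun i ↦ a (f i)) = 0 := by
      refine (S.vol p).map_eq_zero_of_not_injective _ fun hi ↦ hf ?_
      exact fun i j hij ↦ hi (by simp [hij])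
    have h2 : (Matrix.vandermonde fun i ↦ ((f i : ℕ) : ℝ)).det = 0 := by
      by_contra h3
      rw [← ne_eq, Matrix.det_vandermonde_ne_zero_iff] at h3
      exact hf fun i j hij ↦ h3 (by simp [hij])
    rw [h1, h2, zero_div]

end Pointwise

section Pointwise
variable {M : Type*} [TopologicalSpace M] [ChartedSpace E5 M] [IsManifold (𝓡 5) ∞ M]
  {S : IrreducibleSO3Structure M} {p : M} {a b : Fin 5 → TangentSpace (𝓡 5) p}

/-- The product of the differences of five indices, divided by `288`: the Levi-Civita symbol. -/
def eps (i j k l m : Fin 5) : ℝ :=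
  ((j : ℕ) - (i : ℕ)) * ((k : ℕ) - (i : ℕ)) * ((l : ℕ) - (i : ℕ)) * ((m : ℕ) - (i : ℕ)) *
  ((k : ℕ) - (j : ℕ)) * ((l : ℕ) - (j : ℕ)) * ((m : ℕ) - (j : ℕ)) *
  ((l : ℕ) - (k : ℕ)) * ((m : ℕ) - (k : ℕ)) * ((m : ℕ) - (l : ℕ)) / 288

theorem vol_eq_eps (h : S.vol p a = 1) (i j k l m : Fin 5) :
    S.vol p ![a i, a j, a k, a l, a m] = eps i j k l m := by
  have h1 : ![a i, a j, a k, a l, a m] = fun n ↦ a (![i, j, k, l, m] n) := by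
    ext1 n
    fin_cases n <;> rfl
  rw [h1, vol_apply h, Matrix.det_vandermonde, eps]
  congr 1
  have e : ∀ i : Fin 5, Finset.Ioi i = Finset.univ.filter (fun j ↦ i < j) := by decide
  simp only [e, Finset.prod_filter, Fin.prod_univ_five]
  simp only [Fin.lt_def]
  simp [-mul_eq_mul_right_iff, -mul_eq_mul_left_iff]
  ring

/-- The contraction with a skew-symmetric matrix, as a sum over the pairs `i < j`. -/
theorem sum_mul_skew (F γ : Fin 5 → Fin 5 → ℝ) (h : ∀ i j, γ j i = -γ i j) :
    ∑ i, ∑ j, F i j * γ i j =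
      (F 0 1 - F 1 0) * γ 0 1 + (F 0 2 - F 2 0) * γ 0 2 + (F 0 3 - F 3 0) * γ 0 3
      + (F 0 4 - F 4 0) * γ 0 4 + (F 1 2 - F 2 1) * γ 1 2 + (F 1 3 - F 3 1) * γ 1 3
      + (F 1 4 - F 4 1) * γ 1 4 + (F 2 3 - F 3 2) * γ 2 3 + (F 2 4 - F 4 2) * γ 2 4
      + (F 3 4 - F 4 3) * γ 3 4 := by
  have hd : ∀ i, γ i i = 0 := fun i ↦ by linarith [h i i]
  simp only [Fin.sum_univ_five, hd, h 0 1, h 0 2, h 0 3, h 0 4, h 1 2, h 1 3, h 1 4, h 2 3, h 2 4,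
    h 3 4]
  ring

theorem eps_swap_left (i j k l m : Fin 5) : eps j i k l m = -eps i j k l m := by
  simp only [eps]; ring

theorem eps_swap_right (i j k l m : Fin 5) : eps i j l k m = -eps i j k l m := by
  simp only [eps]; ring

/-- The contraction of `F ∧ F` with the Levi-Civita symbol that defines `ξ`. -/
theorem sum_eps (F : Matrix (Fin 5) (Fin 5) ℝ) (m : Fin 5) :
    1 / 16 * ∑ i, ∑ j, F i j * ∑ k, ∑ l, F k l * eps i j k l m = quad F m := by
  rw [sum_mul_skew F]
  swap
  · intro i j
    simp only [eps_swap_left i j, mul_neg, Finset.sum_neg_distrib]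
  simp only [sum_mul_skew F _ (fun k l ↦ eps_swap_right _ _ k l m)]
  fin_cases m <;> simp [eps, quad, pfaff] <;> ring

/-- The contraction of an endomorphism with a bilinear form does not depend on the orthonormal
basis. -/
theorem IsON.sum_mat_mul (ha : S.IsON a) (hb : S.IsON b) (σ : EndT M p)
    (B : TangentSpace (𝓡 5) p →ₗ[ℝ] TangentSpace (𝓡 5) p →ₗ[ℝ] ℝ) :
    ∑ i, ∑ j, mat S b σ i j * B (b i) (b j) = ∑ i, ∑ j, mat S a σ i j * B (a i) (a j) := by
  have h : ∀ {c : Fin 5 → TangentSpace (𝓡 5) p}, S.IsON c → ∀ i,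
      ∑ j, mat S c σ i j * B (c i) (c j) = B (c i) (σ (c i)) := by
    intro c hc i
    rw [hc.apply_eq σ i, map_sum]
    simp only [map_smul, smul_eq_mul]
  simp only [h ha, h hb]
  exact ha.contract hb (B.compl₂ (σ : TangentSpace (𝓡 5) p →ₗ[ℝ] TangentSpace (𝓡 5) p))

/-- A `5`-linear form as a linear function of one of its arguments. -/
def slot {V : Type*} [AddCommGroup V] [Module ℝ V] (f : V [⋀^Fin 5]→ₗ[ℝ] ℝ) (m : Fin 5 → V)
    (i : Fin 5) : V →ₗ[ℝ] ℝ := f.toMultilinearMap.toLinearMap m i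

theorem slot_apply {V : Type*} [AddCommGroup V] [Module ℝ V] (f : V [⋀^Fin 5]→ₗ[ℝ] ℝ)
    (u v w x y : V) : f ![u, v, w, x, y] = slot f ![0, v, w, x, y] 0 u ∧
      f ![u, v, w, x, y] = slot f ![u, 0, w, x, y] 1 v ∧
      f ![u, v, w, x, y] = slot f ![u, v, 0, x, y] 2 w ∧
      f ![u, v, w, x, y] = slot f ![u, v, w, 0, y] 3 x ∧
      f ![u, v, w, x, y] = slot f ![u, v, w, x, 0] 4 y := by
  refine ⟨?_, ?_, ?_, ?_, ?_⟩ <;>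
  · refine congrArg f (funext fun n ↦ ?_)
    fin_cases n <;> rfl

/-- The vector `ξ_σ` can be computed in any adapted basis: both contractions of `σ ⊗ σ` with the
volume form are independent of the orthonormal basis. -/
theorem IsAdapted.xi_eq (h : S.IsAdapted p a) (σ : EndT M p) :
    S.xi σ = ∑ i, quad (mat S a σ) i • a i := by
  obtain ⟨e, he, hxi⟩ : ∃ e, S.IsAdapted p e ∧ S.xi σ = ∑ m, (1 / 16 * ∑ i, ∑ j, ∑ k, ∑ l,
      mat S e σ i j * mat S e σ k l * S.vol p ![e i, e j, e k, e l, e m]) • e m :=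
    ⟨S.adaptedBasis p, Classical.choose_spec (S.exists_isAdapted p), rfl⟩
  rw [hxi]
  refine h.isON.ext fun m ↦ ?_
  rw [h.isON.inner_sum, inner_sum_left]
  have h1 : ∀ i j k l, ∑ n, S.vol p ![e i, e j, e k, e l, e n] * S.g.inner p (e n) (a m) =
      S.vol p ![e i, e j, e k, e l, a m] := by
    intro i j k l
    rw [(slot_apply _ _ _ _ _ _).2.2.2.2, he.isON.expand (a m), map_sum]
    refine Finset.sum_congr rfl fun n _ ↦ ?_
    rw [map_smul, ← (slot_apply _ _ _ _ _ _).2.2.2.2, ← he.isON.expand (a m), S.g.symm, smul_eq_mul,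
      mul_comm]
  have h2 : ∑ n, (1 / 16 * ∑ i, ∑ j, ∑ k, ∑ l, mat S e σ i j * mat S e σ k l
      * S.vol p ![e i, e j, e k, e l, e n]) * S.g.inner p (e n) (a m) =
      1 / 16 * ∑ i, ∑ j, mat S e σ i j *
        ∑ k, ∑ l, mat S e σ k l * S.vol p ![e i, e j, e k, e l, a m] := by
    simp only [← h1, Finset.mul_sum, Finset.sum_mul]
    rw [Finset.sum_comm]
    refine Finset.sum_congr rfl fun i _ ↦ ?_
    rw [Finset.sum_comm]
    refine Finset.sum_congr rfl fun j _ ↦ ?_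
    rw [Finset.sum_comm]
    refine Finset.sum_congr rfl fun k _ ↦ ?_
    rw [Finset.sum_comm]
    refine Finset.sum_congr rfl fun l _ ↦ Finset.sum_congr rfl fun n _ ↦ by ring
  rw [h2]
  have k0 := fun u v w x y ↦ (slot_apply (S.vol p) u v w x y).1
  have k1 := fun u v w x y ↦ (slot_apply (S.vol p) u v w x y).2.1
  have k2 := fun u v w x y ↦ (slot_apply (S.vol p) u v w x y).2.2.1
  have k3 := fun u v w x y ↦ (slot_apply (S.vol p) u v w x y).2.2.2.1
  let B₁ : TangentSpace (𝓡 5) p → TangentSpace (𝓡 5) p →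
      TangentSpace (𝓡 5) p →ₗ[ℝ] TangentSpace (𝓡 5) p →ₗ[ℝ] ℝ := fun x y ↦
    LinearMap.mk₂ ℝ (fun u w ↦ S.vol p ![x, y, u, w, a m])
      (by intros; simp only [k2, map_add]) (by intros; simp only [k2, map_smul])
      (by intros; simp only [k3, map_add]) (by intros; simp only [k3, map_smul])
  let B₂ : TangentSpace (𝓡 5) p → TangentSpace (𝓡 5) p →
      TangentSpace (𝓡 5) p →ₗ[ℝ] TangentSpace (𝓡 5) p →ₗ[ℝ] ℝ := fun x y ↦
    LinearMap.mk₂ ℝ (fun u w ↦ S.vol p ![u, w, x, y, a m])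
      (by intros; simp only [k0, map_add]) (by intros; simp only [k0, map_smul])
      (by intros; simp only [k1, map_add]) (by intros; simp only [k1, map_smul])
  have h3 : ∀ i j, ∑ k, ∑ l, mat S e σ k l * S.vol p ![e i, e j, e k, e l, a m] =
      ∑ k, ∑ l, mat S a σ k l * S.vol p ![e i, e j, a k, a l, a m] := fun i j ↦
    h.isON.sum_mat_mul he.isON σ (B₁ (e i) (e j))
  have h4 : ∑ i, ∑ j, mat S e σ i j *
        ∑ k, ∑ l, mat S a σ k l * S.vol p ![e i, e j, a k, a l, a m] =
      ∑ i, ∑ j, mat S a σ i j *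
        ∑ k, ∑ l, mat S a σ k l * S.vol p ![a i, a j, a k, a l, a m] := by
    have := h.isON.sum_mat_mul he.isON σ (∑ k, ∑ l, mat S a σ k l • B₂ (a k) (a l))
    simpa only [LinearMap.sum_apply, LinearMap.smul_apply, smul_eq_mul, B₂,
      LinearMap.mk₂_apply] using this
  simp only [h3, h4, vol_eq_eps h.2.1]
  exact sum_eps _ m

end Pointwise

/-! ### Infinitesimal equivariance, and the algebra of the Killing equation -/

section Pointwise
variable {M : Type*} [TopologicalSpace M] [ChartedSpace E5 M] [IsManifold (𝓡 5) ∞ M]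
  {S : IrreducibleSO3Structure M} {p : M} {a : Fin 5 → TangentSpace (𝓡 5) p}

open scoped Matrix

/-- The polarization of `quad`. -/
def quadPolar (F B : Matrix (Fin 5) (Fin 5) ℝ) (k : Fin 5) : ℝ :=
  quad (F + B) k - quad F k - quad B k

theorem quadPolar_add (F B C : Matrix (Fin 5) (Fin 5) ℝ) (k : Fin 5) :
    quadPolar F (B + C) k = quadPolar F B k + quadPolar F C k := by
  have key : ∀ c i j k l, c * pfaff (F + (B + C)) i j k l - c * pfaff F i j k l
      - c * pfaff (B + C) i j k l = c * pfaff (F + B) i j k l - c * pfaff F i j k l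
      - c * pfaff B i j k l
      + (c * pfaff (F + C) i j k l - c * pfaff F i j k l - c * pfaff C i j k l) := by
    intros
    simp only [pfaff, Matrix.add_apply]
    ring
  have hneg : ∀ c x : ℝ, -(c * x) = -c * x := fun c x ↦ (neg_mul c x).symm
  simp only [quadPolar, quad, hneg]
  fin_cases k <;> exact key _ _ _ _ _

/-- The components of `ξ_v` form a basis of the harmonic quadratic polynomials in `v`. -/
theorem quad_so3Mat (v : Fin 3 → ℝ) : quad (so3Mat v) =
    ![(v 0 ^ 2 - 2 * v 1 ^ 2 + v 2 ^ 2) / 2, -(√3 * v 0 * v 2), √3 * v 1 * v 2,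
      √3 / 2 * (v 0 ^ 2 - v 2 ^ 2), -(√3 * v 0 * v 1)] := by
  ext k
  fin_cases k <;> simp [quad, pfaff, so3Mat] <;> ring

set_option maxHeartbeats 1000000 in
/-- The Lie bracket of `so(3)` is the cross product of `ℝ³`, up to sign. -/
theorem so3Mat_lie (g v : Fin 3 → ℝ) :
    so3Mat g * so3Mat v - so3Mat v * so3Mat g = -so3Mat (g ⨯₃ v) := by
  have s3 : √3 ^ 2 = (3 : ℝ) := Real.sq_sqrt (by norm_num)
  ext i j
  rw [Matrix.sub_apply, Matrix.mul_apply, Matrix.mul_apply, Fin.sum_univ_five, Fin.sum_univ_five,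
    Matrix.neg_apply]
  fin_cases i <;> fin_cases j <;>
    simp [so3Mat, cross_apply] <;> ring_nf <;> simp only [s3] <;> ring

/-- The trace form of `so(3)` is a multiple of the dot product of `ℝ³`. -/
theorem sum_so3Mat_mul (v w : Fin 3 → ℝ) :
    ∑ i, ∑ j, so3Mat v i j * so3Mat w j i = -10 * v ⬝ᵥ w := by
  have s3 : √3 ^ 2 = (3 : ℝ) := Real.sq_sqrt (by norm_num)
  simp [so3Mat, Fin.sum_univ_five, Fin.sum_univ_three, dotProduct]
  ring_nf
  simp only [s3]
  ring

/-- `F ↦ *(F ∧ F)` is infinitesimally equivariant under `so(3)`. -/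
theorem quadPolar_cross (v g : Fin 3 → ℝ) (k : Fin 5) :
    quadPolar (so3Mat v) (so3Mat (g ⨯₃ v)) k = ∑ j, quad (so3Mat v) j * so3Mat g j k := by
  have s3 : √3 ^ 2 = (3 : ℝ) := Real.sq_sqrt (by norm_num)
  rw [quadPolar, ← (isLinear_so3Mat _ _ 0).1]
  simp only [quad_so3Mat, cross_apply, Fin.sum_univ_five]
  fin_cases k <;> simp [so3Mat] <;> ring_nf
  simp only [s3]

/-- The coordinates of the orthogonal projection of `x ∧ y` onto `so(3)`. -/
def projVec (x y : Fin 5 → ℝ) : Fin 3 → ℝ :=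
  fun r ↦ 1 / 5 * ∑ i, ∑ j, x i * y j * so3Mat (Pi.single r 1) i j

/-- The defining property of the projection, in which the factor `5` is the squared length of a unit
vector of `ℝ³` as an element of `so(3)`. -/
theorem projVec_dotProduct (x y : Fin 5 → ℝ) (g : Fin 3 → ℝ) :
    5 * projVec x y ⬝ᵥ g = ∑ i, ∑ j, x i * y j * so3Mat g i j := by
  simp [projVec, dotProduct, Fin.sum_univ_three, Fin.sum_univ_five, so3Mat]
  ring

/-- A bilinear map `D : Λ²ℝ⁵ → ℝ³`, for which `D(ξ_v, b)` is a multiple of `v` for all unit `v`,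
vanishes: the vectors `ξ_v` span `ℝ⁵`, and `D(ξ_v, ξ_w)` is a multiple both of `v` and of `w`. -/
theorem eq_zero_of_cross_eq_zero (D : (Fin 5 → ℝ) →ₗ[ℝ] (Fin 5 → ℝ) →ₗ[ℝ] (Fin 3 → ℝ))
    (hD : ∀ x y, D y x = -D x y)
    (h : ∀ v : Fin 3 → ℝ, v ⬝ᵥ v = 1 → ∀ b, D (quad (so3Mat v)) b ⨯₃ v = 0) : D = 0 := by
  -- As `ξ_v` is quadratic in `v`, the restriction to unit vectors can be dropped.
  have h' : ∀ v : Fin 3 → ℝ, ∀ b, D (quad (so3Mat v)) b ⨯₃ v = 0 := by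
    intro v b
    by_cases hv : v = 0
    · simp [hv]
    have hpos : 0 < v ⬝ᵥ v := by
      have : 0 ≤ v ⬝ᵥ v := Finset.sum_nonneg fun i _ ↦ mul_self_nonneg (v i)
      exact lt_of_le_of_ne this fun h0 ↦ hv (dotProduct_self_eq_zero.mp h0.symm)
    set s := √(v ⬝ᵥ v) with hs
    have hs0 : s ≠ 0 := (Real.sqrt_pos.mpr hpos).ne'
    have hss : s * s = v ⬝ᵥ v := Real.mul_self_sqrt hpos.le
    have h1 := h (s⁻¹ • v) (by
      rw [smul_dotProduct, dotProduct_smul, ← hss]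
      simp [hs0]) b
    have h2 : quad (so3Mat (s⁻¹ • v)) = (s⁻¹ * s⁻¹) • quad (so3Mat v) := by
      simp only [quad_so3Mat]
      ext k
      fin_cases k <;> simp <;> ring
    rw [h2] at h1
    simp only [map_smul, LinearMap.smul_apply, smul_smul] at h1
    exact (smul_eq_zero.mp h1).resolve_left (by simp [hs0])
  -- For independent `v` and `w`, a common multiple of both is zero.
  have hind : ∀ v w : Fin 3 → ℝ, v ⨯₃ w ≠ 0 → D (quad (so3Mat v)) (quad (so3Mat w)) = 0 := by
    intro v w hvw
    have h1 := h' v (quad (so3Mat w))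
    have h2 : D (quad (so3Mat v)) (quad (so3Mat w)) ⨯₃ w = 0 := by
      have := h' w (quad (so3Mat v))
      rw [hD (quad (so3Mat v)), map_neg, LinearMap.neg_apply] at this
      exact neg_eq_zero.mp this
    generalize D (quad (so3Mat v)) (quad (so3Mat w)) = d at h1 h2
    have hc : ∀ u : Fin 3 → ℝ, d ⨯₃ u = 0 → ∀ i j, d i * u j = d j * u i := by
      intro u hu i j
      have c0 := congrFun hu 0
      have c1 := congrFun hu 1
      have c2 := congrFun hu 2
      simp [cross_apply] at c0 c1 c2
      fin_cases i <;> fin_cases j <;> simp <;> linarith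
    have h3 : ∀ l i j, d l * (v i * w j - v j * w i) = 0 := fun l i j ↦ by
      linear_combination w j * hc v h1 l i - w i * hc v h1 l j + v l * hc w h2 i j
    ext l
    by_contra hl
    have h4 : ∀ i j, v i * w j - v j * w i = 0 := fun i j ↦
      (mul_eq_zero.mp (h3 l i j)).resolve_left hl
    refine hvw ?_
    ext k
    fin_cases k <;> simp [cross_apply, h4]
  -- Five vectors, no two of them proportional, for which the vectors `ξ` form a basis of `ℝ⁵`.
  let V : Fin 5 → Fin 3 → ℝ := ![![1, 0, 0], ![0, 1, 0], ![1, 0, 1], ![0, 1, 1], ![1, 1, 0]]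
  have hV : ∀ i j, D (quad (so3Mat (V i))) (quad (so3Mat (V j))) = 0 := by
    have hself : ∀ x, D x x = 0 := fun x ↦ self_eq_neg.mp (hD x x)
    intro i j
    by_cases hij : i = j
    · rw [hij, hself]
    · refine hind _ _ fun h0 ↦ ?_
      have c0 := congrFun h0 0
      have c1 := congrFun h0 1
      have c2 := congrFun h0 2
      fin_cases i <;> fin_cases j <;> simp [V, cross_apply] at hij c0 c1 c2
  have hne : (√3 : ℝ) ≠ 0 := by positivity
  have hspan : ∀ y : Fin 5 → ℝ, ∃ c : Fin 5 → ℝ, y = ∑ i, c i • quad (so3Mat (V i)) := by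
    intro y
    let c1 := 2 * y 3 / √3 + y 2 / √3 + y 4 / √3
    refine ⟨![c1, c1 / 2 - y 1 / √3 - y 2 / √3 / 2 + y 4 / √3 / 2 - y 0, -(y 1 / √3), y 2 / √3,
      -(y 4 / √3)], ?_⟩
    ext k
    simp only [V, quad_so3Mat, Fin.sum_univ_five, c1]
    fin_cases k <;> simp <;> field_simp <;> ring
  refine LinearMap.ext fun x ↦ LinearMap.ext fun y ↦ ?_
  obtain ⟨c, rfl⟩ := hspan x
  obtain ⟨d, rfl⟩ := hspan y
  simp [map_sum, LinearMap.sum_apply, hV]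

end Pointwise

/-! ### Adapted frames -/

section Frames
variable {M : Type*} [TopologicalSpace M] [ChartedSpace E5 M] [IsManifold (𝓡 5) ∞ M]
  (S : IrreducibleSO3Structure M)

/-- Five global smooth vector fields which form an adapted basis at all points of a neighbourhood
`U` of `x₀`. -/
structure AdaptedFrame (x₀ : M) where
  /-- the vector fields -/
  e : Fin 5 → (x : M) → TangentSpace (𝓡 5) x
  /-- the open set on which they are adapted -/
  U : Set M
  smooth : ∀ i, ContMDiff (𝓡 5) ((𝓡 5).prod 𝓘(ℝ, E5)) ∞
    (fun x ↦ (⟨x, e i x⟩ : TotalSpace E5 (fun x : M ↦ TangentSpace (𝓡 5) x)))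
  isOpen : IsOpen U
  mem : x₀ ∈ U
  adapted : ∀ x ∈ U, S.IsAdapted x (fun i ↦ e i x)

/-- A local adapted frame becomes global when multiplied by a bump function, which needs the
manifold to be Hausdorff; it stays adapted where the bump function is `1`. -/
theorem exists_adaptedFrame [T2Space M] (x₀ : M) : Nonempty (AdaptedFrame S x₀) := by
  obtain ⟨U, hU, hx₀, e, he, had⟩ := S.exists_adapted_frame x₀
  obtain ⟨f, -, hf⟩ := (SmoothBumpFunction.nhds_basis_tsupport (I := 𝓡 5) x₀).mem_iff.mp
    (hU.mem_nhds hx₀)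
  have h1 : ∀ᶠ x in 𝓝 x₀, f x = 1 := f.eventuallyEq_one
  obtain ⟨V, hV, hVo, hxV⟩ := eventually_nhds_iff.mp (h1.and (hU.mem_nhds hx₀))
  refine ⟨⟨fun i x ↦ f x • e i x, V, fun i ↦ ?_, hVo, hxV, fun x hx ↦ ?_⟩⟩
  · exact ContMDiffOn.smul_section_of_tsupport f.contMDiff.contMDiffOn hU hf (he i)
  · have h2 : (fun i ↦ f x • e i x) = fun i ↦ e i x := by
      funext i
      rw [(hV x hx).1, one_smul]
    rw [h2]
    exact had x (hV x hx).2

variable {S}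

theorem AdaptedFrame.isON {x₀ : M} (fr : AdaptedFrame S x₀) {x : M} (hx : x ∈ fr.U) :
    S.IsON (fun i ↦ fr.e i x) := (fr.adapted x hx).isON

theorem AdaptedFrame.diffAt {x₀ : M} (fr : AdaptedFrame S x₀) (i : Fin 5) (x : M) :
    DiffAt (fr.e i) x := (fr.smooth i).mdifferentiable (by simp) x

theorem AdaptedFrame.eventually_mem {x₀ : M} (fr : AdaptedFrame S x₀) {x : M} (hx : x ∈ fr.U) :
    ∀ᶠ y in 𝓝 x, y ∈ fr.U := fr.isOpen.mem_nhds hx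

theorem contMDiffAt_inner {E H N : Type*} [NormedAddCommGroup E] [NormedSpace ℝ E]
    [TopologicalSpace H] {I : ModelWithCorners ℝ E H} [TopologicalSpace N] [ChartedSpace H N]
    {b : N → M} {n : N} {X Y : (y : N) → TangentSpace (𝓡 5) (b y)}
    (hX : ContMDiffAt I ((𝓡 5).prod 𝓘(ℝ, E5)) ∞
      (fun y ↦ (⟨b y, X y⟩ : TotalSpace E5 (fun x : M ↦ TangentSpace (𝓡 5) x))) n)
    (hY : ContMDiffAt I ((𝓡 5).prod 𝓘(ℝ, E5)) ∞
      (fun y ↦ (⟨b y, Y y⟩ : TotalSpace E5 (fun x : M ↦ TangentSpace (𝓡 5) x))) n) :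
    ContMDiffAt I 𝓘(ℝ, ℝ) ∞ (fun y ↦ S.g.inner (b y) (X y) (Y y)) n := by
  have hb : ContMDiffAt I (𝓡 5) ∞ b n := by
    simp only [contMDiffAt_totalSpace] at hX
    exact hX.1
  have h1 : ContMDiffAt I ((𝓡 5).prod 𝓘(ℝ)) ∞
      (fun y ↦ TotalSpace.mk' ℝ (E := Bundle.Trivial M ℝ) (b y) (S.g.inner (b y) (X y) (Y y)))
      n := by
    apply ContMDiffAt.clm_bundle_apply₂ (F₁ := E5) (F₂ := E5)
    · exact ContMDiffAt.comp n S.g.contMDiff.contMDiffAt hb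
    · exact hX
    · exact hY
  simp only [contMDiffAt_totalSpace] at h1
  exact h1.2

variable (cov : Connection M)

/-- The connection forms `v ↦ g(∇_v e_k, e_l)` of a frame. -/
def AdaptedFrame.conn {x₀ : M} (fr : AdaptedFrame S x₀) (k l : Fin 5) (x : M) :
    TangentSpace (𝓡 5) x →L[ℝ] ℝ :=
  (S.g.inner x (fr.e l x)).comp (cov (fr.e k) x)

theorem AdaptedFrame.conn_apply {x₀ : M} (fr : AdaptedFrame S x₀) (k l : Fin 5) (x : M)
    (v : TangentSpace (𝓡 5) x) :
    fr.conn cov k l x v = S.g.inner x (cov (fr.e k) x v) (fr.e l x) := S.g.symm _ _ _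

variable {cov}

theorem contMDiffAt_cov [CovariantDerivative.ContMDiffCovariantDerivative cov ∞]
    {X Y : (x : M) → TangentSpace (𝓡 5) x} {x : M}
    (hX : ContMDiff (𝓡 5) ((𝓡 5).prod 𝓘(ℝ, E5)) ∞
      (fun x ↦ (⟨x, X x⟩ : TotalSpace E5 (fun x : M ↦ TangentSpace (𝓡 5) x))))
    (hY : ContMDiffAt (𝓡 5) ((𝓡 5).prod 𝓘(ℝ, E5)) ∞
      (fun x ↦ (⟨x, Y x⟩ : TotalSpace E5 (fun x : M ↦ TangentSpace (𝓡 5) x))) x) :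
    ContMDiffAt (𝓡 5) ((𝓡 5).prod 𝓘(ℝ, E5)) ∞
      (fun x ↦ (⟨x, cov X x (Y x)⟩ : TotalSpace E5 (fun x : M ↦ TangentSpace (𝓡 5) x))) x := by
  have h := (CovariantDerivative.ContMDiffCovariantDerivative.contMDiff (cov := cov)
    (k := ∞)).contMDiff (σ := X) (by simpa using hX.contMDiffOn)
  exact ContMDiffAt.clm_bundle_apply (h.contMDiffAt Filter.univ_mem) hY

theorem AdaptedFrame.contMDiffAt_conn [CovariantDerivative.ContMDiffCovariantDerivative cov ∞]
    {x₀ : M} (fr : AdaptedFrame S x₀) (i k l : Fin 5) (x : M) :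
    ContMDiffAt (𝓡 5) 𝓘(ℝ, ℝ) ∞ (fun x ↦ fr.conn cov k l x (fr.e i x)) x :=
  contMDiffAt_inner (b := id) (fr.smooth l x) (contMDiffAt_cov (fr.smooth k) (fr.smooth i x))

variable {x₀ : M} (fr : AdaptedFrame S x₀) {x : M}

/-- The connection forms are skew-symmetric, as `∇g = 0`. -/
theorem AdaptedFrame.conn_skew (hcov : S.IsSO3Connection cov) (hx : x ∈ fr.U) (k l : Fin 5)
    (v : TangentSpace (𝓡 5) x) : fr.conn cov l k x v = -fr.conn cov k l x v := by
  have h1 := hcov.metric x (fr.e k) (fr.e l) (fr.diffAt k x) (fr.diffAt l x) v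
  have h2 : mvfderiv (𝓡 5) (fun y ↦ S.g.inner y (fr.e k y) (fr.e l y)) x v = 0 := by
    rw [mvfderiv_congr (g := fun _ ↦ if k = l then (1 : ℝ) else 0) ?_ v, mvfderiv_const]
    · rfl
    · filter_upwards [fr.eventually_mem hx] with y hy using fr.isON hy k l
  rw [fr.conn_apply, fr.conn_apply, S.g.symm x (cov (fr.e l) x v)]
  linarith

theorem AdaptedFrame.cov_eq (hx : x ∈ fr.U) (k : Fin 5) (v : TangentSpace (𝓡 5) x) :
    cov (fr.e k) x v = ∑ l, fr.conn cov k l x v • fr.e l x := by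
  simp only [fr.conn_apply]
  exact (fr.isON hx).expand _

/-- The connection forms take values in `so(3)`: `∇Υ = 0`, and the components of `Υ` in an adapted
frame are constant, so that the connection matrix annihilates the cubic form. -/
theorem AdaptedFrame.exists_conn_eq_so3Mat (hcov : S.IsSO3Connection cov) (hx : x ∈ fr.U)
    (v : TangentSpace (𝓡 5) x) : ∃ r, (fun k l ↦ fr.conn cov k l x v) = so3Mat r := by
  refine exists_so3Mat_of_annihilates _ (fun i j ↦ fr.conn_skew hcov hx i j v) fun i j k ↦ ?_
  have hU : ∀ y ∈ fr.U, ∀ i j k, S.Υ y (fr.e i y) (fr.e j y) (fr.e k y) =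
      upsTri (Pi.single i 1) (Pi.single j 1) (Pi.single k 1) := by
    intro y hy i j k
    rw [← (fr.adapted y hy).upsilon_eq]
    simp only [sum_single_smul (fun i ↦ fr.e i y)]
  have h1 := hcov.upsilon x (fr.e i) (fr.e j) (fr.e k) (fr.diffAt i x) (fr.diffAt j x)
    (fr.diffAt k x) v
  have h2 : mvfderiv (𝓡 5) (fun y ↦ S.Υ y (fr.e i y) (fr.e j y) (fr.e k y)) x v = 0 := by
    rw [mvfderiv_congr
      (g := fun _ ↦ upsTri (Pi.single i 1) (Pi.single j 1) (Pi.single k 1)) ?_ v, mvfderiv_const]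
    · rfl
    · filter_upwards [fr.eventually_mem hx] with y hy using hU y hy i j k
  rw [h2] at h1
  rw [← (fr.adapted x hx).upsilon_eq, ← (fr.adapted x hx).upsilon_eq,
    ← (fr.adapted x hx).upsilon_eq]
  simp only [sum_single_smul (fun i ↦ fr.e i x), ← fr.cov_eq hx]
  exact h1.symm

/-- The part of the characteristic condition that enters the Killing equation: the sum of the
connection form and the bracket is skew, as the torsion is totally skew. -/
theorem AdaptedFrame.torsion_skew (hcov : S.IsCharacteristic cov) (hx : x ∈ fr.U)
    (j i k : Fin 5) :
    fr.conn cov j k x (fr.e i x)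
        + S.g.inner x (VectorField.mlieBracket (𝓡 5) (fr.e j) (fr.e i) x) (fr.e k x)
      + (fr.conn cov j i x (fr.e k x)
        + S.g.inner x (VectorField.mlieBracket (𝓡 5) (fr.e j) (fr.e k) x) (fr.e i x)) = 0 := by
  have h1 := hcov.skew_right x (fr.e j x) (fr.e i x) (fr.e k x)
  have ht : ∀ i k, S.g.inner x (cov.torsion x (fr.e j x) (fr.e i x)) (fr.e k x) =
      fr.conn cov i k x (fr.e j x) - fr.conn cov j k x (fr.e i x)
      - S.g.inner x (VectorField.mlieBracket (𝓡 5) (fr.e j) (fr.e i) x) (fr.e k x) := by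
    intro i k
    rw [cov.torsion_apply (fr.diffAt j x) (fr.diffAt i x), fr.conn_apply, fr.conn_apply]
    simp only [map_sub, sub_apply]
  rw [ht, ht] at h1
  have h2 := fr.conn_skew hcov.toIsSO3Connection hx i k (fr.e j x)
  linarith

end Frames

/-! ### The curvature in an adapted frame -/

section Curvature
variable {M : Type*} [TopologicalSpace M] [ChartedSpace E5 M] [IsManifold (𝓡 5) ∞ M]
  {S : IrreducibleSO3Structure M} {cov : Connection M} {x₀ : M} (fr : AdaptedFrame S x₀)

variable (cov) in
/-- The curvature forms `(dω_kl - ∑ₘ ω_km ∧ ω_ml)(eⱼ, eᵢ)` of the connection forms `ω` of an adapted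
frame. -/
def AdaptedFrame.curv (x : M) (j i : Fin 5) : Matrix (Fin 5) (Fin 5) ℝ := fun k l ↦
  mvfderiv (𝓡 5) (fun y ↦ fr.conn cov k l y (fr.e i y)) x (fr.e j x)
    - mvfderiv (𝓡 5) (fun y ↦ fr.conn cov k l y (fr.e j y)) x (fr.e i x)
    - fr.conn cov k l x (VectorField.mlieBracket (𝓡 5) (fr.e j) (fr.e i) x)
    - ∑ m, (fr.conn cov k m x (fr.e j x) * fr.conn cov m l x (fr.e i x)
      - fr.conn cov k m x (fr.e i x) * fr.conn cov m l x (fr.e j x))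

theorem AdaptedFrame.curv_skew (x : M) (j i k l : Fin 5) :
    fr.curv cov x i j k l = -fr.curv cov x j i k l := by
  simp only [AdaptedFrame.curv, Finset.sum_sub_distrib]
  rw [VectorField.mlieBracket_swap]
  have : fr.conn cov k l x ((-VectorField.mlieBracket (𝓡 5) (fr.e j) (fr.e i)) x) =
    -fr.conn cov k l x (VectorField.mlieBracket (𝓡 5) (fr.e j) (fr.e i) x) := map_neg _ _
  rw [this]
  ring

/-- `so(3)`, as the linear image of `ℝ³`. -/
def so3Lin : (Fin 3 → ℝ) →ₗ[ℝ] Matrix (Fin 5) (Fin 5) ℝ where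
  toFun := so3Mat
  map_add' v w := (isLinear_so3Mat v w 0).1
  map_smul' c v := (isLinear_so3Mat v v c).2

theorem so3Mat_eq_sum (v : Fin 3 → ℝ) (k l : Fin 5) :
    so3Mat v k l = ∑ r, v r * so3Mat (Pi.single r 1) k l := by
  fin_cases k <;> fin_cases l <;> simp [so3Mat, Fin.sum_univ_three, mul_comm]

/-- The derivatives of the connection forms take values in `so(3)`, which is a linear space. -/
theorem AdaptedFrame.exists_mvfderiv_eq_so3Mat
    [CovariantDerivative.ContMDiffCovariantDerivative cov ∞] (hcov : S.IsSO3Connection cov) {x : M}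
    (hx : x ∈ fr.U) (i : Fin 5) (v : TangentSpace (𝓡 5) x) :
    ∃ r, (fun k l ↦ mvfderiv (𝓡 5) (fun y ↦ fr.conn cov k l y (fr.e i y)) x v) = so3Mat r := by
  let c : M → Fin 3 → ℝ := fun y ↦ ![-fr.conn cov 1 4 y (fr.e i y), -fr.conn cov 2 4 y (fr.e i y),
    -fr.conn cov 1 2 y (fr.e i y)]
  have hc : ∀ y ∈ fr.U, (fun k l ↦ fr.conn cov k l y (fr.e i y)) = so3Mat (c y) := by
    intro y hy
    obtain ⟨r, hr⟩ := fr.exists_conn_eq_so3Mat hcov hy (fr.e i y)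
    rw [hr]
    congr 1
    have h0 := congrFun (congrFun hr 1) 4
    have h1 := congrFun (congrFun hr 2) 4
    have h2 := congrFun (congrFun hr 1) 2
    ext s
    fin_cases s <;> simp [c, h0, h1, h2] <;> simp [so3Mat]
  have hcs : ∀ r, ContMDiffAt (𝓡 5) 𝓘(ℝ, ℝ) ∞ (fun y ↦ c y r) x := by
    intro r
    fin_cases r <;> exact (fr.contMDiffAt_conn _ _ _ x).neg
  refine ⟨fun r ↦ mvfderiv (𝓡 5) (fun y ↦ c y r) x v, ?_⟩
  ext k l
  rw [so3Mat_eq_sum, mvfderiv_congr (g := fun y ↦ ∑ r, c y r * so3Mat (Pi.single r 1) k l) ?_ v,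
    mvfderiv_sum_mul (g := fun r _ ↦ so3Mat (Pi.single r 1) k l) _ hcs fun r ↦ contMDiffAt_const]
  · simp [mvfderiv_const]
  · filter_upwards [fr.eventually_mem hx] with y hy
    rw [← so3Mat_eq_sum, ← hc y hy]

/-- The curvature forms take values in `so(3)`, as this space is closed under the Lie bracket. -/
theorem AdaptedFrame.exists_curv_eq_so3Mat
    [CovariantDerivative.ContMDiffCovariantDerivative cov ∞] (hcov : S.IsSO3Connection cov) {x : M}
    (hx : x ∈ fr.U) (j i : Fin 5) : ∃ r, fr.curv cov x j i = so3Mat r := by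
  obtain ⟨r₁, h₁⟩ := fr.exists_mvfderiv_eq_so3Mat hcov hx i (fr.e j x)
  obtain ⟨r₂, h₂⟩ := fr.exists_mvfderiv_eq_so3Mat hcov hx j (fr.e i x)
  obtain ⟨r₃, h₃⟩ := fr.exists_conn_eq_so3Mat hcov hx
    (VectorField.mlieBracket (𝓡 5) (fr.e j) (fr.e i) x)
  obtain ⟨r₄, h₄⟩ := fr.exists_conn_eq_so3Mat hcov hx (fr.e j x)
  obtain ⟨r₅, h₅⟩ := fr.exists_conn_eq_so3Mat hcov hx (fr.e i x)
  refine ⟨r₁ - r₂ - r₃ + crossProduct r₄ r₅, ?_⟩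
  have h : so3Lin (r₁ - r₂ - r₃ + crossProduct r₄ r₅) = so3Lin r₁ - so3Lin r₂ - so3Lin r₃
      + so3Lin (crossProduct r₄ r₅) := by simp only [map_add, map_sub]
  have h6 := so3Mat_lie r₄ r₅
  refine Eq.trans ?_ h.symm
  change _ = so3Mat r₁ - so3Mat r₂ - so3Mat r₃ + so3Mat (crossProduct r₄ r₅)
  rw [← neg_eq_iff_eq_neg.mpr h6]
  ext k l
  simp only [Matrix.add_apply, Matrix.sub_apply, Matrix.neg_apply, Matrix.mul_apply,
    ← fun k l ↦ congrFun (congrFun h₁ k) l, ← fun k l ↦ congrFun (congrFun h₂ k) l,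
    ← fun k l ↦ congrFun (congrFun h₃ k) l, ← fun k l ↦ congrFun (congrFun h₄ k) l,
    ← fun k l ↦ congrFun (congrFun h₅ k) l, AdaptedFrame.curv, Finset.sum_sub_distrib]
  ring

end Curvature

section Curvature
variable {M : Type*} [TopologicalSpace M] [ChartedSpace E5 M] [IsManifold (𝓡 5) ∞ M]
  {S : IrreducibleSO3Structure M} {cov : Connection M} {x₀ : M} (fr : AdaptedFrame S x₀)

/-- The curvature forms on two vectors with coefficients `x` and `y`, in terms of the values `∑ xⱼ G
j`, `∑ yᵢ G i` of the connection forms on them. -/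
theorem sum_curvature_form (x y : Fin 5 → ℝ) (d G H : Fin 5 → Fin 5 → ℝ) :
    ∑ j, ∑ i, x j * y i * (d j i - ∑ m, (G j m * H i m - G i m * H j m)) =
      ∑ j, ∑ i, x j * y i * d j i - ∑ m, ((∑ j, x j * G j m) * (∑ i, y i * H i m)
        - (∑ i, y i * G i m) * (∑ j, x j * H j m)) := by
  have h1 : ∀ m, (∑ j, x j * G j m) * (∑ i, y i * H i m)
      - (∑ i, y i * G i m) * (∑ j, x j * H j m) =
      ∑ j, ∑ i, x j * y i * (G j m * H i m - G i m * H j m) := by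
    intro m
    rw [mul_comm (∑ i, y i * G i m), Finset.sum_mul_sum, Finset.sum_mul_sum,
      ← Finset.sum_sub_distrib]
    refine Finset.sum_congr rfl fun j _ ↦ ?_
    rw [← Finset.sum_sub_distrib]
    exact Finset.sum_congr rfl fun i _ ↦ by ring
  have h2 : ∑ m, ((∑ j, x j * G j m) * (∑ i, y i * H i m)
      - (∑ i, y i * G i m) * (∑ j, x j * H j m)) =
      ∑ j, ∑ i, x j * y i * ∑ m, (G j m * H i m - G i m * H j m) := by
    simp only [h1]
    rw [Finset.sum_comm]
    refine Finset.sum_congr rfl fun j _ ↦ ?_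
    rw [Finset.sum_comm]
    exact Finset.sum_congr rfl fun i _ ↦ (Finset.mul_sum _ _ _).symm
  rw [h2]
  rw [← Finset.sum_sub_distrib]
  refine Finset.sum_congr rfl fun j _ ↦ ?_
  rw [← Finset.sum_sub_distrib]
  exact Finset.sum_congr rfl fun i _ ↦ mul_sub _ _ _

/-- The cancellation of the derivatives of the coefficients `z` of `Z` in
`∇_Y ∇_X Z - ∇_X ∇_Y Z + ∇_[X,Y] Z`. Here `P` and `Q` are the connection forms on `X` and `Y`. -/
theorem curvature_components (z Xz Yz DX DY B : Fin 5 → ℝ) (XY YX : ℝ)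
    (P Q : Fin 5 → Fin 5 → ℝ) (l : Fin 5) :
    YX + ∑ k, (Yz k * P k l + z k * DX k) + ∑ m, (Xz m + ∑ k, z k * P k m) * Q m l
      - (XY + ∑ k, (Xz k * Q k l + z k * DY k) + ∑ m, (Yz m + ∑ k, z k * Q k m) * P m l)
      + (XY - YX + ∑ k, z k * B k) =
      -∑ k, z k * (DY k - DX k - B k - ∑ m, (P k m * Q m l - Q k m * P m l)) := by
  have hA : ∀ (a b : Fin 5 → ℝ) (P Q : Fin 5 → Fin 5 → ℝ),
      ∑ m, (a m + ∑ k, b k * P k m) * Q m l =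
        ∑ m, a m * Q m l + ∑ k, b k * ∑ m, P k m * Q m l := by
    intro a b P Q
    simp only [add_mul, Finset.sum_add_distrib, Finset.sum_mul, Finset.mul_sum, mul_assoc]
    rw [Finset.sum_comm (f := fun m k ↦ b k * (P k m * Q m l))]
  rw [hA, hA]
  simp only [Finset.sum_add_distrib, Finset.sum_sub_distrib, mul_sub]
  ring

theorem AdaptedFrame.inner_cov (hcov : S.IsSO3Connection cov) {x : M} (hx : x ∈ fr.U)
    {Z : (x : M) → TangentSpace (𝓡 5) x} (hZ : DiffAt Z x) (v : TangentSpace (𝓡 5) x) (l : Fin 5) :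
    S.g.inner x (cov Z x v) (fr.e l x) =
      mvfderiv (𝓡 5) (fun y ↦ S.g.inner y (Z y) (fr.e l y)) x v
        + ∑ k, S.g.inner x (Z x) (fr.e k x) * fr.conn cov k l x v := by
  have h1 := hcov.metric x Z (fr.e l) hZ (fr.diffAt l x) v
  rw [h1, fr.cov_eq hx l v, inner_sum_right]
  simp only [fun k ↦ fr.conn_skew hcov hx k l v]
  have h2 : ∑ k, -fr.conn cov k l x v * S.g.inner x (Z x) (fr.e k x) =
      -∑ k, S.g.inner x (Z x) (fr.e k x) * fr.conn cov k l x v := by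
    rw [← Finset.sum_neg_distrib]
    exact Finset.sum_congr rfl fun k _ ↦ by ring
  linarith

theorem AdaptedFrame.contMDiffAt_coeff {X : (x : M) → TangentSpace (𝓡 5) x} {x : M}
    (hX : ContMDiffAt (𝓡 5) ((𝓡 5).prod 𝓘(ℝ, E5)) ∞
      (fun x ↦ (⟨x, X x⟩ : TotalSpace E5 (fun x : M ↦ TangentSpace (𝓡 5) x))) x) (i : Fin 5) :
    ContMDiffAt (𝓡 5) 𝓘(ℝ, ℝ) ∞ (fun y ↦ S.g.inner y (X y) (fr.e i y)) x :=
  contMDiffAt_inner (b := id) hX (fr.smooth i x)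

/-- The component `g(R(X, Y)Z, e_l)` of the curvature tensor, for fields that are smooth at `x`. -/
theorem AdaptedFrame.inner_curvature_aux
    [CovariantDerivative.ContMDiffCovariantDerivative cov ∞]
    (hcov : S.IsSO3Connection cov) {x : M} (hx : x ∈ fr.U)
    {X Y Z : (x : M) → TangentSpace (𝓡 5) x}
    (hX : ContMDiffAt (𝓡 5) ((𝓡 5).prod 𝓘(ℝ, E5)) ∞
      (fun x ↦ (⟨x, X x⟩ : TotalSpace E5 (fun x : M ↦ TangentSpace (𝓡 5) x))) x)
    (hY : ContMDiffAt (𝓡 5) ((𝓡 5).prod 𝓘(ℝ, E5)) ∞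
      (fun x ↦ (⟨x, Y x⟩ : TotalSpace E5 (fun x : M ↦ TangentSpace (𝓡 5) x))) x)
    (hZ : ContMDiffAt (𝓡 5) ((𝓡 5).prod 𝓘(ℝ, E5)) ∞
      (fun x ↦ (⟨x, Z x⟩ : TotalSpace E5 (fun x : M ↦ TangentSpace (𝓡 5) x))) x) (l : Fin 5) :
    S.g.inner x (cov (fun y ↦ cov Z y (X y)) x (Y x) - cov (fun y ↦ cov Z y (Y y)) x (X x)
      + cov Z x (VectorField.mlieBracket (𝓡 5) X Y x)) (fr.e l x) =
      -∑ k, S.g.inner x (Z x) (fr.e k x) * ∑ j, ∑ i, S.g.inner x (X x) (fr.e j x)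
        * S.g.inner x (Y x) (fr.e i x) * fr.curv cov x j i k l := by
  have : IsManifold (𝓡 5) 1 M := IsManifold.of_le (n := ∞) (by simp)
  let z : Fin 5 → M → ℝ := fun k y ↦ S.g.inner y (Z y) (fr.e k y)
  have hz : ∀ k, ContMDiffAt (𝓡 5) 𝓘(ℝ, ℝ) ∞ (z k) x := fr.contMDiffAt_coeff hZ
  have hZd : ∀ᶠ y in 𝓝 x, DiffAt Z y := by
    have h1 := (contMDiffAt_iff_contMDiffAt_nhds (n := 1) (by simp)).mp (hZ.of_le (by simp))
    filter_upwards [h1] with y hy using hy.mdifferentiableAt (by simp)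
  have hfr : ∀ (V : (x : M) → TangentSpace (𝓡 5) x),
      ∀ᶠ y in 𝓝 x, V y = ∑ i, S.g.inner y (V y) (fr.e i y) • fr.e i y := fun V ↦ by
    filter_upwards [fr.eventually_mem hx] with y hy using (fr.isON hy).expand (V y)
  -- the connection forms, evaluated on a smooth field, are smooth
  have hconn : ∀ {V : (x : M) → TangentSpace (𝓡 5) x}, ContMDiffAt (𝓡 5) ((𝓡 5).prod 𝓘(ℝ, E5)) ∞
      (fun x ↦ (⟨x, V x⟩ : TotalSpace E5 (fun x : M ↦ TangentSpace (𝓡 5) x))) x → ∀ k l,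
      ContMDiffAt (𝓡 5) 𝓘(ℝ, ℝ) ∞ (fun y ↦ fr.conn cov k l y (V y)) x := fun hV k l ↦
    contMDiffAt_inner (b := id) (fr.smooth l x) (contMDiffAt_cov (fr.smooth k) hV)
  -- the components of `∇_V Z`
  have hs : ∀ V : (x : M) → TangentSpace (𝓡 5) x, ∀ l,
      (fun y ↦ S.g.inner y (cov Z y (V y)) (fr.e l y)) =ᶠ[𝓝 x]
      fun y ↦ mvfderiv (𝓡 5) (z l) y (V y) + ∑ k, z k y * fr.conn cov k l y (V y) := by
    intro V l
    filter_upwards [fr.eventually_mem hx, hZd] with y hy hy'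
      using fr.inner_cov hcov hy hy' (V y) l
  have hs1 : ∀ {V : (x : M) → TangentSpace (𝓡 5) x}, ContMDiffAt (𝓡 5) ((𝓡 5).prod 𝓘(ℝ, E5)) ∞
      (fun x ↦ (⟨x, V x⟩ : TotalSpace E5 (fun x : M ↦ TangentSpace (𝓡 5) x))) x → ∀ l,
      ContMDiffAt (𝓡 5) 𝓘(ℝ, ℝ) ∞ (fun y ↦ ∑ k, z k y * fr.conn cov k l y (V y)) x :=
    fun hV l ↦ ContMDiffAt.sum fun k _ ↦ (hz k).mul (hconn hV k l)
  have hsm : ∀ {V : (x : M) → TangentSpace (𝓡 5) x}, ContMDiffAt (𝓡 5) ((𝓡 5).prod 𝓘(ℝ, E5)) ∞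
      (fun x ↦ (⟨x, V x⟩ : TotalSpace E5 (fun x : M ↦ TangentSpace (𝓡 5) x))) x →
      DiffAt (fun y ↦ cov Z y (V y)) x := by
    intro V hV
    have h1 : ∀ l, ContMDiffAt (𝓡 5) 𝓘(ℝ, ℝ) ∞
        (fun y ↦ S.g.inner y (cov Z y (V y)) (fr.e l y)) x := fun l ↦
      (((hz l).mvfderiv_vectorField hV).add (hs1 hV l)).congr_of_eventuallyEq (hs V l)
    have h2 : ContMDiffAt (𝓡 5) ((𝓡 5).prod 𝓘(ℝ, E5)) ∞
        (fun y ↦ (⟨y, ∑ l, S.g.inner y (cov Z y (V y)) (fr.e l y) • fr.e l y⟩ :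
          TotalSpace E5 (fun x : M ↦ TangentSpace (𝓡 5) x))) x :=
      ContMDiffAt.sum_section fun l _ ↦ (h1 l).smul_section (fr.smooth l x)
    refine (h2.congr_of_eventuallyEq ?_).mdifferentiableAt (by simp)
    filter_upwards [hfr fun y ↦ cov Z y (V y)] with y hy
    rw [← hy]
  have hmain : ∀ {V : (x : M) → TangentSpace (𝓡 5) x}, ContMDiffAt (𝓡 5) ((𝓡 5).prod 𝓘(ℝ, E5)) ∞
      (fun x ↦ (⟨x, V x⟩ : TotalSpace E5 (fun x : M ↦ TangentSpace (𝓡 5) x))) x → ∀ w,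
      S.g.inner x (cov (fun y ↦ cov Z y (V y)) x w) (fr.e l x) =
      mvfderiv (𝓡 5) (fun y ↦ mvfderiv (𝓡 5) (z l) y (V y)) x w
        + ∑ k, (mvfderiv (𝓡 5) (z k) x w * fr.conn cov k l x (V x)
          + z k x * mvfderiv (𝓡 5) (fun y ↦ fr.conn cov k l y (V y)) x w)
        + ∑ m, (mvfderiv (𝓡 5) (z m) x (V x) + ∑ k, z k x * fr.conn cov k m x (V x))
          * fr.conn cov m l x w := by
    intro V hV w
    rw [fr.inner_cov hcov hx (hsm hV) w l, mvfderiv_congr (hs V l) w, mvfderiv_fun_add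
      (((hz l).mvfderiv_vectorField hV).mdifferentiableAt (by simp))
      ((hs1 hV l).mdifferentiableAt (by simp)), add_apply,
      mvfderiv_sum_mul _ hz (fun k ↦ hconn hV k l)]
    simp only [fun m ↦ (hs V m).self_of_nhds]
  have hbr := mvfderiv_mlieBracket (hz l) hX hY (by rw [(𝓡 5).range_eq_univ]; simp)
  have hid : ∀ (y : M) (v : TangentSpace (𝓡 5) y), mfderiv (𝓡 5) (𝓡 5) (fun y : M ↦ y) y v = v :=
    fun y v ↦ congrArg (fun L : TangentSpace (𝓡 5) y →L[ℝ] TangentSpace (𝓡 5) y ↦ L v) mfderiv_id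
  have hd := fun k ↦ pullback_extDeriv_frame (I := 𝓡 5) (J := 𝓡 5) (q := fun y ↦ y) (n := x)
    (by rw [(𝓡 5).range_eq_univ]; simp) contMDiffAt_id hX hY (e := fr.e) (fun i ↦ fr.smooth i x)
    (fr.contMDiffAt_coeff hX) (fr.contMDiffAt_coeff hY)
    ((hfr X).mono fun y hy ↦ (hid y _).trans hy) ((hfr Y).mono fun y hy ↦ (hid y _).trans hy)
    (α := fr.conn cov k l) (fun i ↦ fr.contMDiffAt_conn i k l x)
  simp only [hid] at hd
  have hlin : ∀ k l, ∀ V : (x : M) → TangentSpace (𝓡 5) x, fr.conn cov k l x (V x) =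
      ∑ j, S.g.inner x (V x) (fr.e j x) * fr.conn cov k l x (fr.e j x) := by
    intro k l V
    conv_lhs => rw [(hfr V).self_of_nhds]
    simp only [map_sum, map_smul, smul_eq_mul]
  have hcurv : ∀ k, ∑ j, ∑ i, S.g.inner x (X x) (fr.e j x) * S.g.inner x (Y x) (fr.e i x)
      * fr.curv cov x j i k l =
      mvfderiv (𝓡 5) (fun y ↦ fr.conn cov k l y (Y y)) x (X x)
        - mvfderiv (𝓡 5) (fun y ↦ fr.conn cov k l y (X y)) x (Y x)
        - fr.conn cov k l x (VectorField.mlieBracket (𝓡 5) X Y x)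
        - ∑ m, (fr.conn cov k m x (X x) * fr.conn cov m l x (Y x)
          - fr.conn cov k m x (Y x) * fr.conn cov m l x (X x)) := by
    intro k
    rw [hd k]
    simp only [AdaptedFrame.curv]
    rw [sum_curvature_form (fun j ↦ S.g.inner x (X x) (fr.e j x))
      (fun i ↦ S.g.inner x (Y x) (fr.e i x)) _ (fun j m ↦ fr.conn cov k m x (fr.e j x))
      (fun i m ↦ fr.conn cov m l x (fr.e i x))]
    simp only [← hlin]
  have hz2 : ∀ k, S.g.inner x (Z x) (fr.e k x) = z k x := fun _ ↦ rfl
  simp only [map_add, map_sub, add_apply, sub_apply]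
  rw [hmain hX, hmain hY, fr.inner_cov hcov hx hZd.self_of_nhds, hbr]
  simp only [hcurv, hz2]
  exact curvature_components (fun k ↦ z k x) (fun k ↦ mvfderiv (𝓡 5) (z k) x (X x))
    (fun k ↦ mvfderiv (𝓡 5) (z k) x (Y x)) _ _ _ _ _ (fun k l ↦ fr.conn cov k l x (X x))
    (fun k l ↦ fr.conn cov k l x (Y x)) l

/-- The components of the curvature tensor: it is minus the curvature forms, because of the sign
convention for `R`. -/
theorem AdaptedFrame.inner_curvature [CovariantDerivative.ContMDiffCovariantDerivative cov ∞]
    (hcov : S.IsSO3Connection cov) {x : M} (hx : x ∈ fr.U) (X Y Z : TangentSpace (𝓡 5) x)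
    (l : Fin 5) :
    S.g.inner x (curvature cov x X Y Z) (fr.e l x) =
      -∑ k, S.g.inner x Z (fr.e k x) * ∑ j, ∑ i, S.g.inner x X (fr.e j x)
        * S.g.inner x Y (fr.e i x) * fr.curv cov x j i k l := by
  have h := fr.inner_curvature_aux hcov hx
    (FiberBundle.contMDiffAt_extend (𝓡 5) E5 (V := fun p : M ↦ TangentSpace (𝓡 5) p) X)
    (FiberBundle.contMDiffAt_extend (𝓡 5) E5 (V := fun p : M ↦ TangentSpace (𝓡 5) p) Y)
    (FiberBundle.contMDiffAt_extend (𝓡 5) E5 (V := fun p : M ↦ TangentSpace (𝓡 5) p) Z) l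
  simp only [FiberBundle.extend_apply_self] at h
  exact h

end Curvature

/-! ### Scalar coordinates on `End(TM)` over an adapted frame -/

section FrameCoordinates
variable {M : Type*} [TopologicalSpace M] [ChartedSpace E5 M] [IsManifold (𝓡 5) ∞ M]
  {S : IrreducibleSO3Structure M} {cov : Connection M} {x₀ : M} (fr : AdaptedFrame S x₀)

/-- The matrix of `τ ∈ End(TM)` in the frame. -/
def AdaptedFrame.fmat (τ : EndTM M) : Matrix (Fin 5) (Fin 5) ℝ :=
  mat S (fun i ↦ fr.e i τ.1) τ.2

/-- The coefficients in the frame of the projection of a tangent vector to `M`. -/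
def AdaptedFrame.hcoeff (i : Fin 5) (τ : EndTM M) (A : TangentSpace IEnd τ) : ℝ :=
  S.g.inner τ.1 (dproj τ A) (fr.e i τ.1)

variable (cov) in
/-- The matrix in the frame of the vertical component of a tangent vector. -/
def AdaptedFrame.vmat (τ : EndTM M) (A : TangentSpace IEnd τ) : Matrix (Fin 5) (Fin 5) ℝ :=
  mat S (fun i ↦ fr.e i τ.1) (connMap cov τ A)

variable (cov) in
/-- The connection forms, evaluated on the projection of a tangent vector. -/
def AdaptedFrame.cmat (τ : EndTM M) (A : TangentSpace IEnd τ) : Matrix (Fin 5) (Fin 5) ℝ :=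
  fun k l ↦ fr.conn cov k l τ.1 (dproj τ A)

theorem AdaptedFrame.contMDiffAt_comp_base (i : Fin 5) (τ : EndTM M) :
    ContMDiffAt IEnd ((𝓡 5).prod 𝓘(ℝ, E5)) ∞
      (fun τ : EndTM M ↦ (⟨τ.1, fr.e i τ.1⟩ : TotalSpace E5 (fun x : M ↦ TangentSpace (𝓡 5) x)))
      τ :=
  ContMDiffAt.comp τ (fr.smooth i τ.1) contMDiff_base.contMDiffAt

theorem AdaptedFrame.contMDiffAt_fmat (i j : Fin 5) (τ : EndTM M) :
    ContMDiffAt IEnd 𝓘(ℝ, ℝ) ∞ (fun τ ↦ fr.fmat τ i j) τ := by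
  refine contMDiffAt_inner (b := fun τ : EndTM M ↦ τ.1) (X := fun τ ↦ τ.2 (fr.e i τ.1)) ?_
    (fr.contMDiffAt_comp_base j τ)
  exact ContMDiffAt.clm_bundle_apply (F₁ := E5) (F₂ := E5) (b := fun τ : EndTM M ↦ τ.1)
    (ϕ := fun τ ↦ τ.2) contMDiffAt_id (fr.contMDiffAt_comp_base i τ)

/-- The derivative of the matrix coordinates: the vertical component, and an infinitesimal
rotation by the connection forms. -/
theorem AdaptedFrame.mvfderiv_fmat (hcov : S.IsSO3Connection cov) {τ : EndTM M} (hτ : τ.1 ∈ fr.U)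
    (A : TangentSpace IEnd τ) (i j : Fin 5) :
    mvfderiv IEnd (fun τ ↦ fr.fmat τ i j) τ A =
      (fr.vmat cov τ A + (fr.cmat cov τ A * fr.fmat τ - fr.fmat τ * fr.cmat cov τ A)) i j := by
  have hd : MDifferentiableAt IEnd 𝓘(ℝ, ℝ) (fun τ ↦ fr.fmat τ i j) τ :=
    (fr.contMDiffAt_fmat i j τ).mdifferentiableAt (by simp)
  have hs := endDiffAt_extSection τ
  have hself := extSection_self τ
  have h1 : mvfderiv IEnd (fun τ ↦ fr.fmat τ i j) τ
      (sectionLift τ (extSection τ) (dproj τ A)) =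
      S.g.inner τ.1 (endCov cov hs (dproj τ A) (fr.e i τ.1)) (fr.e j τ.1)
        + (fr.cmat cov τ A * fr.fmat τ - fr.fmat τ * fr.cmat cov τ A) i j := by
    rw [mvfderiv_sectionLift hself hs hd]
    have hsY : DiffAt (fun x ↦ extSection τ x (fr.e i x)) τ.1 :=
      MDifferentiableAt.clm_bundle_apply hs (fr.diffAt i τ.1)
    refine (hcov.metric τ.1 _ (fr.e j) hsY (fr.diffAt j τ.1) (dproj τ A)).trans ?_
    have h2 := endCov_apply cov hs (dproj τ A) (fr.diffAt i τ.1)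
    rw [eq_sub_iff_add_eq] at h2
    rw [← h2, fr.cov_eq hτ i, fr.cov_eq hτ j, hself, map_add, add_apply, map_sum,
      inner_sum_right]
    simp only [map_smul, inner_sum_left, Matrix.sub_apply, Matrix.mul_apply, add_assoc]
    congr 1
    rw [sub_eq_add_neg, ← Finset.sum_neg_distrib]
    congr 1
    refine Finset.sum_congr rfl fun k _ ↦ ?_
    rw [fr.conn_skew hcov hτ k j, AdaptedFrame.fmat, AdaptedFrame.cmat, mat]
    ring
  have h3 : ∀ w, mvfderiv IEnd (fun τ ↦ fr.fmat τ i j) τ (vlift τ w) =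
      S.g.inner τ.1 (w (fr.e i τ.1)) (fr.e j τ.1) := by
    intro w
    rw [mvfderiv_vlift τ w hd]
    have h4 : (fun r : ℝ ↦ fr.fmat ⟨τ.1, τ.2 + r • w⟩ i j) = fun r ↦
        S.g.inner τ.1 (τ.2 (fr.e i τ.1)) (fr.e j τ.1)
          + r * S.g.inner τ.1 (w (fr.e i τ.1)) (fr.e j τ.1) := by
      funext r
      simp only [AdaptedFrame.fmat, mat_add, mat_smul, Matrix.add_apply, Matrix.smul_apply]
      rfl
    rw [h4]
    simp
  have h5 := congrArg (mvfderiv IEnd (fun τ ↦ fr.fmat τ i j) τ) (tangent_decomp cov τ A)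
  rw [h5, ContinuousLinearMap.map_add (mvfderiv IEnd (fun τ ↦ fr.fmat τ i j) τ), h1, h3,
    sub_apply, map_sub, sub_apply, Matrix.add_apply]
  change _ = S.g.inner τ.1 (connMap cov τ A (fr.e i τ.1)) (fr.e j τ.1) + _
  ring

theorem contMDiffAt_dproj {A : (σ : EndTM M) → TangentSpace IEnd σ} {τ : EndTM M}
    (hA : ContMDiffAt IEnd (IEnd.prod 𝓘(ℝ, E5 × (E5 →L[ℝ] E5))) ∞
      (fun σ ↦ (⟨σ, A σ⟩ : TangentBundle IEnd (EndTM M))) τ) :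
    ContMDiffAt IEnd ((𝓡 5).prod 𝓘(ℝ, E5)) ∞
      (fun σ : EndTM M ↦ (⟨σ.1, dproj σ (A σ)⟩ :
        TotalSpace E5 (fun x : M ↦ TangentSpace (𝓡 5) x))) τ := by
  have h := (contMDiff_base (M := M)).contMDiff_tangentMap (m := ∞) (by simp)
  exact ContMDiffAt.comp τ h.contMDiffAt hA

theorem AdaptedFrame.contMDiffAt_hcoeff {A : (σ : EndTM M) → TangentSpace IEnd σ} {τ : EndTM M}
    (hA : ContMDiffAt IEnd (IEnd.prod 𝓘(ℝ, E5 × (E5 →L[ℝ] E5))) ∞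
      (fun σ ↦ (⟨σ, A σ⟩ : TangentBundle IEnd (EndTM M))) τ) (i : Fin 5) :
    ContMDiffAt IEnd 𝓘(ℝ, ℝ) ∞ (fun σ ↦ fr.hcoeff i σ (A σ)) τ :=
  contMDiffAt_inner (contMDiffAt_dproj hA) (fr.contMDiffAt_comp_base i τ)

theorem AdaptedFrame.dproj_eq {τ : EndTM M} (hτ : τ.1 ∈ fr.U) (A : TangentSpace IEnd τ) :
    dproj τ A = ∑ i, fr.hcoeff i τ A • fr.e i τ.1 := (fr.isON hτ).expand _

theorem AdaptedFrame.cmat_eq {τ : EndTM M} (hτ : τ.1 ∈ fr.U) (A : TangentSpace IEnd τ)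
    (k l : Fin 5) :
    fr.cmat cov τ A k l = ∑ i, fr.hcoeff i τ A * fr.conn cov k l τ.1 (fr.e i τ.1) := by
  rw [AdaptedFrame.cmat, fr.dproj_eq hτ, map_sum]
  exact Finset.sum_congr rfl fun i _ ↦ map_smul _ _ _

theorem AdaptedFrame.eventually_base_mem {τ : EndTM M} (hτ : τ.1 ∈ fr.U) :
    ∀ᶠ σ in 𝓝 τ, σ.1 ∈ fr.U :=
  (contMDiff_base.continuous.isOpen_preimage _ fr.isOpen).mem_nhds hτ

theorem AdaptedFrame.contMDiffAt_cmat [CovariantDerivative.ContMDiffCovariantDerivative cov ∞]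
    {A : (σ : EndTM M) → TangentSpace IEnd σ} {τ : EndTM M} (hτ : τ.1 ∈ fr.U)
    (hA : ContMDiffAt IEnd (IEnd.prod 𝓘(ℝ, E5 × (E5 →L[ℝ] E5))) ∞
      (fun σ ↦ (⟨σ, A σ⟩ : TangentBundle IEnd (EndTM M))) τ) (k l : Fin 5) :
    ContMDiffAt IEnd 𝓘(ℝ, ℝ) ∞ (fun σ ↦ fr.cmat cov σ (A σ) k l) τ := by
  have h1 : ContMDiffAt IEnd 𝓘(ℝ, ℝ) ∞
      (fun σ ↦ ∑ i, fr.hcoeff i σ (A σ) * fr.conn cov k l σ.1 (fr.e i σ.1)) τ :=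
    ContMDiffAt.sum fun i _ ↦ (fr.contMDiffAt_hcoeff hA i).mul
      (ContMDiffAt.comp τ (fr.contMDiffAt_conn i k l τ.1) contMDiff_base.contMDiffAt)
  refine h1.congr_of_eventuallyEq ?_
  filter_upwards [fr.eventually_base_mem hτ] with σ hσ using fr.cmat_eq hσ _ k l

theorem AdaptedFrame.contMDiffAt_vmat [CovariantDerivative.ContMDiffCovariantDerivative cov ∞]
    (hcov : S.IsSO3Connection cov)
    {A : (σ : EndTM M) → TangentSpace IEnd σ} {τ : EndTM M} (hτ : τ.1 ∈ fr.U)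
    (hA : ContMDiffAt IEnd (IEnd.prod 𝓘(ℝ, E5 × (E5 →L[ℝ] E5))) ∞
      (fun σ ↦ (⟨σ, A σ⟩ : TangentBundle IEnd (EndTM M))) τ) (i j : Fin 5) :
    ContMDiffAt IEnd 𝓘(ℝ, ℝ) ∞ (fun σ ↦ fr.vmat cov σ (A σ) i j) τ := by
  have h1 : ContMDiffAt IEnd 𝓘(ℝ, ℝ) ∞ (fun σ ↦
      mvfderiv IEnd (fun τ ↦ fr.fmat τ i j) σ (A σ)
        - (∑ k, fr.cmat cov σ (A σ) i k * fr.fmat σ k j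
          - ∑ k, fr.fmat σ i k * fr.cmat cov σ (A σ) k j)) τ :=
    ((fr.contMDiffAt_fmat i j τ).mvfderiv_vectorField hA).sub
      ((ContMDiffAt.sum fun k _ ↦ (fr.contMDiffAt_cmat hτ hA i k).mul
        (fr.contMDiffAt_fmat k j τ)).sub
        (ContMDiffAt.sum fun k _ ↦ (fr.contMDiffAt_fmat i k τ).mul (fr.contMDiffAt_cmat hτ hA k j)))
  refine h1.congr_of_eventuallyEq ?_
  filter_upwards [fr.eventually_base_mem hτ] with σ hσ
  rw [fr.mvfderiv_fmat hcov hσ, Matrix.add_apply, Matrix.sub_apply, Matrix.mul_apply,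
    Matrix.mul_apply, add_sub_cancel_right]

end FrameCoordinates

/-! ### Smoothness of fields given by their coefficients in a frame -/

section SmoothFields
variable {M : Type*} [TopologicalSpace M] [ChartedSpace E5 M] [IsManifold (𝓡 5) ∞ M]
  {S : IrreducibleSO3Structure M} {cov : Connection M} {x₀ : M} (fr : AdaptedFrame S x₀)

theorem _root_.ContMDiffAt.smulRight {E H N F G : Type*} [NormedAddCommGroup E] [NormedSpace ℝ E]
    [TopologicalSpace H] {I : ModelWithCorners ℝ E H} [TopologicalSpace N] [ChartedSpace H N]
    [NormedAddCommGroup F] [NormedSpace ℝ F] [NormedAddCommGroup G] [NormedSpace ℝ G]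
    {c : N → F →L[ℝ] ℝ} {v : N → G} {x : N} (hc : ContMDiffAt I 𝓘(ℝ, F →L[ℝ] ℝ) ∞ c x)
    (hv : ContMDiffAt I 𝓘(ℝ, G) ∞ v x) :
    ContMDiffAt I 𝓘(ℝ, F →L[ℝ] G) ∞ (fun y ↦ (c y).smulRight (v y)) x :=
  ContMDiffAt.comp x (g := fun q : (F →L[ℝ] ℝ) × G ↦ q.1.smulRight q.2)
    (contDiff_fst.smulRight contDiff_snd).contMDiff.contMDiffAt (hc.prodMk_space hv)

/-- The section `g(X, ·) Y` of `End(TM)` is smooth if `X` and `Y` are. -/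
theorem contMDiffAt_rankOne {X Y : (x : M) → TangentSpace (𝓡 5) x} {x : M}
    (hX : ContMDiffAt (𝓡 5) ((𝓡 5).prod 𝓘(ℝ, E5)) ∞
      (fun y ↦ (⟨y, X y⟩ : TotalSpace E5 (fun x : M ↦ TangentSpace (𝓡 5) x))) x)
    (hY : ContMDiffAt (𝓡 5) ((𝓡 5).prod 𝓘(ℝ, E5)) ∞
      (fun y ↦ (⟨y, Y y⟩ : TotalSpace E5 (fun x : M ↦ TangentSpace (𝓡 5) x))) x) :
    ContMDiffAt (𝓡 5) IEnd ∞
      (fun y ↦ (⟨y, (S.g.inner y (X y)).smulRight (Y y)⟩ : EndTM M)) x := by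
  have h1 : ContMDiffAt (𝓡 5) ((𝓡 5).prod 𝓘(ℝ, E5 →L[ℝ] ℝ)) ∞
      (fun y ↦ TotalSpace.mk' (E5 →L[ℝ] ℝ)
        (E := fun x : M ↦ TangentSpace (𝓡 5) x →L[ℝ] Bundle.Trivial M ℝ x) y
        (S.g.inner y (X y))) x :=
    ContMDiffAt.clm_bundle_apply (F₁ := E5) (F₂ := E5 →L[ℝ] ℝ) (b := fun y : M ↦ y)
      (E₂ := fun x : M ↦ TangentSpace (𝓡 5) x →L[ℝ] Bundle.Trivial M ℝ x)
      S.g.contMDiff.contMDiffAt hX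
  rw [contMDiffAt_hom_bundle] at h1 ⊢
  refine ⟨contMDiffAt_id, ?_⟩
  rw [contMDiffAt_section] at hY
  refine (h1.2.smulRight hY).congr_of_eventuallyEq ?_
  filter_upwards [(chartAt E5 x).open_source.mem_nhds (mem_chart_source E5 x)] with y hy
  ext1 v
  simp only [ContinuousLinearMap.inCoordinates, ContinuousLinearMap.comp_apply,
    ContinuousLinearMap.smulRight_apply, map_smul]
  rw [Trivialization.continuousLinearMapAt_apply_of_mem ℝ
    (trivializationAt E5 (fun x : M ↦ TangentSpace (𝓡 5) x) x) (by simpa using hy),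
    Trivialization.continuousLinearMapAt_apply_of_mem ℝ
    (trivializationAt ℝ (Bundle.Trivial M ℝ) x) (Set.mem_univ y)]
  rfl

theorem ofMat_eq_sum {p : M} (a : Fin 5 → TangentSpace (𝓡 5) p) (W : Matrix (Fin 5) (Fin 5) ℝ) :
    ofMat S a W =
      ∑ ij : Fin 5 × Fin 5, W ij.1 ij.2 • (S.g.inner p (a ij.1)).smulRight (a ij.2) := by
  rw [ofMat, Fintype.sum_prod_type]

/-- The fibre coordinates of the elementary endomorphisms `g(eᵢ, ·) eⱼ`. -/
def AdaptedFrame.fibFrame (p : M) (ij : Fin 5 × Fin 5) (x : M) : E5 →L[ℝ] E5 :=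
  fibCoord p ⟨x, (S.g.inner x (fr.e ij.1 x)).smulRight (fr.e ij.2 x)⟩

theorem AdaptedFrame.contMDiffAt_fibFrame {p x : M} (h : x ∈ (chartAt E5 p).source)
    (ij : Fin 5 × Fin 5) : ContMDiffAt (𝓡 5) 𝓘(ℝ, E5 →L[ℝ] E5) ∞ (fr.fibFrame p ij) x :=
  ContMDiffAt.comp x (contMDiffAt_fibCoord (by rw [baseSet_eq]; exact h))
    (contMDiffAt_rankOne (fr.smooth _ x) (fr.smooth _ x))

theorem AdaptedFrame.fibCoord_eq_sum (p : M) {τ : EndTM M} (h : τ.1 ∈ (chartAt E5 p).source)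
    (hτ : τ.1 ∈ fr.U) :
    fibCoord p τ = ∑ ij : Fin 5 × Fin 5, fr.fmat τ ij.1 ij.2 • fr.fibFrame p ij τ.1 := by
  have h1 : τ.2 = ofMat S (fun i ↦ fr.e i τ.1) (fr.fmat τ) :=
    (fr.isON hτ).end_ext ((fr.isON hτ).mat_ofMat _).symm
  have h2 : fibCoord p τ = fibCoord p ⟨τ.1, ofMat S (fun i ↦ fr.e i τ.1) (fr.fmat τ)⟩ := by
    rw [← h1]
  rw [h2, fibCoord_eq p h, ofMat_eq_sum, map_sum]
  refine Finset.sum_congr rfl fun ij _ ↦ ?_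
  rw [map_smul, AdaptedFrame.fibFrame, fibCoord_eq p h]

/-- A vector field on `End(TM)` is smooth if the coefficients of its horizontal part and of its
vertical part in a frame are. -/
theorem AdaptedFrame.contMDiffAt_of_coeff [CovariantDerivative.ContMDiffCovariantDerivative cov ∞]
    (hcov : S.IsSO3Connection cov) {σ : EndTM M} (hσ : σ.1 ∈ fr.U)
    {B : (τ : EndTM M) → TangentSpace IEnd τ}
    (h1 : ∀ i, ContMDiffAt IEnd 𝓘(ℝ, ℝ) ∞ (fun τ ↦ fr.hcoeff i τ (B τ)) σ)
    (h2 : ∀ i j, ContMDiffAt IEnd 𝓘(ℝ, ℝ) ∞ (fun τ ↦ fr.vmat cov τ (B τ) i j) σ) :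
    ContMDiffAt IEnd (IEnd.prod 𝓘(ℝ, E5 × (E5 →L[ℝ] E5))) ∞
      (fun τ ↦ (⟨τ, B τ⟩ : TangentBundle IEnd (EndTM M))) σ := by
  rw [contMDiffAt_vectorField_iff]
  have hb : ContMDiffAt IEnd (𝓡 5) ∞ (fun τ : EndTM M ↦ τ.1) σ := contMDiff_base.contMDiffAt
  have hsrc : ∀ᶠ τ : EndTM M in 𝓝 σ, τ.1 ∈ (chartAt E5 σ.1).source :=
    (contMDiff_base.continuous.isOpen_preimage _ (chartAt E5 σ.1).open_source).mem_nhds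
      (mem_chart_source _ _)
  have hA : ContMDiffAt IEnd 𝓘(ℝ, E5) ∞ (fun τ ↦ ∑ i, fr.hcoeff i τ (B τ) •
      mvfderiv (𝓡 5) (extChartAt (𝓡 5) σ.1) τ.1 (fr.e i τ.1)) σ :=
    ContMDiffAt.sum fun i _ ↦ (h1 i).smul
      (ContMDiffAt.comp σ (contMDiffAt_vectorField_iff.1 (fr.smooth i σ.1)) hb)
  have hc : ∀ k l, ContMDiffAt IEnd 𝓘(ℝ, ℝ) ∞ (fun τ ↦ ∑ i, fr.hcoeff i τ (B τ) *
      fr.conn cov k l τ.1 (fr.e i τ.1)) σ := fun k l ↦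
    ContMDiffAt.sum fun i _ ↦ (h1 i).mul
      (ContMDiffAt.comp σ (fr.contMDiffAt_conn i k l σ.1) hb)
  have hF : ∀ k l, ContMDiffAt IEnd 𝓘(ℝ, ℝ) ∞ (fun τ ↦
      fr.vmat cov τ (B τ) k l +
        (∑ m, (∑ i, fr.hcoeff i τ (B τ) * fr.conn cov k m τ.1 (fr.e i τ.1)) * fr.fmat τ m l
        - ∑ m, fr.fmat τ k m * ∑ i, fr.hcoeff i τ (B τ) * fr.conn cov m l τ.1 (fr.e i τ.1))) σ :=
    fun k l ↦ (h2 k l).add ((ContMDiffAt.sum fun m _ ↦ (hc k m).mul (fr.contMDiffAt_fmat m l σ)).sub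
      (ContMDiffAt.sum fun m _ ↦ (fr.contMDiffAt_fmat k m σ).mul (hc m l)))
  have hY : ∀ ij, ContMDiffAt (𝓡 5) 𝓘(ℝ, E5 →L[ℝ] E5) ∞ (fr.fibFrame σ.1 ij) σ.1 :=
    fun ij ↦ fr.contMDiffAt_fibFrame (mem_chart_source _ _) ij
  have hG : ContMDiffAt IEnd 𝓘(ℝ, E5 →L[ℝ] E5) ∞ (fun τ ↦ ∑ ij : Fin 5 × Fin 5,
      ((fr.vmat cov τ (B τ) ij.1 ij.2 +
        (∑ m, (∑ i, fr.hcoeff i τ (B τ) * fr.conn cov ij.1 m τ.1 (fr.e i τ.1)) * fr.fmat τ m ij.2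
        - ∑ m, fr.fmat τ ij.1 m * ∑ i, fr.hcoeff i τ (B τ) * fr.conn cov m ij.2 τ.1 (fr.e i τ.1)))
          • fr.fibFrame σ.1 ij τ.1
        + fr.fmat τ ij.1 ij.2 • ∑ i, fr.hcoeff i τ (B τ) •
          mvfderiv (𝓡 5) (fr.fibFrame σ.1 ij) τ.1 (fr.e i τ.1))) σ :=
    ContMDiffAt.sum fun ij _ ↦ ((hF _ _).smul (ContMDiffAt.comp σ (hY ij) hb)).add
      ((fr.contMDiffAt_fmat _ _ σ).smul (ContMDiffAt.sum fun i _ ↦ (h1 i).smul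
        (ContMDiffAt.comp σ ((hY ij).mvfderiv_vectorField (fr.smooth i σ.1)) hb)))
  refine (hA.prodMk_space hG).congr_of_eventuallyEq ?_
  filter_upwards [hsrc, fr.eventually_base_mem hσ] with τ hτ hτU
  rw [mvfderiv_extChartAt_EndTM σ τ hτ]
  refine Prod.ext ?_ ?_
  · change mvfderiv (𝓡 5) (extChartAt (𝓡 5) σ.1) τ.1 (dproj τ (B τ)) = _
    rw [fr.dproj_eq hτU, map_sum]
    exact Finset.sum_congr rfl fun i _ ↦ ContinuousLinearMap.map_smul
      (mvfderiv (𝓡 5) (extChartAt (𝓡 5) σ.1) τ.1) _ _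
  · have hev : fibCoord σ.1 =ᶠ[𝓝 τ] fun τ ↦
        ∑ ij : Fin 5 × Fin 5, fr.fmat τ ij.1 ij.2 • fr.fibFrame σ.1 ij τ.1 := by
      filter_upwards [(contMDiff_base.continuous.isOpen_preimage _
        (chartAt E5 σ.1).open_source).mem_nhds hτ, fr.eventually_base_mem hτU] with ρ h3 h4
        using fr.fibCoord_eq_sum σ.1 h3 h4
    change mvfderiv IEnd (fibCoord σ.1) τ (B τ) = _
    have hd := mvfderiv_sum_smul (I := IEnd) (x := τ) Finset.univ
      (c := fun (ij : Fin 5 × Fin 5) (τ : EndTM M) ↦ fr.fmat τ ij.1 ij.2)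
      (g := fun ij (τ : EndTM M) ↦ fr.fibFrame σ.1 ij τ.1)
      (fun ij ↦ fr.contMDiffAt_fmat _ _ τ)
      (fun ij ↦ ContMDiffAt.comp τ (f := fun τ : EndTM M ↦ τ.1) (g := fr.fibFrame σ.1 ij)
        (fr.contMDiffAt_fibFrame hτ ij) contMDiff_base.contMDiffAt) (B τ)
    rw [mvfderiv_congr hev, hd]
    dsimp only
    refine (Finset.sum_congr rfl fun ij _ ↦ ?_)
    rw [fr.mvfderiv_fmat hcov hτU, Matrix.add_apply, Matrix.sub_apply, Matrix.mul_apply,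
      Matrix.mul_apply]
    simp only [fr.cmat_eq hτU]
    congr 2
    have h5 := mvfderiv_comp_eq (I := IEnd) (q := fun τ : EndTM M ↦ τ.1) τ
      ((fr.contMDiffAt_fibFrame hτ ij).mdifferentiableAt (by simp))
      (contMDiff_base.contMDiffAt.mdifferentiableAt (by simp)) (B τ)
    refine Eq.trans h5 ?_
    change mvfderiv (𝓡 5) (fr.fibFrame σ.1 ij) τ.1 (dproj τ (B τ)) = _
    rw [fr.dproj_eq hτU, map_sum]
    exact Finset.sum_congr rfl fun i _ ↦ ContinuousLinearMap.map_smul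
      (mvfderiv (𝓡 5) (fr.fibFrame σ.1 ij) τ.1) _ _

end SmoothFields

/-! ### Derivatives of matrix-valued functions -/

section MatrixDerivative
variable {E H N : Type*} [NormedAddCommGroup E] [NormedSpace ℝ E] [TopologicalSpace H]
  {I : ModelWithCorners ℝ E H} [TopologicalSpace N] [ChartedSpace H N]
  {P Q : N → Matrix (Fin 5) (Fin 5) ℝ} {x : N}

/-- A matrix-valued function has smooth entries at `x`. -/
def SmoothEntries (I : ModelWithCorners ℝ E H) (P : N → Matrix (Fin 5) (Fin 5) ℝ) (x : N) : Prop :=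
  ∀ i j, ContMDiffAt I 𝓘(ℝ, ℝ) ∞ (fun y ↦ P y i j) x

/-- The entrywise derivative of a matrix-valued function. -/
def matDeriv (P : N → Matrix (Fin 5) (Fin 5) ℝ) (x : N) (v : TangentSpace I x) :
    Matrix (Fin 5) (Fin 5) ℝ :=
  Matrix.of fun i j ↦ mvfderiv I (fun y ↦ P y i j) x v

theorem SmoothEntries.diff (h : SmoothEntries I P x) (i j : Fin 5) :
    MDifferentiableAt I 𝓘(ℝ, ℝ) (fun y ↦ P y i j) x := (h i j).mdifferentiableAt (by simp)

theorem SmoothEntries.sub (hP : SmoothEntries I P x) (hQ : SmoothEntries I Q x) :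
    SmoothEntries I (fun y ↦ P y - Q y) x := fun i j ↦ (hP i j).sub (hQ i j)

theorem SmoothEntries.mul (hP : SmoothEntries I P x) (hQ : SmoothEntries I Q x) :
    SmoothEntries I (fun y ↦ P y * Q y) x := fun i j ↦ by
  simp only [Matrix.mul_apply]
  exact ContMDiffAt.sum fun k _ ↦ (hP i k).mul (hQ k j)

theorem matDeriv_add (hP : SmoothEntries I P x) (hQ : SmoothEntries I Q x) (v : TangentSpace I x) :
    matDeriv (fun y ↦ P y + Q y) x v = matDeriv P x v + matDeriv Q x v := by
  ext i j
  exact congrArg (fun L : TangentSpace I x →L[ℝ] ℝ ↦ L v)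
    (mvfderiv_fun_add (hP.diff i j) (hQ.diff i j))

theorem matDeriv_sub (hP : SmoothEntries I P x) (hQ : SmoothEntries I Q x) (v : TangentSpace I x) :
    matDeriv (fun y ↦ P y - Q y) x v = matDeriv P x v - matDeriv Q x v := by
  ext i j
  exact congrArg (fun L : TangentSpace I x →L[ℝ] ℝ ↦ L v)
    (mvfderiv_fun_sub (hP.diff i j) (hQ.diff i j))

theorem matDeriv_mul (hP : SmoothEntries I P x) (hQ : SmoothEntries I Q x) (v : TangentSpace I x) :
    matDeriv (fun y ↦ P y * Q y) x v = matDeriv P x v * Q x + P x * matDeriv Q x v := by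
  ext i j
  simp only [matDeriv, Matrix.of_apply, Matrix.mul_apply, Matrix.add_apply,
    ← Finset.sum_add_distrib]
  exact mvfderiv_sum_mul _ (fun k ↦ hP i k) (fun k ↦ hQ k j) v

theorem matDeriv_congr (h : P =ᶠ[𝓝 x] Q) (v : TangentSpace I x) :
    matDeriv P x v = matDeriv Q x v := by
  ext i j
  exact mvfderiv_congr (h.fun_comp fun F : Matrix (Fin 5) (Fin 5) ℝ ↦ F i j) v

theorem mvfderiv_pfaff (hP : SmoothEntries I P x) (i j k l : Fin 5) (v : TangentSpace I x) :
    mvfderiv I (fun y ↦ pfaff (P y) i j k l) x v =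
      pfaff (P x + matDeriv P x v) i j k l - pfaff (P x) i j k l
        - pfaff (matDeriv P x v) i j k l := by
  have hu : ∀ i j, ContMDiffAt I 𝓘(ℝ, ℝ) ∞ (fun y ↦ P y i j - P y j i) x :=
    fun i j ↦ (hP i j).sub (hP j i)
  have hud : ∀ i j, mvfderiv I (fun y ↦ P y i j - P y j i) x v =
      matDeriv P x v i j - matDeriv P x v j i := fun i j ↦
    congrArg (fun L : TangentSpace I x →L[ℝ] ℝ ↦ L v) (mvfderiv_fun_sub (hP.diff i j) (hP.diff j i))
  have hd : ∀ i j, MDifferentiableAt I 𝓘(ℝ, ℝ) (fun y ↦ P y i j - P y j i) x :=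
    fun i j ↦ (hu i j).mdifferentiableAt (by simp)
  have hm : ∀ i j k l, MDifferentiableAt I 𝓘(ℝ, ℝ)
      (fun y ↦ (P y i j - P y j i) * (P y k l - P y l k)) x :=
    fun i j k l ↦ ((hu i j).mul (hu k l)).mdifferentiableAt (by simp)
  simp only [pfaff]
  have hm2 : MDifferentiableAt I 𝓘(ℝ, ℝ) (fun y ↦ (P y i j - P y j i) * (P y k l - P y l k)
      - (P y i k - P y k i) * (P y j l - P y l j)) x := (hm _ _ _ _).sub (hm _ _ _ _)
  rw [mvfderiv_fun_add hm2 (hm _ _ _ _),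
    mvfderiv_fun_sub (hm _ _ _ _) (hm _ _ _ _), mvfderiv_fun_mul (hd _ _) (hd _ _),
    mvfderiv_fun_mul (hd _ _) (hd _ _), mvfderiv_fun_mul (hd _ _) (hd _ _)]
  simp only [add_apply, sub_apply, smul_apply, hud, Matrix.add_apply, smul_eq_mul]
  ring

theorem SmoothEntries.contMDiffAt_pfaff (hP : SmoothEntries I P x) (i j k l : Fin 5) :
    ContMDiffAt I 𝓘(ℝ, ℝ) ∞ (fun y ↦ pfaff (P y) i j k l) x := by
  have hu : ∀ i j, ContMDiffAt I 𝓘(ℝ, ℝ) ∞ (fun y ↦ P y i j - P y j i) x :=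
    fun i j ↦ (hP i j).sub (hP j i)
  exact (((hu _ _).mul (hu _ _)).sub ((hu _ _).mul (hu _ _))).add ((hu _ _).mul (hu _ _))

theorem SmoothEntries.contMDiffAt_quad (hP : SmoothEntries I P x) (k : Fin 5) :
    ContMDiffAt I 𝓘(ℝ, ℝ) ∞ (fun y ↦ quad (P y) k) x := by
  have h1 : ∀ i j k l, ContMDiffAt I 𝓘(ℝ, ℝ) ∞ (fun y ↦ 1 / 8 * pfaff (P y) i j k l) x :=
    fun i j k l ↦ contMDiffAt_const.mul (hP.contMDiffAt_pfaff i j k l)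
  fin_cases k
  exacts [h1 _ _ _ _, (h1 _ _ _ _).neg, h1 _ _ _ _, (h1 _ _ _ _).neg, h1 _ _ _ _]

/-- The derivative of a quadratic map is its polarization. -/
theorem mvfderiv_quad (hP : SmoothEntries I P x) (k : Fin 5) (v : TangentSpace I x) :
    mvfderiv I (fun y ↦ quad (P y) k) x v = quadPolar (P x) (matDeriv P x v) k := by
  have key : ∀ (c : ℝ) (i j k l : Fin 5), mvfderiv I (fun y ↦ c * pfaff (P y) i j k l) x v =
      c * (pfaff (P x + matDeriv P x v) i j k l - pfaff (P x) i j k l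
        - pfaff (matDeriv P x v) i j k l) := by
    intro c i j k l
    rw [← mvfderiv_pfaff hP, mvfderiv_fun_mul mdifferentiableAt_const
      ((hP.contMDiffAt_pfaff i j k l).mdifferentiableAt (by simp))]
    simp [mvfderiv_const]
  fin_cases k
  all_goals
    simp [quad, quadPolar, ← neg_mul, key]
    try ring

theorem quadPolar_neg (F B : Matrix (Fin 5) (Fin 5) ℝ) (k : Fin 5) :
    quadPolar F (-B) k = -quadPolar F B k := by
  have h := quadPolar_add F B (-B) k
  have h0 : quadPolar F 0 k = 0 := by simpa using quadPolar_add F 0 0 k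
  rw [add_neg_cancel, h0] at h
  linarith

end MatrixDerivative

/-! ### The characteristic field, and Lie brackets on `End(TM)` -/

section Brackets
variable {M : Type*} [TopologicalSpace M] [ChartedSpace E5 M] [IsManifold (𝓡 5) ∞ M]
  {S : IrreducibleSO3Structure M} {cov : Connection M} {x₀ : M} (fr : AdaptedFrame S x₀)

/-- A vector field on `End(TM)` is smooth at `σ`. -/
abbrev SmoothFieldAt (A : (τ : EndTM M) → TangentSpace IEnd τ) (σ : EndTM M) : Prop :=
  ContMDiffAt IEnd (IEnd.prod 𝓘(ℝ, E5 × (E5 →L[ℝ] E5))) ∞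
    (fun τ ↦ (⟨τ, A τ⟩ : TangentBundle IEnd (EndTM M))) σ

theorem AdaptedFrame.smoothEntries_fmat (σ : EndTM M) : SmoothEntries IEnd fr.fmat σ :=
  fun i j ↦ fr.contMDiffAt_fmat i j σ

theorem AdaptedFrame.matDeriv_fmat (hcov : S.IsSO3Connection cov) {τ : EndTM M} (hτ : τ.1 ∈ fr.U)
    (A : TangentSpace IEnd τ) :
    matDeriv fr.fmat τ A =
      fr.vmat cov τ A + (fr.cmat cov τ A * fr.fmat τ - fr.fmat τ * fr.cmat cov τ A) := by
  ext i j
  exact fr.mvfderiv_fmat hcov hτ A i j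

theorem AdaptedFrame.hcoeff_hlift (τ : EndTM M) (hτ : τ.1 ∈ fr.U) (a : Fin 5 → ℝ) (k : Fin 5) :
    fr.hcoeff k τ (hlift cov τ (∑ i, a i • fr.e i τ.1)) = a k := by
  rw [AdaptedFrame.hcoeff, dproj_hlift]
  exact (fr.isON hτ).inner_sum a k

theorem AdaptedFrame.vmat_hlift (τ : EndTM M) (X : TangentSpace (𝓡 5) τ.1) :
    fr.vmat cov τ (hlift cov τ X) = 0 := by
  ext i j
  rw [AdaptedFrame.vmat, connMap_hlift, mat, zero_apply, map_zero]
  rfl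

theorem AdaptedFrame.hcoeff_vlift (τ : EndTM M) (w : EndT M τ.1) (k : Fin 5) :
    fr.hcoeff k τ (vlift τ w) = 0 := by
  rw [AdaptedFrame.hcoeff, dproj_vlift, map_zero, zero_apply]

theorem AdaptedFrame.vmat_vlift (τ : EndTM M) (w : EndT M τ.1) :
    fr.vmat cov τ (vlift τ w) = mat S (fun i ↦ fr.e i τ.1) w := by
  rw [AdaptedFrame.vmat, connMap_vlift]

theorem AdaptedFrame.hcoeff_chi {τ : EndTM M} (hτ : τ.1 ∈ fr.U) (k : Fin 5) :
    fr.hcoeff k τ (S.chi cov τ) = quad (fr.fmat τ) k := by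
  rw [chi, (fr.adapted τ.1 hτ).xi_eq τ.2]
  exact fr.hcoeff_hlift τ hτ _ k

theorem AdaptedFrame.vmat_chi (τ : EndTM M) : fr.vmat cov τ (S.chi cov τ) = 0 :=
  fr.vmat_hlift τ _

theorem AdaptedFrame.smoothFieldAt_chi [CovariantDerivative.ContMDiffCovariantDerivative cov ∞]
    (hcov : S.IsSO3Connection cov) {σ : EndTM M} (hσ : σ.1 ∈ fr.U) :
    SmoothFieldAt (S.chi cov) σ := by
  refine fr.contMDiffAt_of_coeff hcov hσ (fun i ↦ ?_) fun i j ↦ ?_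
  · refine ((fr.smoothEntries_fmat σ).contMDiffAt_quad i).congr_of_eventuallyEq ?_
    filter_upwards [fr.eventually_base_mem hσ] with τ hτ using fr.hcoeff_chi hτ i
  · simp only [fr.vmat_chi]
    exact contMDiffAt_const

theorem mem_closure_interior_range_IEnd (x : E5 × (E5 →L[ℝ] E5)) :
    x ∈ closure (interior (Set.range (IEnd))) := by
  rw [ModelWithCorners.range_eq_univ]
  simp

/-- The horizontal components of a Lie bracket. -/
theorem AdaptedFrame.hcoeff_mlieBracket {σ : EndTM M} (hσ : σ.1 ∈ fr.U)
    {V W : (τ : EndTM M) → TangentSpace IEnd τ} (hV : SmoothFieldAt V σ) (hW : SmoothFieldAt W σ)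
    (k : Fin 5) :
    fr.hcoeff k σ (VectorField.mlieBracket IEnd V W σ) =
      mvfderiv IEnd (fun τ ↦ fr.hcoeff k τ (W τ)) σ (V σ)
        - mvfderiv IEnd (fun τ ↦ fr.hcoeff k τ (V τ)) σ (W σ)
        + ∑ j, ∑ i, fr.hcoeff j σ (V σ) * fr.hcoeff i σ (W σ) *
          S.g.inner σ.1 (VectorField.mlieBracket (𝓡 5) (fr.e j) (fr.e i) σ.1) (fr.e k σ.1) := by
  have h := mfderiv_mlieBracket_frame (I := IEnd) (J := 𝓡 5) (q := fun τ : EndTM M ↦ τ.1)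
    (mem_closure_interior_range_IEnd _) contMDiff_base.contMDiffAt hV hW
    (fun i ↦ fr.smooth i σ.1) (fun i ↦ fr.contMDiffAt_hcoeff hV i)
    (fun i ↦ fr.contMDiffAt_hcoeff hW i)
    (by filter_upwards [fr.eventually_base_mem hσ] with τ hτ using fr.dproj_eq hτ (V τ))
    (by filter_upwards [fr.eventually_base_mem hσ] with τ hτ using fr.dproj_eq hτ (W τ))
  have h2 : dproj σ (VectorField.mlieBracket IEnd V W σ) = _ := h
  rw [AdaptedFrame.hcoeff, h2, map_add, add_apply]
  refine congrArg₂ (· + ·) ((fr.isON hσ).inner_sum _ k) ?_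
  rw [map_sum, sum_apply]
  refine Finset.sum_congr rfl fun j _ ↦ ?_
  exact inner_sum_left _ _ _

/-- The curvature forms, evaluated on the horizontal parts of two tangent vectors. -/
def AdaptedFrame.curvMat (cov : Connection M) (σ : EndTM M) (A B : TangentSpace IEnd σ) :
    Matrix (Fin 5) (Fin 5) ℝ :=
  Matrix.of fun k l ↦ ∑ j, ∑ i, fr.hcoeff j σ A * fr.hcoeff i σ B * fr.curv cov σ.1 j i k l

/-- Cartan's structure equation, pulled back to `End(TM)`. -/
theorem AdaptedFrame.structure_equation [CovariantDerivative.ContMDiffCovariantDerivative cov ∞]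
    {σ : EndTM M} (hσ : σ.1 ∈ fr.U)
    {V W : (τ : EndTM M) → TangentSpace IEnd τ} (hV : SmoothFieldAt V σ) (hW : SmoothFieldAt W σ) :
    matDeriv (fun τ ↦ fr.cmat cov τ (W τ)) σ (V σ)
      - matDeriv (fun τ ↦ fr.cmat cov τ (V τ)) σ (W σ)
      - fr.cmat cov σ (VectorField.mlieBracket IEnd V W σ) =
    fr.curvMat cov σ (V σ) (W σ) + (fr.cmat cov σ (V σ) * fr.cmat cov σ (W σ)
      - fr.cmat cov σ (W σ) * fr.cmat cov σ (V σ)) := by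
  ext k l
  have h := pullback_extDeriv_frame (I := IEnd) (J := 𝓡 5) (q := fun τ : EndTM M ↦ τ.1)
    (mem_closure_interior_range_IEnd _) contMDiff_base.contMDiffAt hV hW
    (fun i ↦ fr.smooth i σ.1) (fun i ↦ fr.contMDiffAt_hcoeff hV i)
    (fun i ↦ fr.contMDiffAt_hcoeff hW i)
    (by filter_upwards [fr.eventually_base_mem hσ] with τ hτ using fr.dproj_eq hτ (V τ))
    (by filter_upwards [fr.eventually_base_mem hσ] with τ hτ using fr.dproj_eq hτ (W τ))
    (α := fun x ↦ fr.conn cov k l x) (fun i ↦ fr.contMDiffAt_conn i k l σ.1)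
  refine Eq.trans h ?_
  have h2 := sum_curvature_form (fun j ↦ fr.hcoeff j σ (V σ)) (fun i ↦ fr.hcoeff i σ (W σ))
    (fun j i ↦ mvfderiv (𝓡 5) (fun y ↦ fr.conn cov k l y (fr.e i y)) σ.1 (fr.e j σ.1)
      - mvfderiv (𝓡 5) (fun y ↦ fr.conn cov k l y (fr.e j y)) σ.1 (fr.e i σ.1)
      - fr.conn cov k l σ.1 (VectorField.mlieBracket (𝓡 5) (fr.e j) (fr.e i) σ.1))
    (fun j m ↦ fr.conn cov k m σ.1 (fr.e j σ.1)) (fun i m ↦ fr.conn cov m l σ.1 (fr.e i σ.1))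
  simp only [Matrix.add_apply, Matrix.sub_apply, Matrix.mul_apply, AdaptedFrame.curvMat,
    Matrix.of_apply, AdaptedFrame.curv, fr.cmat_eq hσ, ← Finset.sum_sub_distrib]
  rw [h2, Finset.sum_sub_distrib]
  ring

/-- The vertical component of a Lie bracket. It comes from the action of the bracket on the matrix
coordinates `fmat`, in which the derivatives of the connection forms combine to the curvature by the
structure equation. -/
theorem AdaptedFrame.vmat_mlieBracket [CovariantDerivative.ContMDiffCovariantDerivative cov ∞]
    (hcov : S.IsSO3Connection cov) {σ : EndTM M} (hσ : σ.1 ∈ fr.U)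
    {V W : (τ : EndTM M) → TangentSpace IEnd τ} (hV : SmoothFieldAt V σ) (hW : SmoothFieldAt W σ) :
    fr.vmat cov σ (VectorField.mlieBracket IEnd V W σ) =
      matDeriv (fun τ ↦ fr.vmat cov τ (W τ)) σ (V σ)
        - matDeriv (fun τ ↦ fr.vmat cov τ (V τ)) σ (W σ)
        + (fr.curvMat cov σ (V σ) (W σ) * fr.fmat σ - fr.fmat σ * fr.curvMat cov σ (V σ) (W σ))
        + (fr.cmat cov σ (W σ) * fr.vmat cov σ (V σ) - fr.vmat cov σ (V σ) * fr.cmat cov σ (W σ))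
        - (fr.cmat cov σ (V σ) * fr.vmat cov σ (W σ)
          - fr.vmat cov σ (W σ) * fr.cmat cov σ (V σ)) := by
  have h1 : matDeriv fr.fmat σ (VectorField.mlieBracket IEnd V W σ) =
      matDeriv (fun τ ↦ matDeriv fr.fmat τ (W τ)) σ (V σ)
        - matDeriv (fun τ ↦ matDeriv fr.fmat τ (V τ)) σ (W σ) := by
    ext i j
    exact mvfderiv_mlieBracket (fr.contMDiffAt_fmat i j σ) hV hW
      (mem_closure_interior_range_IEnd _)
  have h2 : ∀ {X : (τ : EndTM M) → TangentSpace IEnd τ}, SmoothFieldAt X σ →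
      ∀ A : TangentSpace IEnd σ, matDeriv (fun τ ↦ matDeriv fr.fmat τ (X τ)) σ A =
        matDeriv (fun τ ↦ fr.vmat cov τ (X τ)) σ A
          + (matDeriv (fun τ ↦ fr.cmat cov τ (X τ)) σ A * fr.fmat σ
            + fr.cmat cov σ (X σ) * matDeriv fr.fmat σ A
            - (matDeriv fr.fmat σ A * fr.cmat cov σ (X σ)
              + fr.fmat σ * matDeriv (fun τ ↦ fr.cmat cov τ (X τ)) σ A)) := by
    intro X hX A
    have hv : SmoothEntries IEnd (fun τ ↦ fr.vmat cov τ (X τ)) σ :=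
      fun i j ↦ fr.contMDiffAt_vmat hcov hσ hX i j
    have hc : SmoothEntries IEnd (fun τ ↦ fr.cmat cov τ (X τ)) σ :=
      fun i j ↦ fr.contMDiffAt_cmat hσ hX i j
    have hf := fr.smoothEntries_fmat σ
    have hev : (fun τ ↦ matDeriv fr.fmat τ (X τ)) =ᶠ[𝓝 σ] fun τ ↦ fr.vmat cov τ (X τ)
        + (fr.cmat cov τ (X τ) * fr.fmat τ - fr.fmat τ * fr.cmat cov τ (X τ)) := by
      filter_upwards [fr.eventually_base_mem hσ] with τ hτ using fr.matDeriv_fmat hcov hτ (X τ)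
    rw [matDeriv_congr hev, matDeriv_add hv ((hc.mul hf).sub (hf.mul hc)),
      matDeriv_sub (hc.mul hf) (hf.mul hc), matDeriv_mul hc hf, matDeriv_mul hf hc]
  have h3 := fr.structure_equation (cov := cov) hσ hV hW
  rw [h2 hV, h2 hW, fr.matDeriv_fmat hcov hσ, fr.matDeriv_fmat hcov hσ,
    fr.matDeriv_fmat hcov hσ] at h1
  generalize fr.vmat cov σ (VectorField.mlieBracket IEnd V W σ) = vC at h1 ⊢
  generalize fr.cmat cov σ (VectorField.mlieBracket IEnd V W σ) = cC at h1 h3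
  generalize matDeriv (fun τ ↦ fr.cmat cov τ (W τ)) σ (V σ) = dW at h1 h3
  generalize matDeriv (fun τ ↦ fr.cmat cov τ (V τ)) σ (W σ) = dV at h1 h3
  rw [sub_eq_iff_eq_add, sub_eq_iff_eq_add] at h3
  subst h3
  rw [← eq_sub_iff_add_eq] at h1
  rw [h1]
  noncomm_ring

end Brackets

/-! ### The Lie derivative of the metric along the characteristic field -/

section LieDerivative
variable {M : Type*} [TopologicalSpace M] [ChartedSpace E5 M] [IsManifold (𝓡 5) ∞ M]
  {S : IrreducibleSO3Structure M} {cov : Connection M} {x₀ : M} (fr : AdaptedFrame S x₀)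

open scoped Matrix

theorem AdaptedFrame.hMetric_eq (t : ℝ) {τ : EndTM M} (hτ : τ.1 ∈ fr.U)
    (A B : TangentSpace IEnd τ) :
    S.hMetric cov t τ A B = ∑ k, fr.hcoeff k τ A * fr.hcoeff k τ B
      + t * (-(1 / 2) * (fr.vmat cov τ A * fr.vmat cov τ B).trace) := by
  rw [hMetric, (fr.isON hτ).inner_eq, (fr.isON hτ).bivInner_eq]
  rfl

theorem mvfderiv_trace {P : EndTM M → Matrix (Fin 5) (Fin 5) ℝ} {σ : EndTM M}
    (hP : SmoothEntries IEnd P σ) (A : TangentSpace IEnd σ) :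
    mvfderiv IEnd (fun τ ↦ (P τ).trace) σ A = (matDeriv P σ A).trace :=
  mvfderiv_sum Finset.univ (fun i ↦ hP i i) A

theorem AdaptedFrame.mvfderiv_hMetric [CovariantDerivative.ContMDiffCovariantDerivative cov ∞]
    (hcov : S.IsSO3Connection cov) (t : ℝ) {σ : EndTM M} (hσ : σ.1 ∈ fr.U)
    {A B : (τ : EndTM M) → TangentSpace IEnd τ} (hA : SmoothFieldAt A σ) (hB : SmoothFieldAt B σ)
    (C : TangentSpace IEnd σ) :
    mvfderiv IEnd (fun τ ↦ S.hMetric cov t τ (A τ) (B τ)) σ C =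
      ∑ k, (mvfderiv IEnd (fun τ ↦ fr.hcoeff k τ (A τ)) σ C * fr.hcoeff k σ (B σ)
        + fr.hcoeff k σ (A σ) * mvfderiv IEnd (fun τ ↦ fr.hcoeff k τ (B τ)) σ C)
      + t * (-(1 / 2) * (matDeriv (fun τ ↦ fr.vmat cov τ (A τ)) σ C * fr.vmat cov σ (B σ)
        + fr.vmat cov σ (A σ) * matDeriv (fun τ ↦ fr.vmat cov τ (B τ)) σ C).trace) := by
  have hvA : SmoothEntries IEnd (fun τ ↦ fr.vmat cov τ (A τ)) σ :=
    fun i j ↦ fr.contMDiffAt_vmat hcov hσ hA i j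
  have hvB : SmoothEntries IEnd (fun τ ↦ fr.vmat cov τ (B τ)) σ :=
    fun i j ↦ fr.contMDiffAt_vmat hcov hσ hB i j
  have hs : ContMDiffAt IEnd 𝓘(ℝ, ℝ) ∞
      (fun τ ↦ ∑ k, fr.hcoeff k τ (A τ) * fr.hcoeff k τ (B τ)) σ :=
    ContMDiffAt.sum fun k _ ↦ (fr.contMDiffAt_hcoeff hA k).mul (fr.contMDiffAt_hcoeff hB k)
  have htr : ContMDiffAt IEnd 𝓘(ℝ, ℝ) ∞
      (fun τ ↦ (fr.vmat cov τ (A τ) * fr.vmat cov τ (B τ)).trace) σ :=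
    ContMDiffAt.sum fun i _ ↦ (hvA.mul hvB) i i
  have htr2 : ContMDiffAt IEnd 𝓘(ℝ, ℝ) ∞
      (fun τ ↦ (t * -(1 / 2)) * (fr.vmat cov τ (A τ) * fr.vmat cov τ (B τ)).trace) σ :=
    contMDiffAt_const.mul htr
  have hev : (fun τ ↦ S.hMetric cov t τ (A τ) (B τ)) =ᶠ[𝓝 σ]
      fun τ ↦ ∑ k, fr.hcoeff k τ (A τ) * fr.hcoeff k τ (B τ)
        + (t * -(1 / 2)) * (fr.vmat cov τ (A τ) * fr.vmat cov τ (B τ)).trace := by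
    filter_upwards [fr.eventually_base_mem hσ] with τ hτ
    rw [fr.hMetric_eq t hτ, mul_assoc]
  rw [mvfderiv_congr hev, mvfderiv_fun_add (hs.mdifferentiableAt (by simp))
    (htr2.mdifferentiableAt (by simp)), mvfderiv_fun_mul mdifferentiableAt_const
    (htr.mdifferentiableAt (by simp)), add_apply,
    mvfderiv_sum_mul _ (fun k ↦ fr.contMDiffAt_hcoeff hA k) (fun k ↦ fr.contMDiffAt_hcoeff hB k),
    ← matDeriv_mul hvA hvB, ← mvfderiv_trace (hvA.mul hvB)]
  simp [mvfderiv_const]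
  ring

/-- The contributions of the connection forms and of the brackets of the frame to the
horizontal-horizontal part of the Lie derivative cancel, as the torsion is totally skew. -/
theorem AdaptedFrame.sum_torsion (hcov : S.IsCharacteristic cov) {x : M} (hx : x ∈ fr.U)
    (ξ a b : Fin 5 → ℝ) :
    ∑ k, (∑ j, ξ j * ∑ i, a i * fr.conn cov j k x (fr.e i x)
        + ∑ j, ∑ i, ξ j * a i * S.g.inner x (VectorField.mlieBracket (𝓡 5) (fr.e j) (fr.e i) x)
          (fr.e k x)) * b k
      + ∑ k, (∑ j, ξ j * ∑ i, b i * fr.conn cov j k x (fr.e i x)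
        + ∑ j, ∑ i, ξ j * b i * S.g.inner x (VectorField.mlieBracket (𝓡 5) (fr.e j) (fr.e i) x)
          (fr.e k x)) * a k = 0 := by
  have h1 : ∀ a b : Fin 5 → ℝ, ∑ k, (∑ j, ξ j * ∑ i, a i * fr.conn cov j k x (fr.e i x)
        + ∑ j, ∑ i, ξ j * a i * S.g.inner x (VectorField.mlieBracket (𝓡 5) (fr.e j) (fr.e i) x)
          (fr.e k x)) * b k = ∑ j, ∑ k, ∑ i, ξ j * a i * b k * (fr.conn cov j k x (fr.e i x)
          + S.g.inner x (VectorField.mlieBracket (𝓡 5) (fr.e j) (fr.e i) x) (fr.e k x)) := by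
    intro a b
    rw [Finset.sum_comm]
    refine Finset.sum_congr rfl fun k _ ↦ ?_
    rw [← Finset.sum_add_distrib, Finset.sum_mul]
    refine Finset.sum_congr rfl fun j _ ↦ ?_
    rw [Finset.mul_sum, ← Finset.sum_add_distrib, Finset.sum_mul]
    exact Finset.sum_congr rfl fun i _ ↦ by ring
  rw [h1, h1, ← Finset.sum_add_distrib]
  refine Finset.sum_eq_zero fun j _ ↦ ?_
  rw [Finset.sum_comm, ← Finset.sum_add_distrib]
  refine Finset.sum_eq_zero fun i _ ↦ ?_
  rw [← Finset.sum_add_distrib]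
  refine Finset.sum_eq_zero fun k _ ↦ ?_
  have := fr.torsion_skew hcov hx j i k
  linear_combination ξ j * a i * b k * this

/-- The vertical part of the Lie derivative: the derivatives `DA`, `DB` of the components of the two
fields and the connection matrix `c` along `χ` drop out, and the curvature terms `ΩA`, `ΩB` remain.
-/
theorem trace_cancel (DA DB a b ΩA ΩB c cA cB : Matrix (Fin 5) (Fin 5) ℝ) :
    (DA * b + a * DB).trace
      - ((DA - 0 + ΩA + (cA * 0 - 0 * cA) - (c * a - a * c)) * b).trace
      - ((DB - 0 + ΩB + (cB * 0 - 0 * cB) - (c * b - b * c)) * a).trace =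
    -(ΩA * b + ΩB * a).trace := by
  simp only [mul_zero, zero_mul, sub_zero, add_zero, add_mul, sub_mul, Matrix.trace_add,
    Matrix.trace_sub]
  linear_combination Matrix.trace_mul_comm a DB + Matrix.trace_mul_cycle c a b
    - Matrix.trace_mul_cycle a c b - Matrix.trace_mul_cycle b a c

/-- The horizontal part of the Lie derivative: the derivatives `X`, `Y` of the components of the two
fields and the terms of `AdaptedFrame.sum_torsion` drop out, and the vertical derivatives `q`, `q'`
of `ξ` remain. -/
theorem sum_cancel {X Y q q' T T' R R' a b : Fin 5 → ℝ}
    (h : ∑ k, (T k + R k) * b k + ∑ k, (T' k + R' k) * a k = 0) :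
    ∑ k, (X k * b k + a k * Y k) - ∑ k, (X k - (q k - T k) + R k) * b k
      - ∑ k, (Y k - (q' k - T' k) + R' k) * a k = ∑ k, (q k * b k + q' k * a k) := by
  rw [← sub_eq_zero, ← neg_eq_zero.mpr h, ← Finset.sum_add_distrib, ← Finset.sum_sub_distrib,
    ← Finset.sum_sub_distrib, ← Finset.sum_sub_distrib, ← Finset.sum_neg_distrib]
  exact Finset.sum_congr rfl fun k _ ↦ by ring

/-- The Lie derivative of `h_t` along `χ`, in matrix form, at a point of `Λ²₃TM`. -/
theorem AdaptedFrame.lieDerivMetric_eq [CovariantDerivative.ContMDiffCovariantDerivative cov ∞]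
    (hcov : S.IsCharacteristic cov) (t : ℝ) {σ : EndTM M} (hσ : σ.1 ∈ fr.U)
    {v : Fin 3 → ℝ} (hv : fr.fmat σ = so3Mat v)
    {A B : (τ : EndTM M) → TangentSpace IEnd τ} (hA : SmoothFieldAt A σ) (hB : SmoothFieldAt B σ) :
    S.lieDerivMetric cov t A B σ =
      ∑ k, (quadPolar (so3Mat v) (fr.vmat cov σ (A σ)) k * fr.hcoeff k σ (B σ)
        + quadPolar (so3Mat v) (fr.vmat cov σ (B σ)) k * fr.hcoeff k σ (A σ))
      + t / 2 * ((fr.curvMat cov σ (S.chi cov σ) (A σ) * so3Mat v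
          - so3Mat v * fr.curvMat cov σ (S.chi cov σ) (A σ)) * fr.vmat cov σ (B σ)
        + (fr.curvMat cov σ (S.chi cov σ) (B σ) * so3Mat v
          - so3Mat v * fr.curvMat cov σ (S.chi cov σ) (B σ)) * fr.vmat cov σ (A σ)).trace := by
  have hcov' := hcov.toIsSO3Connection
  have hχ := fr.smoothFieldAt_chi hcov' hσ
  -- By equivariance, the connection forms act on `ξ` as on any horizontal vector.
  have hξ : ∀ k (C : TangentSpace IEnd σ),
      mvfderiv IEnd (fun τ ↦ fr.hcoeff k τ (S.chi cov τ)) σ C =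
        quadPolar (so3Mat v) (fr.vmat cov σ C) k
          - ∑ j, fr.hcoeff j σ (S.chi cov σ) * ∑ i, fr.hcoeff i σ C
            * fr.conn cov j k σ.1 (fr.e i σ.1) := by
    intro k C
    have hev : (fun τ ↦ fr.hcoeff k τ (S.chi cov τ)) =ᶠ[𝓝 σ] fun τ ↦ quad (fr.fmat τ) k := by
      filter_upwards [fr.eventually_base_mem hσ] with τ hτ using fr.hcoeff_chi hτ k
    obtain ⟨g, hg⟩ : ∃ g, fr.cmat cov σ C = so3Mat g :=
      fr.exists_conn_eq_so3Mat hcov' hσ (dproj σ C)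
    rw [mvfderiv_congr hev, mvfderiv_quad (fr.smoothEntries_fmat σ), fr.matDeriv_fmat hcov' hσ,
      quadPolar_add, hv, hg, so3Mat_lie, quadPolar_neg, quadPolar_cross, ← sub_eq_add_neg]
    congr 1
    refine Finset.sum_congr rfl fun j _ ↦ ?_
    rw [fr.hcoeff_chi hσ, hv, ← hg, fr.cmat_eq hσ]
  have hvχ : ∀ C : TangentSpace IEnd σ,
      matDeriv (fun τ ↦ fr.vmat cov τ (S.chi cov τ)) σ C = 0 := by
    intro C
    simp only [fr.vmat_chi]
    ext i j
    simp [matDeriv, mvfderiv_const]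
  have hbr : ∀ {C D : (τ : EndTM M) → TangentSpace IEnd τ}, SmoothFieldAt C σ →
      S.hMetric cov t σ (VectorField.mlieBracket IEnd (S.chi cov) C σ) (D σ) = _ :=
      fun {C D} hC ↦ by
    rw [fr.hMetric_eq t hσ, fr.vmat_mlieBracket hcov' hσ hχ hC, hvχ, fr.vmat_chi]
  have hsymm : ∀ C D : TangentSpace IEnd σ, S.hMetric cov t σ C D = S.hMetric cov t σ D C := by
    intro C D
    rw [fr.hMetric_eq t hσ, fr.hMetric_eq t hσ, Matrix.trace_mul_comm]
    simp only [mul_comm]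
  have htor := fr.sum_torsion hcov hσ (fun j ↦ fr.hcoeff j σ (S.chi cov σ))
    (fun i ↦ fr.hcoeff i σ (A σ)) (fun i ↦ fr.hcoeff i σ (B σ))
  rw [lieDerivMetric, fr.mvfderiv_hMetric hcov' t hσ hA hB, hsymm (A σ), hbr hA, hbr hB, hv]
  simp only [fr.hcoeff_mlieBracket hσ hχ hA, fr.hcoeff_mlieBracket hσ hχ hB, hξ]
  have hsum := sum_cancel htor
    (X := fun k ↦ mvfderiv IEnd (fun τ ↦ fr.hcoeff k τ (A τ)) σ (S.chi cov σ))
    (Y := fun k ↦ mvfderiv IEnd (fun τ ↦ fr.hcoeff k τ (B τ)) σ (S.chi cov σ))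
    (q := quadPolar (so3Mat v) (fr.vmat cov σ (A σ)))
    (q' := quadPolar (so3Mat v) (fr.vmat cov σ (B σ)))
  have htrace := trace_cancel
    (matDeriv (fun τ ↦ fr.vmat cov τ (A τ)) σ (S.chi cov σ))
    (matDeriv (fun τ ↦ fr.vmat cov τ (B τ)) σ (S.chi cov σ))
    (fr.vmat cov σ (A σ)) (fr.vmat cov σ (B σ))
    (fr.curvMat cov σ (S.chi cov σ) (A σ) * so3Mat v
      - so3Mat v * fr.curvMat cov σ (S.chi cov σ) (A σ))
    (fr.curvMat cov σ (S.chi cov σ) (B σ) * so3Mat v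
      - so3Mat v * fr.curvMat cov σ (S.chi cov σ) (B σ))
    (fr.cmat cov σ (S.chi cov σ)) (fr.cmat cov σ (A σ)) (fr.cmat cov σ (B σ))
  rw [← hsum]
  linear_combination -(t / 2) * htrace

end LieDerivative

/-! ### The defect of the curvature from being constant -/

section Defect
variable {M : Type*} [TopologicalSpace M] [ChartedSpace E5 M] [IsManifold (𝓡 5) ∞ M]
  {S : IrreducibleSO3Structure M} {cov : Connection M} {x₀ : M} (fr : AdaptedFrame S x₀)

open scoped Matrix

/-- The bilinear map with given values on the standard basis. -/
def bilinOf (d : Fin 5 → Fin 5 → Fin 3 → ℝ) :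
    (Fin 5 → ℝ) →ₗ[ℝ] (Fin 5 → ℝ) →ₗ[ℝ] (Fin 3 → ℝ) :=
  LinearMap.mk₂ ℝ (fun x y ↦ ∑ j, ∑ i, (x j * y i) • d j i)
    (fun x x' y ↦ by simp only [Pi.add_apply, add_mul, add_smul, Finset.sum_add_distrib])
    (fun c x y ↦ by simp only [Pi.smul_apply, smul_eq_mul, mul_assoc, mul_smul, Finset.smul_sum])
    (fun x y y' ↦ by simp only [Pi.add_apply, mul_add, add_smul, Finset.sum_add_distrib])
    (fun c x y ↦ by
      simp only [Pi.smul_apply, smul_eq_mul, mul_left_comm _ c, mul_smul, Finset.smul_sum])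

theorem bilinOf_apply (d : Fin 5 → Fin 5 → Fin 3 → ℝ) (x y : Fin 5 → ℝ) :
    bilinOf d x y = ∑ j, ∑ i, (x j * y i) • d j i := rfl

theorem bilinOf_skew {d : Fin 5 → Fin 5 → Fin 3 → ℝ} (hd : ∀ i j, d i j = -d j i)
    (x y : Fin 5 → ℝ) : bilinOf d y x = -bilinOf d x y := by
  rw [bilinOf_apply, bilinOf_apply, Finset.sum_comm, ← Finset.sum_neg_distrib]
  refine Finset.sum_congr rfl fun j _ ↦ ?_
  rw [← Finset.sum_neg_distrib]
  exact Finset.sum_congr rfl fun i _ ↦ by rw [hd i j, smul_neg, mul_comm]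

/-- The coordinates on `so(3)`, inverse to `so3Mat`, extended to all matrices by reading off three
entries. -/
def vecOf (F : Matrix (Fin 5) (Fin 5) ℝ) : Fin 3 → ℝ := ![-F 1 4, -F 2 4, -F 1 2]

theorem vecOf_so3Mat (v : Fin 3 → ℝ) : vecOf (so3Mat v) = v := by
  ext r
  fin_cases r <;> simp [vecOf, so3Mat]

variable (cov) in
/-- The curvature forms as a bilinear map with values in `so(3) = ℝ³`. With the sign convention for
`R`, this is minus the curvature operator: it represents `Z ↦ -R(X, Y)Z`. -/
def AdaptedFrame.curvVec (x : M) : (Fin 5 → ℝ) →ₗ[ℝ] (Fin 5 → ℝ) →ₗ[ℝ] (Fin 3 → ℝ) :=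
  bilinOf fun j i ↦ vecOf (fr.curv cov x j i)

/-- The map `projVec`, as a bilinear map. -/
def projLin : (Fin 5 → ℝ) →ₗ[ℝ] (Fin 5 → ℝ) →ₗ[ℝ] (Fin 3 → ℝ) :=
  bilinOf fun j i r ↦ 1 / 5 * so3Mat (Pi.single r 1) j i

theorem projLin_apply (x y : Fin 5 → ℝ) : projLin x y = projVec x y := by
  ext r
  simp only [projLin, bilinOf_apply, Finset.sum_apply, Pi.smul_apply, smul_eq_mul, projVec,
    Finset.mul_sum]
  exact Finset.sum_congr rfl fun j _ ↦ Finset.sum_congr rfl fun i _ ↦ by ring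

variable (cov) in
/-- The difference `𝒫 - t 𝓡` as a bilinear map `Λ²ℝ⁵ → so(3) = ℝ³`. -/
def AdaptedFrame.defect (t : ℝ) (x : M) : (Fin 5 → ℝ) →ₗ[ℝ] (Fin 5 → ℝ) →ₗ[ℝ] (Fin 3 → ℝ) :=
  projLin + t • fr.curvVec cov x

theorem AdaptedFrame.defect_skew (t : ℝ) (x : M) (a b : Fin 5 → ℝ) :
    fr.defect cov t x b a = -fr.defect cov t x a b := by
  have h1 : projLin b a = -projLin a b := bilinOf_skew (fun i j ↦ by
    ext r
    rw [Pi.neg_apply, so3Mat_skew _ j i]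
    ring) a b
  have h2 : fr.curvVec cov x b a = -fr.curvVec cov x a b := bilinOf_skew (fun i j ↦ by
    have h := fr.curv_skew (cov := cov) x j i
    ext r
    fin_cases r <;> simp [vecOf, h]) a b
  simp only [AdaptedFrame.defect, LinearMap.add_apply, LinearMap.smul_apply, h1, h2]
  rw [smul_neg, neg_add]

theorem AdaptedFrame.so3Mat_curvVec [CovariantDerivative.ContMDiffCovariantDerivative cov ∞]
    (hcov : S.IsSO3Connection cov) {x : M} (hx : x ∈ fr.U) (a b : Fin 5 → ℝ) (k l : Fin 5) :
    so3Mat (fr.curvVec cov x a b) k l = ∑ j, ∑ i, a j * b i * fr.curv cov x j i k l := by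
  have h1 : ∀ j i, so3Lin (vecOf (fr.curv cov x j i)) = fr.curv cov x j i := by
    intro j i
    obtain ⟨r, hr⟩ := fr.exists_curv_eq_so3Mat hcov hx j i
    rw [hr, vecOf_so3Mat]
    rfl
  have h2 : so3Lin (fr.curvVec cov x a b) = ∑ j, ∑ i, (a j * b i) • fr.curv cov x j i := by
    simp only [AdaptedFrame.curvVec, bilinOf_apply, map_sum, map_smul, h1]
  have h3 := congrFun (congrFun h2 k) l
  simp only [Matrix.sum_apply, Matrix.smul_apply, smul_eq_mul] at h3
  exact h3

theorem AdaptedFrame.curvMat_eq [CovariantDerivative.ContMDiffCovariantDerivative cov ∞]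
    (hcov : S.IsSO3Connection cov) {σ : EndTM M} (hσ : σ.1 ∈ fr.U) (A B : TangentSpace IEnd σ) :
    fr.curvMat cov σ A B = so3Mat (fr.curvVec cov σ.1 (fun j ↦ fr.hcoeff j σ A)
      (fun i ↦ fr.hcoeff i σ B)) := by
  ext k l
  rw [fr.so3Mat_curvVec hcov hσ]
  rfl

/-- The pairing of `x ∧ y - P` with `τ`, for `P` and `τ` in `Λ²₃`. -/
theorem IsON.bivInner_wedge_sub {p : M} {a : Fin 5 → TangentSpace (𝓡 5) p} (h : S.IsON a)
    (X Y : TangentSpace (𝓡 5) p) {P τ : EndT M p} {q g : Fin 3 → ℝ} (hP : mat S a P = so3Mat q)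
    (hτ : mat S a τ = so3Mat g) :
    bivInner (S.wedge X Y - P) τ =
      5 * projVec (fun i ↦ S.g.inner p X (a i)) (fun i ↦ S.g.inner p Y (a i)) ⬝ᵥ g
        - 5 * q ⬝ᵥ g := by
  have h1 := sum_so3Mat_mul q g
  have h2 : ∑ i, ∑ j, mat S a (S.wedge X Y) i j * so3Mat g j i =
      -2 * ∑ i, ∑ j, S.g.inner p X (a i) * S.g.inner p Y (a j) * so3Mat g i j := by
    simp only [mat_wedge, sub_mul, Finset.sum_sub_distrib]
    rw [Finset.sum_comm (f := fun i j ↦ S.g.inner p Y (a i) * S.g.inner p X (a j) * so3Mat g j i)]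
    simp only [← Finset.sum_sub_distrib, Finset.mul_sum]
    exact Finset.sum_congr rfl fun i _ ↦ Finset.sum_congr rfl fun j _ ↦ by
      rw [so3Mat_skew g i j]; ring
  rw [h.bivInner_eq, mat_sub, hP, hτ, projVec_dotProduct]
  simp only [Matrix.sub_apply, sub_mul, Finset.sum_sub_distrib]
  rw [h1, h2]
  simp only [neg_mul]
  ring

/-- In an adapted basis, the orthogonal projection onto `Λ²₃` is `projVec`. -/
theorem IsAdapted.isProj23_iff {p : M} {a : Fin 5 → TangentSpace (𝓡 5) p} (h : S.IsAdapted p a)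
    (X Y : TangentSpace (𝓡 5) p) (P : EndT M p) :
    S.IsProj23 (S.wedge X Y) P ↔ mat S a P =
      so3Mat (projVec (fun i ↦ S.g.inner p X (a i)) (fun i ↦ S.g.inner p Y (a i))) := by
  constructor
  · rintro ⟨hP, horth⟩
    obtain ⟨q, hq⟩ := h.mem_lambda23.1 hP
    rw [hq]
    refine congrArg so3Mat (dotProduct_eq _ _ fun g ↦ ?_)
    have hmem : ofMat S a (so3Mat g) ∈ S.lambda23 p :=
      h.mem_lambda23.2 ⟨g, h.isON.mat_ofMat _⟩
    have h1 := horth _ hmem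
    rw [h.isON.bivInner_wedge_sub X Y hq (h.isON.mat_ofMat _)] at h1
    linarith
  · intro hP
    refine ⟨h.mem_lambda23.2 ⟨_, hP⟩, fun τ hτ ↦ ?_⟩
    obtain ⟨g, hg⟩ := h.mem_lambda23.1 hτ
    rw [h.isON.bivInner_wedge_sub X Y hP hg, sub_self]

/-- `∇` has constant curvature `t⁻¹` iff the defect vanishes. -/
theorem AdaptedFrame.curvature_eq_iff [CovariantDerivative.ContMDiffCovariantDerivative cov ∞]
    (hcov : S.IsSO3Connection cov) {t : ℝ} (ht : 0 < t) {x : M} (hx : x ∈ fr.U) :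
    (∀ X Y : TangentSpace (𝓡 5) x, ∃ P : EndT M x, S.IsProj23 (S.wedge X Y) P ∧
      ∀ Z : TangentSpace (𝓡 5) x, curvature cov x X Y Z = t⁻¹ • P Z) ↔ fr.defect cov t x = 0 := by
  have had := fr.adapted x hx
  have hon := fr.isON hx
  have hcurv : ∀ X Y Z l, S.g.inner x (curvature cov x X Y Z) (fr.e l x) =
      -∑ k, S.g.inner x Z (fr.e k x) * so3Mat (fr.curvVec cov x
        (fun i ↦ S.g.inner x X (fr.e i x)) (fun i ↦ S.g.inner x Y (fr.e i x))) k l := by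
    intro X Y Z l
    rw [fr.inner_curvature hcov hx]
    simp only [fr.so3Mat_curvVec hcov hx]
  constructor
  · intro h
    refine LinearMap.ext fun a ↦ LinearMap.ext fun b ↦ ?_
    obtain ⟨P, hP, hR⟩ := h (∑ i, a i • fr.e i x) (∑ i, b i • fr.e i x)
    rw [had.isProj23_iff] at hP
    simp only [hon.inner_sum] at hP
    have h1 : so3Mat (-fr.curvVec cov x a b) = so3Mat (t⁻¹ • projVec a b) := by
      rw [(isLinear_so3Mat _ 0 _).2, ← hP]
      ext k l
      have h2 := hcurv (∑ i, a i • fr.e i x) (∑ i, b i • fr.e i x) (fr.e k x) l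
      rw [hR] at h2
      simp only [hon.inner_sum, hon k _] at h2
      have h3 : so3Mat (-fr.curvVec cov x a b) k l = -so3Mat (fr.curvVec cov x a b) k l := by
        rw [← neg_one_smul ℝ, (isLinear_so3Mat _ 0 _).2]
        simp
      rw [h3]
      simp only [ite_mul, one_mul, zero_mul, Finset.sum_ite_eq, Finset.mem_univ, if_true] at h2
      rw [← h2, map_smul]
      rfl
    have h4 := so3Mat_inj h1
    rw [AdaptedFrame.defect, LinearMap.add_apply, LinearMap.add_apply, projLin_apply,
      LinearMap.smul_apply, LinearMap.smul_apply, ← neg_neg (fr.curvVec cov x a b), h4, smul_neg,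
      smul_smul, mul_inv_cancel₀ ht.ne', one_smul, add_neg_cancel]
    rfl
  · intro h X Y
    refine ⟨ofMat S (fun i ↦ fr.e i x) (so3Mat (projVec (fun i ↦ S.g.inner x X (fr.e i x))
      (fun i ↦ S.g.inner x Y (fr.e i x)))), (had.isProj23_iff X Y _).2 (hon.mat_ofMat _),
      fun Z ↦ hon.ext fun l ↦ ?_⟩
    have h1 := congrArg (fun D : (Fin 5 → ℝ) →ₗ[ℝ] (Fin 5 → ℝ) →ₗ[ℝ] (Fin 3 → ℝ) ↦
      D (fun i ↦ S.g.inner x X (fr.e i x)) (fun i ↦ S.g.inner x Y (fr.e i x))) h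
    simp only [AdaptedFrame.defect, LinearMap.add_apply, LinearMap.smul_apply, projLin_apply,
      LinearMap.zero_apply] at h1
    rw [hcurv, eq_neg_of_add_eq_zero_left h1, map_smul, smul_apply]
    have h2 : ∀ W : Matrix (Fin 5) (Fin 5) ℝ,
        S.g.inner x (ofMat S (fun i ↦ fr.e i x) W Z) (fr.e l x) =
          ∑ k, S.g.inner x Z (fr.e k x) * W k l := by
      intro W
      have hZ : ofMat S (fun i ↦ fr.e i x) W Z =
          ∑ k, S.g.inner x Z (fr.e k x) • ofMat S (fun i ↦ fr.e i x) W (fr.e k x) := by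
        conv_lhs => rw [hon.expand Z, map_sum]
        exact Finset.sum_congr rfl fun k _ ↦ map_smul _ _ _
      rw [hZ, inner_sum_left]
      have h3 : ∀ k, S.g.inner x (ofMat S (fun i ↦ fr.e i x) W (fr.e k x)) (fr.e l x) = W k l :=
        fun k ↦ congrFun (congrFun (hon.mat_ofMat W) k) l
      simp only [h3]
    rw [h2, ← neg_smul, (isLinear_so3Mat _ 0 _).2, smul_eq_mul, Finset.mul_sum,
      ← Finset.sum_neg_distrib]
    refine Finset.sum_congr rfl fun k _ ↦ ?_
    rw [Matrix.smul_apply, smul_eq_mul]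
    field_simp

end Defect

/-! ### The Killing equation on the twistor space -/

section Killing
variable {M : Type*} [TopologicalSpace M] [ChartedSpace E5 M] [IsManifold (𝓡 5) ∞ M]
  {S : IrreducibleSO3Structure M} {cov : Connection M} {x₀ : M} (fr : AdaptedFrame S x₀)

open scoped Matrix

theorem trace_lie_mul (r v w : Fin 3 → ℝ) :
    ((so3Mat r * so3Mat v - so3Mat v * so3Mat r) * so3Mat w).trace = 10 * r ⬝ᵥ v ⨯₃ w := by
  have h : (so3Mat (r ⨯₃ v) * so3Mat w).trace = -10 * (r ⨯₃ v) ⬝ᵥ w :=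
    sum_so3Mat_mul (r ⨯₃ v) w
  rw [so3Mat_lie, neg_mul, Matrix.trace_neg, h, dotProduct_comm (r ⨯₃ v),
    triple_product_permutation]
  ring

/-- The derivative of `v ↦ ξ_v` at a unit vector along a tangent vector `w` of the sphere, which is
the infinitesimal rotation of `v` by `v × w`. -/
theorem sum_quadPolar_mul {v w : Fin 3 → ℝ} (hv : v ⬝ᵥ v = 1) (hw : v ⬝ᵥ w = 0) (b : Fin 5 → ℝ) :
    ∑ k, quadPolar (so3Mat v) (so3Mat w) k * b k =
      5 * projVec (quad (so3Mat v)) b ⬝ᵥ v ⨯₃ w := by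
  have h : w = v ⨯₃ w ⨯₃ v := by
    rw [cross_cross_eq_smul_sub_smul, hv, dotProduct_comm w v, hw, one_smul, zero_smul, sub_zero]
  rw [projVec_dotProduct]
  conv_lhs => rw [h]
  simp only [quadPolar_cross, Finset.sum_mul]
  rw [Finset.sum_comm]
  exact Finset.sum_congr rfl fun j _ ↦ Finset.sum_congr rfl fun k _ ↦ by ring

/-- The Lie derivative of `h_t` on the twistor space, in terms of the defect `D`, at the point with
coordinates `v`: it is `5 D(ξ_v, b) · (v × w_A) + 5 D(ξ_v, a) · (v × w_B)`, where `a`, `b` are the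
horizontal and `w_A`, `w_B` the vertical components of the two fields. -/
theorem AdaptedFrame.lieDerivMetric_eq_defect
    [CovariantDerivative.ContMDiffCovariantDerivative cov ∞]
    (hcov : S.IsCharacteristic cov) (t : ℝ) {σ : EndTM M} (hσ : σ.1 ∈ fr.U)
    {v : Fin 3 → ℝ} (hv : fr.fmat σ = so3Mat v) (hv1 : v ⬝ᵥ v = 1)
    {A B : (τ : EndTM M) → TangentSpace IEnd τ} (hA : SmoothFieldAt A σ) (hB : SmoothFieldAt B σ)
    {wA wB : Fin 3 → ℝ} (hwA : fr.vmat cov σ (A σ) = so3Mat wA) (hvA : v ⬝ᵥ wA = 0)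
    (hwB : fr.vmat cov σ (B σ) = so3Mat wB) (hvB : v ⬝ᵥ wB = 0) :
    S.lieDerivMetric cov t A B σ =
      5 * fr.defect cov t σ.1 (quad (so3Mat v)) (fun k ↦ fr.hcoeff k σ (B σ)) ⬝ᵥ v ⨯₃ wA
      + 5 * fr.defect cov t σ.1 (quad (so3Mat v)) (fun k ↦ fr.hcoeff k σ (A σ)) ⬝ᵥ v ⨯₃ wB := by
  have hξ : (fun j ↦ fr.hcoeff j σ (S.chi cov σ)) = quad (so3Mat v) := by
    funext j
    rw [fr.hcoeff_chi hσ, hv]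
  rw [fr.lieDerivMetric_eq hcov t hσ hv hA hB, fr.curvMat_eq hcov.toIsSO3Connection hσ,
    fr.curvMat_eq hcov.toIsSO3Connection hσ, hwA, hwB, hξ, Finset.sum_add_distrib,
    sum_quadPolar_mul hv1 hvA (fun k ↦ fr.hcoeff k σ (B σ)),
    sum_quadPolar_mul hv1 hvB (fun k ↦ fr.hcoeff k σ (A σ)), Matrix.trace_add, trace_lie_mul,
    trace_lie_mul]
  simp only [AdaptedFrame.defect, LinearMap.add_apply, LinearMap.smul_apply, projLin_apply,
    add_dotProduct, smul_dotProduct, smul_eq_mul]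
  ring

/-- In an adapted frame, the points of `𝕋` over `x` are the unit vectors of `ℝ³ = so(3)`. -/
theorem AdaptedFrame.exists_fmat_eq {σ : EndTM M} (hσ : σ.1 ∈ fr.U) (h : σ ∈ S.twistorSpace) :
    ∃ v : Fin 3 → ℝ, fr.fmat σ = so3Mat v ∧ v ⬝ᵥ v = 1 := by
  obtain ⟨v, hv⟩ := (fr.adapted σ.1 hσ).mem_lambda23.1 h.1
  refine ⟨v, hv, ?_⟩
  have h1 := h.2
  rw [(fr.isON hσ).bivInner_eq, hv, sum_so3Mat_mul] at h1
  linarith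

theorem AdaptedFrame.mem_twistorSpace {x : M} (hx : x ∈ fr.U) {v : Fin 3 → ℝ} (hv : v ⬝ᵥ v = 1) :
    (⟨x, ofMat S (fun i ↦ fr.e i x) (so3Mat v)⟩ : EndTM M) ∈ S.twistorSpace := by
  have h1 := (fr.isON hx).mat_ofMat (so3Mat v)
  refine ⟨(fr.adapted x hx).mem_lambda23.2 ⟨v, h1⟩, ?_⟩
  rw [(fr.isON hx).bivInner_eq, h1, sum_so3Mat_mul, hv]
  norm_num

/-- In an adapted frame, `𝓥_σ` is the orthogonal complement of `v` in `ℝ³ = so(3)`. -/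
theorem AdaptedFrame.mem_twistorTangent_iff {σ : EndTM M} (hσ : σ.1 ∈ fr.U) {v : Fin 3 → ℝ}
    (hv : fr.fmat σ = so3Mat v) (A : TangentSpace IEnd σ) :
    A ∈ S.twistorTangent cov σ ↔ ∃ w, fr.vmat cov σ A = so3Mat w ∧ v ⬝ᵥ w = 0 := by
  have key : ∀ w, fr.vmat cov σ A = so3Mat w → bivInner (connMap cov σ A) σ.2 = 5 * v ⬝ᵥ w := by
    intro w hw
    have h1 := (fr.isON hσ).bivInner_eq (connMap cov σ A) σ.2
    have h2 : mat S (fun i ↦ fr.e i σ.1) (connMap cov σ A) = so3Mat w := hw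
    have h3 : mat S (fun i ↦ fr.e i σ.1) σ.2 = so3Mat v := hv
    rw [h1, h2, h3, sum_so3Mat_mul, dotProduct_comm]
    ring
  constructor
  · rintro ⟨h1, h2⟩
    obtain ⟨w, hw⟩ := (fr.adapted σ.1 hσ).mem_lambda23.1 h1
    rw [key w hw] at h2
    exact ⟨w, hw, by linarith⟩
  · rintro ⟨w, hw, hvw⟩
    refine ⟨(fr.adapted σ.1 hσ).mem_lambda23.2 ⟨w, hw⟩, ?_⟩
    rw [key w hw, hvw, mul_zero]

theorem so3Mat_zero : so3Mat 0 = 0 := map_zero so3Lin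

/-- The open set of the points of `End(TM)` over the domain of a frame. -/
def AdaptedFrame.dom : Set (EndTM M) := {τ | τ.1 ∈ fr.U}

theorem AdaptedFrame.isOpen_dom : IsOpen fr.dom :=
  contMDiff_base.continuous.isOpen_preimage _ fr.isOpen

variable (cov) in
/-- The horizontal field with constant coefficients in the frame. -/
def AdaptedFrame.horField (b : Fin 5 → ℝ) (τ : EndTM M) : TangentSpace IEnd τ :=
  hlift cov τ (∑ i, b i • fr.e i τ.1)

/-- The fundamental vertical field of the infinitesimal rotation `w`. -/
def AdaptedFrame.verField (w : Fin 3 → ℝ) (τ : EndTM M) : TangentSpace IEnd τ :=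
  vlift τ (ofMat S (fun i ↦ fr.e i τ.1) (so3Mat w * fr.fmat τ - fr.fmat τ * so3Mat w))

theorem AdaptedFrame.vmat_verField (w : Fin 3 → ℝ) {τ : EndTM M} (hτ : τ.1 ∈ fr.U) :
    fr.vmat cov τ (fr.verField w τ) = so3Mat w * fr.fmat τ - fr.fmat τ * so3Mat w := by
  rw [AdaptedFrame.verField, fr.vmat_vlift, (fr.isON hτ).mat_ofMat]

theorem AdaptedFrame.isTwistorField_horField
    [CovariantDerivative.ContMDiffCovariantDerivative cov ∞]
    (hcov : S.IsSO3Connection cov) (b : Fin 5 → ℝ) :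
    S.IsTwistorField cov fr.dom (fr.horField cov b) := by
  refine ⟨fun σ (hσ : σ.1 ∈ fr.U) ↦ ContMDiffAt.contMDiffWithinAt
    (fr.contMDiffAt_of_coeff hcov hσ (fun i ↦ ?_) fun i j ↦ ?_), fun σ hσ ↦ ?_⟩
  · refine (contMDiffAt_const (c := b i)).congr_of_eventuallyEq ?_
    filter_upwards [fr.eventually_base_mem hσ] with τ hτ using fr.hcoeff_hlift τ hτ b i
  · simp only [AdaptedFrame.horField, fr.vmat_hlift]
    exact contMDiffAt_const
  · obtain ⟨v, hv, -⟩ := fr.exists_fmat_eq hσ.1 hσ.2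
    refine (fr.mem_twistorTangent_iff hσ.1 hv _).2 ⟨0, ?_, dotProduct_zero v⟩
    rw [AdaptedFrame.horField, fr.vmat_hlift, so3Mat_zero]

theorem AdaptedFrame.isTwistorField_verField
    [CovariantDerivative.ContMDiffCovariantDerivative cov ∞]
    (hcov : S.IsSO3Connection cov) (w : Fin 3 → ℝ) :
    S.IsTwistorField cov fr.dom (fr.verField w) := by
  refine ⟨fun σ (hσ : σ.1 ∈ fr.U) ↦ ContMDiffAt.contMDiffWithinAt
    (fr.contMDiffAt_of_coeff hcov hσ (fun i ↦ ?_) fun i j ↦ ?_), fun σ hσ ↦ ?_⟩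
  · simp only [AdaptedFrame.verField, fr.hcoeff_vlift]
    exact contMDiffAt_const
  · have hc : SmoothEntries IEnd (fun _ : EndTM M ↦ so3Mat w) σ := fun _ _ ↦ contMDiffAt_const
    have hf := fr.smoothEntries_fmat σ
    refine ((hc.mul hf).sub (hf.mul hc) i j).congr_of_eventuallyEq ?_
    filter_upwards [fr.eventually_base_mem hσ] with τ hτ
    rw [fr.vmat_verField w hτ]
  · obtain ⟨v, hv, -⟩ := fr.exists_fmat_eq hσ.1 hσ.2
    refine (fr.mem_twistorTangent_iff hσ.1 hv _).2 ⟨v ⨯₃ w, ?_, dot_self_cross v w⟩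
    rw [fr.vmat_verField w hσ.1, hv, so3Mat_lie, ← cross_anticomm, ← neg_one_smul ℝ (v ⨯₃ w),
      (isLinear_so3Mat _ 0 _).2, neg_one_smul, neg_neg]

theorem smoothFieldAt_of_isTwistorField {U : Set (EndTM M)} (hU : IsOpen U)
    {σ : EndTM M} (hσ : σ ∈ U) {A : (τ : EndTM M) → TangentSpace IEnd τ}
    (hA : S.IsTwistorField cov U A) : SmoothFieldAt A σ :=
  (hA.1 σ hσ).contMDiffAt (hU.mem_nhds hσ)

/-- If the defect vanishes at the base point of `σ`, then so does the Lie derivative at `σ`. -/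
theorem AdaptedFrame.lieDerivMetric_eq_zero
    [CovariantDerivative.ContMDiffCovariantDerivative cov ∞]
    (hcov : S.IsCharacteristic cov) {t : ℝ} {σ : EndTM M} (hσ : σ.1 ∈ fr.U)
    (hT : σ ∈ S.twistorSpace) (hD : fr.defect cov t σ.1 = 0) {U : Set (EndTM M)} (hU : IsOpen U)
    (hσU : σ ∈ U) {A B : (τ : EndTM M) → TangentSpace IEnd τ} (hA : S.IsTwistorField cov U A)
    (hB : S.IsTwistorField cov U B) : S.lieDerivMetric cov t A B σ = 0 := by
  obtain ⟨v, hv, hv1⟩ := fr.exists_fmat_eq hσ hT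
  obtain ⟨wA, hwA, hvA⟩ := (fr.mem_twistorTangent_iff hσ hv _).1 (hA.2 σ ⟨hσU, hT⟩)
  obtain ⟨wB, hwB, hvB⟩ := (fr.mem_twistorTangent_iff hσ hv _).1 (hB.2 σ ⟨hσU, hT⟩)
  rw [fr.lieDerivMetric_eq_defect hcov t hσ hv hv1 (smoothFieldAt_of_isTwistorField hU hσU hA)
    (smoothFieldAt_of_isTwistorField hU hσU hB) hwA hvA hwB hvB, hD]
  simp

/-- The Killing equation, for a horizontal and a vertical field, forces the defect to vanish. -/
theorem AdaptedFrame.defect_eq_zero [CovariantDerivative.ContMDiffCovariantDerivative cov ∞]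
    (hcov : S.IsCharacteristic cov) {t : ℝ} (h : S.IsKilling cov t) {x : M} (hx : x ∈ fr.U) :
    fr.defect cov t x = 0 := by
  refine eq_zero_of_cross_eq_zero _ (fr.defect_skew t x) fun v hv b ↦ ?_
  have hcov' := hcov.toIsSO3Connection
  set σ : EndTM M := ⟨x, ofMat S (fun i ↦ fr.e i x) (so3Mat v)⟩ with hσdef
  have hσ : σ.1 ∈ fr.U := hx
  have hT : σ ∈ S.twistorSpace := fr.mem_twistorSpace hx hv
  have hF : fr.fmat σ = so3Mat v := (fr.isON hx).mat_ofMat _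
  set d := fr.defect cov t x (quad (so3Mat v)) b with hd
  have hA := fr.isTwistorField_verField (cov := cov) hcov' d
  have hB := fr.isTwistorField_horField (cov := cov) hcov' b
  have hwA : fr.vmat cov σ (fr.verField d σ) = so3Mat (v ⨯₃ d) := by
    rw [fr.vmat_verField d hσ, hF, so3Mat_lie, ← cross_anticomm, ← neg_one_smul ℝ (v ⨯₃ d),
      (isLinear_so3Mat _ 0 _).2, neg_one_smul, neg_neg]
  have hwB : fr.vmat cov σ (fr.horField cov b σ) = so3Mat 0 := by
    rw [AdaptedFrame.horField, fr.vmat_hlift, so3Mat_zero]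
  have h1 := h σ hT fr.dom fr.isOpen_dom hσ _ _ hA hB
  rw [fr.lieDerivMetric_eq_defect hcov t hσ hF hv
    (smoothFieldAt_of_isTwistorField fr.isOpen_dom hσ hA)
    (smoothFieldAt_of_isTwistorField fr.isOpen_dom hσ hB) hwA (dot_self_cross v d) hwB
    (dotProduct_zero v)] at h1
  have h2 : (fun k ↦ fr.hcoeff k σ (fr.horField cov b σ)) = b :=
    funext fun k ↦ fr.hcoeff_hlift σ hσ b k
  rw [h2, LinearMap.map_zero, dotProduct_zero, mul_zero, add_zero] at h1
  -- With `d` the value of the defect, the equation reads `d · (v × (v × d)) = -|d × v|² = 0`.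
  have h3 : (d ⨯₃ v) ⬝ᵥ (d ⨯₃ v) = 0 := by
    have h4 : d ⬝ᵥ v ⨯₃ (v ⨯₃ d) = 0 := by
      have h5 : 5 * d ⬝ᵥ v ⨯₃ (v ⨯₃ d) = 0 := h1
      linarith
    rw [triple_product_permutation, triple_product_permutation, ← cross_anticomm d v,
      neg_dotProduct, neg_eq_zero] at h4
    exact h4
  exact dotProduct_self_eq_zero.1 h3

/-- If `χ` is a conformal Killing field, it is Killing: on a unit horizontal field, the Lie
derivative of the metric vanishes, so that the conformal factor does. -/
theorem isKilling_of_isConformalKilling [T2Space M]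
    [CovariantDerivative.ContMDiffCovariantDerivative cov ∞]
    (hcov : S.IsCharacteristic cov) {t : ℝ} (h : S.IsConformalKilling cov t) :
    S.IsKilling cov t := by
  obtain ⟨f, hf⟩ := h
  intro σ hT U hU hσU A B hA hB
  obtain ⟨fr⟩ := exists_adaptedFrame (S := S) σ.1
  have hσ : σ.1 ∈ fr.U := fr.mem
  have hH := fr.isTwistorField_horField (cov := cov) hcov.toIsSO3Connection (Pi.single 0 1)
  have hHs := smoothFieldAt_of_isTwistorField fr.isOpen_dom (σ := σ) hσ hH
  obtain ⟨v, hv, hv1⟩ := fr.exists_fmat_eq hσ hT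
  have hw : fr.vmat cov σ (fr.horField cov (Pi.single 0 1) σ) = so3Mat 0 := by
    rw [AdaptedFrame.horField, fr.vmat_hlift, so3Mat_zero]
  have h1 := hf ⟨σ, hT⟩ fr.dom fr.isOpen_dom hσ _ _ hH hH
  have h2 : ∀ k, fr.hcoeff k σ (fr.horField cov (Pi.single 0 1) σ) =
      (Pi.single 0 1 : Fin 5 → ℝ) k := fun k ↦ fr.hcoeff_hlift σ hσ _ k
  rw [fr.lieDerivMetric_eq_defect hcov t hσ hv hv1 hHs hHs hw (dotProduct_zero v) hw
    (dotProduct_zero v), LinearMap.map_zero, dotProduct_zero, fr.hMetric_eq t hσ, hw,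
    so3Mat_zero] at h1
  have h3 : f ⟨σ, hT⟩ = 0 := by simpa [h2, Pi.single_apply] using h1.symm
  rw [hf ⟨σ, hT⟩ U hU hσU A B hA hB, h3, zero_mul]

theorem isKilling_iff_hasConstantCurvature [T2Space M]
    [CovariantDerivative.ContMDiffCovariantDerivative cov ∞]
    (hcov : S.IsCharacteristic cov) {t : ℝ} (ht : 0 < t) :
    S.IsKilling cov t ↔ S.HasConstantCurvature cov t⁻¹ := by
  constructor
  · intro h p
    obtain ⟨fr⟩ := exists_adaptedFrame (S := S) p
    exact (fr.curvature_eq_iff hcov.toIsSO3Connection ht fr.mem).2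
      (fr.defect_eq_zero hcov h fr.mem)
  · intro h σ hT U hU hσU A B hA hB
    obtain ⟨fr⟩ := exists_adaptedFrame (S := S) σ.1
    exact fr.lieDerivMetric_eq_zero hcov fr.mem hT
      ((fr.curvature_eq_iff hcov.toIsSO3Connection ht fr.mem).1 (h σ.1)) hU hσU hA hB

end Killing

end IrreducibleSO3Structure
end SO3Twistor
end

theorem mainTheorem7 {M : Type*} [TopologicalSpace M] [T2Space M]
    [ChartedSpace SO3Twistor.E5 M] [IsManifold (𝓡 5) ∞ M]
    (S : SO3Twistor.IrreducibleSO3Structure M)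
    (cov : CovariantDerivative (𝓡 5) SO3Twistor.E5 (fun p : M ↦ TangentSpace (𝓡 5) p))
    [CovariantDerivative.ContMDiffCovariantDerivative cov ∞]
    (hcov : S.IsCharacteristic cov) (t : ℝ) (ht : 0 < t) :
    (S.IsConformalKilling cov t → S.IsKilling cov t) ∧
      (S.IsKilling cov t ↔ S.HasConstantCurvature cov t⁻¹) :=
  ⟨SO3Twistor.IrreducibleSO3Structure.isKilling_of_isConformalKilling hcov,
    SO3Twistor.IrreducibleSO3Structure.isKilling_iff_hasConstantCurvature hcov ht⟩
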